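/- Write $\mathbf e(x)=e^{2\pi i x}$ and, for $\mathrm{Im}\,\tau>0$ and $z,u,v\in\mathbb C$, put $q=\mathbf e(\tau)$, $t=\mathbf e(z)$, $\lambda=\mathbf e(u)$, $\mu=\mathbf e(v)$, $\tilde q=\mathbf e(-1/\tau)$, $\tilde t=\mathbf e(z/\tau)$, $\tilde t^{-1/2}=\mathbf e(-z/(2\tau))$, $\tilde q^{1/8}=\mathbf e(-1/(8\tau))$, and let $\sqrt\tau$ be the principal branch. Let $(a;q)_\infty=\prod_{n\ge 0}(1-aq^n)$, $\theta(t;q)=\sum_{k\in\mathbb Z}(-1)^kq^{k(k+1)/2}t^k$, and consider the Appell–Lerch equation $$f(q^2t)+(qt-1)f(qt)-tf(t)=0 .$$ Put $$f^{(0)}(t,\lambda,q)=\frac1{\theta(\lambda;q)}\sum_{\ell\in\mathbb Z}(-1)^\ell\frac{q^{\ell(\ell+1)/2}\lambda^\ell}{1-\lambda tq^\ell},\qquad f^{(-1)}(t,q)=\frac1{\theta(q^{-1}t;q)},$$ $g^{(0)}(t,\mu,q)=f^{(0)}(t,\mu,q)$, $g^{(-1)}=f^{(-1)}$, and $$U(t,\lambda,q)=\begin{pmatrix}f^{(0)}(t,\lambda,q)&f^{(-1)}(t,q)\\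 f^{(0)}(qt,\lambda,q)&f^{(-1)}(qt,q)\end{pmatrix},\qquad V(t,\mu,q)=\begin{pmatrix}g^{(0)}(t,\mu,q)&g^{(-1)}(t,q)\\ g^{(0)}(qt,\mu,q)&g^{(-1)}(qt,q)\end{pmatrix},$$ regarded as functions of $(z,u,\tau)$ and $(z,v,\tau)$. All identities between them are meant at the points with $z,u,v,z+u,z+v\notin\mathbb Z+\tau\mathbb Z$ (for those of the variables $u,v$ that occur). For $\gamma=\begin{pmatrix}a&b\\c&d\end{pmatrix}\in\mathrm{SL}_2(\mathbb Z)$ and a matrix function $F(w,\tau)$ of Jacobi variables $w$ (one or several of $z,u,v$), let $$(F|_\kappa\gamma)(w,\tau)=F\Big(\frac{w}{c\tau+d},\frac{a\tau+b}{c\tau+d}\Big)\,\mathrm{diag}\big((c\tau+d)^{-\kappa_i}\big),\qquad \Delta_{\kappa,\gamma}(\tau)=\mathrm{diag}\big((c\tau+d)^{\kappa_i}\big),$$ with weights $\kappa=(\kappa_1,\kappa_2)=(1,0)$ for both $U$ and $V$, and let $\Omega_{U,\gamma}=(U|_\kappa\gamma)U^{-1}$, $\Omega_{V,\gamma}=(V|_\kappa\gamma)V^{-1}$.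 Let $\mathbb C_\gamma$ be $\mathbb C\setminus(-\infty,-d/c]$ if $c>0$, $\mathbb C\setminus[-d/c,\infty)$ if $c<0$, and $\mathbb C\setminus\mathbb R$ if $c=0$. **Theorem.** The columns of $U$ and of $V$ come from solutions of the equation, and $\det U\ne0$, $\det V\neq 0$. Moreover: (a) The monodromy matrix $M(t,\lambda,\mu,q)=V(t,\mu,q)^{-1}U(t,\lambda,q)$ equals $\begin{pmatrix}1&0\\M_{2,1}&1\end{pmatrix}$ with $$M_{2,1}(t,\lambda,\mu,q)=-\frac{(q;q)_\infty^3\,\theta(q^{-1}t;q)\,\theta(\lambda^{-1}\mu;q)\,\theta(\lambda^{-1}\mu^{-1}t^{-1};q)}{\theta(\lambda^{-1};q)\,\theta(\mu;q)\,\theta(\lambda^{-1}t^{-1};q)\,\theta(\mu^{-1}t^{-1};q)},$$ and it satisfies $M=\Delta_{\kappa,\gamma}\,(M|_\kappa\gamma)$ for all $\gamma\in\mathrm{SL}_2(\mathbb Z)$. (b) For every $\gamma\in\mathrm{SL}_2(\mathbb Z)$, $\Omega_{U,\gamma}$ and $\Omega_{V,\gamma}$ are equal and independent of $\lambda$ and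 $\mu$, hence one function $\Omega_\gamma(z,\tau)$; these satisfy $\Omega_{\gamma\gamma'}(z,\tau)=\Omega_\gamma(\gamma'(z,\tau))\,\Omega_{\gamma'}(z,\tau)$, where $\gamma(z,\tau)=\big(\frac z{c\tau+d},\frac{a\tau+b}{c\tau+d}\big)$. They are modular: $\Omega_\gamma$ extends to a meromorphic function of $(z,\tau)\in\mathbb C\times\mathbb C_\gamma$ whose poles lie at $z\in S_\gamma+\mathbb Z+\tau\mathbb Z$ for a finite set $S_\gamma$. For $\gamma=S=\begin{pmatrix}0&-1\\1&0\end{pmatrix}$ and $\mathrm{Im}\,\tau>0$, $$\Omega_S(z,\tau)=\begin{pmatrix}0&1\\1&-\tilde t\end{pmatrix}\begin{pmatrix}\tau^{-1}&0\\ \dfrac{\mathbf e(-\frac18)}{\sqrt\tau}\,\tilde t^{-\frac12}\tilde q^{\frac18}\,\mathbf e\big(-\frac{z^2}{2\tau}\big)h(z,\tau)&\dfrac{\mathbf e(\frac18)}{\sqrt\tau}\,\mathbf e\Big(-\frac{(z+1/2-\tau/2)^2}{2\tau}\Big)\end{pmatrix}\begin{pmatrix}0&1\\1&-t\end{pmatrix}^{-1},$$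 where $h(z,\tau)=\int_{\mathbb R}\dfrac{e^{\pi i(\tau x^2+2izx)}}{2\cosh(\pi x)}\,dx$ is the Mordell integral. -/

import Mathlib

noncomputable section

namespace AppellLerch

/-! ### Theta function, Pochhammer symbol, Mordell integral -/

/-- `e(x) = exp(2πix)`. -/
def e (x : ℂ) : ℂ := Complex.exp (2 * Real.pi * Complex.I * x)

/-- The Jacobi theta function `θ(t;q) = ∑_{k ∈ ℤ} (-1)^k q^{k(k+1)/2} t^k` (for `|q| < 1`, `t ≠ 0`);
the exponent `k(k+1)/2` is an integer, so the division in `ℤ` is exact. -/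
def theta (t q : ℂ) : ℂ :=
  ∑' k : ℤ, (-1 : ℂ) ^ k * q ^ (k * (k + 1) / 2) * t ^ k

/-- The infinite Pochhammer symbol `(a;q)_∞ = ∏_{n ≥ 0} (1 - a qⁿ)` (for `|q| < 1`). -/
def qPochhammerInf (a q : ℂ) : ℂ := ∏' n : ℕ, (1 - a * q ^ n)

/-- The Mordell integral. -/
def mordell (z τ : ℂ) : ℂ :=
  ∫ x : ℝ, Complex.exp (Real.pi * Complex.I * (τ * (x : ℂ) ^ 2 + 2 * Complex.I * z * x)) /
    (2 * Complex.cosh (Real.pi * x))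

/-! ### The Appell–Lerch `q`-difference equation and its solutions -/

/-- The equation `f(q²t) + (qt - 1) f(qt) - t f(t) = 0` at the point `t`. -/
def SolvesAt (q t : ℂ) (f : ℂ → ℂ) : Prop :=
  f (q ^ 2 * t) + (q * t - 1) * f (q * t) - t * f t = 0

/-- The solution `f⁽⁰⁾(t, lam, q)` at `t = 0`. -/
def f0 (t lam q : ℂ) : ℂ :=
  (theta lam q)⁻¹ *
    ∑' l : ℤ, (-1 : ℂ) ^ l * (q ^ (l * (l + 1) / 2) * lam ^ l / (1 - lam * t * q ^ l))

/-- The solution `f⁽⁻¹⁾(t, q)` at `t = 0`. -/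
def fNeg1 (t q : ℂ) : ℂ := (theta (q⁻¹ * t) q)⁻¹

/-- The solution `g⁽⁰⁾(t, mu, q)` at `t = ∞`. -/
def g0 (t mu q : ℂ) : ℂ :=
  (theta mu q)⁻¹ *
    ∑' l : ℤ, (-1 : ℂ) ^ l * (q ^ (l * (l + 1) / 2) * mu ^ l / (1 - mu * t * q ^ l))

/-- The solution `g⁽⁻¹⁾(t, q)` at `t = ∞`. -/
def gNeg1 (t q : ℂ) : ℂ := (theta (q⁻¹ * t) q)⁻¹

/-- The `q`-Wronskian `W(f₁, …, f_r)_{ij} = f_j(q^{i-1} t)`. -/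
def qWronskian {r : ℕ} (q : ℂ) (f : Fin r → ℂ → ℂ) (t : ℂ) : Matrix (Fin r) (Fin r) ℂ :=
  Matrix.of fun i j => f j (q ^ (i : ℕ) * t)

/-- The pair of solutions at `t = 0`. -/
def solU (lam q : ℂ) : Fin 2 → ℂ → ℂ := ![fun t => f0 t lam q, fun t => fNeg1 t q]

/-- The pair of solutions at `t = ∞`. -/
def solV (mu q : ℂ) : Fin 2 → ℂ → ℂ := ![fun t => g0 t mu q, fun t => gNeg1 t q]

/-- The fundamental matrix at `t = 0`. -/
def U (t lam q : ℂ) : Matrix (Fin 2) (Fin 2) ℂ := qWronskian q (solU lam q) t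

/-- The fundamental matrix at `t = ∞`. -/
def V (t mu q : ℂ) : Matrix (Fin 2) (Fin 2) ℂ := qWronskian q (solV mu q) t

/-- The monodromy (connection) matrix `M = V⁻¹ U`. -/
def M (t lam mu q : ℂ) : Matrix (Fin 2) (Fin 2) ℂ := (V t mu q)⁻¹ * U t lam q

/-- The theta quotient in the `(2,1)` entry of the monodromy. -/
def M21 (t lam mu q : ℂ) : ℂ :=
  -(qPochhammerInf q q ^ 3 * theta (q⁻¹ * t) q * theta (lam⁻¹ * mu) q *
      theta (lam⁻¹ * mu⁻¹ * t⁻¹) q) /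
    (theta lam⁻¹ q * theta mu q * theta (lam⁻¹ * t⁻¹) q * theta (mu⁻¹ * t⁻¹) q)

/-! ### Passage to the variables `t = e(z)`, `lam = e(u)`, `mu = e(v)`, `q = e(τ)` -/

/-- `U` as a function of `w = (z, u)` and `τ`. -/
def UJ (w : ℂ × ℂ) (τ : ℂ) : Matrix (Fin 2) (Fin 2) ℂ := U (e w.1) (e w.2) (e τ)

/-- `V` as a function of `w = (z, v)` and `τ`. -/
def VJ (w : ℂ × ℂ) (τ : ℂ) : Matrix (Fin 2) (Fin 2) ℂ := V (e w.1) (e w.2) (e τ)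

/-- `M` as a function of `w = (z, u, v)` and `τ`. -/
def MJ (w : ℂ × ℂ × ℂ) (τ : ℂ) : Matrix (Fin 2) (Fin 2) ℂ :=
  M (e w.1) (e w.2.1) (e w.2.2) (e τ)

/-- The lattice `ℤ + τℤ`. -/
def lattice (τ : ℂ) : Set ℂ := {z | ∃ m n : ℤ, z = m + n * τ}

/-- The domain of the fundamental matrices: `Im τ > 0`, and none of the factors
`θ(q⁻¹t;q)`, `θ(lam;q)`, `1 - lam t q^l` in the denominators vanishes. -/
def Regular (z u τ : ℂ) : Prop :=
  0 < τ.im ∧ z ∉ lattice τ ∧ u ∉ lattice τ ∧ z + u ∉ lattice τ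

/-! ### Slash operator and cocycles -/

/-- The automorphy factor `cτ + d`. -/
def autFactor (γ : Matrix.SpecialLinearGroup (Fin 2) ℤ) (τ : ℂ) : ℂ := γ 1 0 * τ + γ 1 1

/-- The Möbius action `(aτ + b) / (cτ + d)`. -/
def moebius (γ : Matrix.SpecialLinearGroup (Fin 2) ℤ) (τ : ℂ) : ℂ :=
  (γ 0 0 * τ + γ 0 1) / autFactor γ τ

/-- `Δ_{κ,γ}(τ) = diag((cτ + d)^{κ_i})`. -/
def Delta {r : ℕ} (κ : Fin r → ℤ) (γ : Matrix.SpecialLinearGroup (Fin 2) ℤ) (τ : ℂ) :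
    Matrix (Fin r) (Fin r) ℂ :=
  Matrix.diagonal fun i => autFactor γ τ ^ κ i

/-- The slash operator of weight `κ` on a matrix-valued function of a tuple `w ∈ E` of Jacobi
variables (`E` is `ℂ × ℂ` for `U` and `V`, and `ℂ × ℂ × ℂ` for `M`) and of `τ`:
`(F|_κ γ)(w, τ) = F(w/(cτ+d), (aτ+b)/(cτ+d)) · diag((cτ+d)^{-κ_i})`. -/
def slash {E : Type*} [AddCommGroup E] [Module ℂ E] {r : ℕ} (κ : Fin r → ℤ)
    (γ : Matrix.SpecialLinearGroup (Fin 2) ℤ) (F : E → ℂ → Matrix (Fin r) (Fin r) ℂ)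
    (w : E) (τ : ℂ) : Matrix (Fin r) (Fin r) ℂ :=
  F ((autFactor γ τ)⁻¹ • w) (moebius γ τ) *
    Matrix.diagonal fun i => autFactor γ τ ^ (-κ i)

/-- The cocycle `Ω_{F,γ} = (F|_κ γ) F⁻¹` of a fundamental matrix `F`. -/
def cocycle {E : Type*} [AddCommGroup E] [Module ℂ E] {r : ℕ} (κ : Fin r → ℤ)
    (γ : Matrix.SpecialLinearGroup (Fin 2) ℤ) (F : E → ℂ → Matrix (Fin r) (Fin r) ℂ)
    (w : E) (τ : ℂ) : Matrix (Fin r) (Fin r) ℂ :=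
  slash κ γ F w τ * (F w τ)⁻¹

/-- The weights of `U` and of `V`: weight `1` for the first column, `0` for the second. -/
def weight : Fin 2 → ℤ := ![1, 0]

/-! ### Modularity -/

/-- The cut plane `ℂ_γ`: `ℂ ∖ (-∞, -d/c]` if `c > 0`, `ℂ ∖ [-d/c, ∞)` if `c < 0`, and
`ℂ ∖ ℝ` if `c = 0`. -/
def cutPlane (γ : Matrix.SpecialLinearGroup (Fin 2) ℤ) : Set ℂ :=
  {τ | τ.im = 0 →
    (0 < γ 1 0 ∧ -(γ 1 1 : ℝ) / (γ 1 0 : ℝ) < τ.re) ∨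
    (γ 1 0 < 0 ∧ τ.re < -(γ 1 1 : ℝ) / (γ 1 0 : ℝ))}

/-- A function of two complex variables is meromorphic on `D` if near every point of `D` it is a
quotient of two holomorphic functions, the denominator not vanishing identically near the point. -/
def IsMeromorphicOn (f : ℂ × ℂ → ℂ) (D : Set (ℂ × ℂ)) : Prop :=
  ∀ p ∈ D, ∃ g h : ℂ × ℂ → ℂ, AnalyticAt ℂ g p ∧ AnalyticAt ℂ h p ∧
    (¬ ∀ᶠ x in nhds p, h x = 0) ∧ ∀ᶠ x in nhds p, h x ≠ 0 → f x = g x / h x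

/-- `F` is a meromorphic matrix-valued function of `(z, τ) ∈ ℂ × ℂ_γ`, holomorphic outside
`z ∈ S + ℤ + τℤ` for some finite set `S`. -/
def IsModularOn {r : ℕ} (γ : Matrix.SpecialLinearGroup (Fin 2) ℤ)
    (F : ℂ × ℂ → Matrix (Fin r) (Fin r) ℂ) : Prop :=
  (∀ i j, IsMeromorphicOn (fun p => F p i j) {p | p.2 ∈ cutPlane γ}) ∧
  ∃ S : Set ℂ, S.Finite ∧ ∀ p : ℂ × ℂ, p.2 ∈ cutPlane γ →
    (∀ s ∈ S, p.1 - s ∉ lattice p.2) → ∀ i j, AnalyticAt ℂ (fun x => F x i j) p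

/-- The explicit matrix for `γ = S`; `√τ` is the principal branch, and with
`t̃ = e(z/τ)`, `q̃ = e(-1/τ)` one has `t̃^{-1/2} = e(-z/(2τ))` and `q̃^{1/8} = e(-1/(8τ))`. -/
def omegaS (z τ : ℂ) : Matrix (Fin 2) (Fin 2) ℂ :=
  !![0, 1; 1, -e (z / τ)] *
  !![τ⁻¹, 0;
     e (-1 / 8) / τ ^ (1 / 2 : ℂ) * e (-z / (2 * τ)) * e (-1 / (8 * τ)) *
        e (-z ^ 2 / (2 * τ)) * mordell z τ,
     e (1 / 8) / τ ^ (1 / 2 : ℂ) * e (-(z + 1 / 2 - τ / 2) ^ 2 / (2 * τ))] *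
  (!![0, 1; 1, -e z])⁻¹

end AppellLerch

end

noncomputable section

namespace AppellLerch

open Complex Filter Topology MeasureTheory
open scoped MatrixGroups

/-! ### The exponential `e` -/

/-! Everything rests on two first-order relations: the Appell–Lerch sum satisfies f(qt) = 1 - t f(t)
for every λ, and 1/θ(q⁻¹t) satisfies f(qt) = -t f(t). Subtracting such a relation at t from the same
relation at qt gives the second-order equation. They also give det U = -1/θ(q⁻¹t).

The inhomogeneous term 1 does not involve λ. Hence the difference of two Appell–Lerch sums satisfies
the homogeneous relation, and its product with θ(q⁻¹t) is elliptic in z. The theta quotient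
`connQuot` has the same multiplier and the same residues at z = -u and z = -v, and θ(q⁻¹t) vanishes
at z = 0. Liouville's theorem, in the form `elliptic_eq_zero`, therefore gives the connection
formula `f0_sub_f0` and with it the monodromy. The Jacobi triple product supplies the zeros of θ and
the constant (q;q)³.

The same argument proves the transformation `f0_S` under τ ↦ -1/τ. The transformed sum and
`thetaFactor` times the original one have equal residues. Their difference fails to be
quasi-periodic exactly as the entire function `mordellPeriod` does, by the two functional equations
of the Mordell integral: one from moving the line of integration across a pole of 1/cosh, the other
from a Gaussian integral. None of the correction terms involves u, so U|S = Ω_S U with Ω_S a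
function of (z, τ) alone.

Rotating the line of integration continues the Mordell integral to the plane slit along (-∞, 0]
(`mordellExt_eq`), and Osgood's lemma makes the continuation jointly analytic. For c > 0 the
Euclidean algorithm writes γ as a product of inversions composed with translations, ending in a
matrix with c = 0. Extensions multiply by the cocycle rule, because each Möbius map carries the slit
domain into that of the next factor. For c < 0 the extension for γ⁻¹ is inverted, which is possible
because the determinants never vanish. The extensions obtained are in fact holomorphic. Finally U
and V acquire the same left factor, which cancels in V⁻¹U; this is the transformation law of M. -/

lemma e_add (x y : ℂ) : e (x + y) = e x * e y := by
  simp only [e, mul_add, Complex.exp_add]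

lemma e_neg (x : ℂ) : e (-x) = (e x)⁻¹ := by
  simp only [e, mul_neg, Complex.exp_neg]

lemma e_sub (x y : ℂ) : e (x - y) = e x / e y := by
  rw [sub_eq_add_neg, e_add, e_neg, div_eq_mul_inv]

@[simp] lemma e_ne_zero (x : ℂ) : e x ≠ 0 := Complex.exp_ne_zero _

@[simp] lemma e_zero : e 0 = 1 := by simp [e]

lemma e_int_mul (n : ℤ) (x : ℂ) : e (n * x) = e x ^ n := by
  rw [e, e, ← Complex.exp_int_mul]; congr 1; ring

lemma e_eq_one_iff {x : ℂ} : e x = 1 ↔ ∃ n : ℤ, x = n := by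
  rw [e, Complex.exp_eq_one_iff]
  have h : (2 * Real.pi * I : ℂ) ≠ 0 := Complex.two_pi_I_ne_zero
  refine exists_congr fun n => ⟨fun hn => mul_left_cancel₀ h ?_, fun hn => ?_⟩
  · rw [hn]; ring
  · rw [hn]; ring

@[simp] lemma e_one : e 1 = 1 := e_eq_one_iff.2 ⟨1, by simp⟩

@[simp] lemma e_intCast (n : ℤ) : e n = 1 := e_eq_one_iff.2 ⟨n, rfl⟩

lemma e_add_int (x : ℂ) (n : ℤ) : e (x + n) = e x := by rw [e_add, e_intCast, mul_one]

lemma e_eq_e_iff {x y : ℂ} : e x = e y ↔ ∃ n : ℤ, x = y + n := by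
  have : e x = e y ↔ e (x - y) = 1 := by
    rw [e_sub, div_eq_one_iff_eq (e_ne_zero y)]
  rw [this, e_eq_one_iff]
  exact exists_congr fun n => sub_eq_iff_eq_add'

lemma exists_e_eq {x : ℂ} (hx : x ≠ 0) : ∃ z, e z = x := by
  refine ⟨Complex.log x / (2 * Real.pi * I), ?_⟩
  rw [e, mul_div_cancel₀ _ Complex.two_pi_I_ne_zero, Complex.exp_log hx]

lemma norm_e (x : ℂ) : ‖e x‖ = Real.exp (-2 * Real.pi * x.im) := by
  rw [e, Complex.norm_exp]
  congr 1
  simp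

lemma norm_e_lt_one {τ : ℂ} (hτ : 0 < τ.im) : ‖e τ‖ < 1 := by
  rw [norm_e, Real.exp_lt_one_iff]
  have := mul_pos Real.pi_pos hτ
  nlinarith

lemma im_pos_of_norm_e_lt_one {τ : ℂ} (h : ‖e τ‖ < 1) : 0 < τ.im := by
  rw [norm_e, Real.exp_lt_one_iff] at h
  by_contra hc
  push Not at hc
  nlinarith [Real.pi_pos, mul_nonneg Real.pi_pos.le (neg_nonneg.2 hc)]

lemma differentiable_e : Differentiable ℂ e := by
  unfold e; fun_prop

lemma e_half : e (1 / 2) = -1 := by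
  rw [e, ← Complex.exp_pi_mul_I]; congr 1; ring

/-! ### Elementary properties of the theta function -/

/-- The general term of the theta series. -/
def thetaTerm (t q : ℂ) (k : ℤ) : ℂ := (-1 : ℂ) ^ k * q ^ (k * (k + 1) / 2) * t ^ k

lemma theta_eq_tsum (t q : ℂ) : theta t q = ∑' k : ℤ, thetaTerm t q k := rfl

lemma two_mul_half_int (k : ℤ) : 2 * (k * (k + 1) / 2) = k * (k + 1) :=
  Int.mul_ediv_cancel' (Int.even_mul_succ_self k).two_dvd

lemma half_int_succ (k : ℤ) : (k + 1) * (k + 1 + 1) / 2 = k * (k + 1) / 2 + (k + 1) := by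
  have h1 := two_mul_half_int k
  have h2 := two_mul_half_int (k + 1)
  nlinarith

/-- The sign is e(k/2) and q^{k(k+1)/2} is q^{k²/2} q^{k/2}; both linear terms go into the elliptic
argument. Convergence, holomorphy and the inversion formula of θ are then those of `jacobiTheta₂`.
-/
lemma thetaTerm_e (z τ : ℂ) (k : ℤ) :
    thetaTerm (e z) (e τ) k = jacobiTheta₂_term k (z + 1 / 2 + τ / 2) τ := by
  have hk : (2 : ℂ) * ((k * (k + 1) / 2 : ℤ) : ℂ) = k * (k + 1) := by
    exact_mod_cast congrArg (Int.cast (R := ℂ)) (two_mul_half_int k)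
  rw [thetaTerm, ← e_half, ← e_int_mul, ← e_int_mul, ← e_int_mul, ← e_add, ← e_add, e,
    jacobiTheta₂_term]
  congr 1
  linear_combination (Real.pi * I * τ) * hk

lemma theta_e (z τ : ℂ) : theta (e z) (e τ) = jacobiTheta₂ (z + 1 / 2 + τ / 2) τ := by
  rw [theta_eq_tsum, jacobiTheta₂]
  exact tsum_congr (thetaTerm_e z τ)

lemma summable_thetaTerm {t q : ℂ} (ht : t ≠ 0) (hq : q ≠ 0) (hq1 : ‖q‖ < 1) :
    Summable (thetaTerm t q) := by
  obtain ⟨z, rfl⟩ := exists_e_eq ht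
  obtain ⟨τ, rfl⟩ := exists_e_eq hq
  rw [show thetaTerm (e z) (e τ) = (jacobiTheta₂_term · (z + 1 / 2 + τ / 2) τ) from
    funext (thetaTerm_e z τ), summable_jacobiTheta₂_term_iff]
  exact im_pos_of_norm_e_lt_one hq1

lemma thetaTerm_succ {t q : ℂ} (ht : t ≠ 0) (hq : q ≠ 0) (k : ℤ) :
    thetaTerm t q (k + 1) = -(q ^ (k + 1) * t) * thetaTerm t q k := by
  rw [thetaTerm, thetaTerm, half_int_succ, zpow_add₀ hq, zpow_add₀ ht,
    zpow_add₀ (by norm_num : (-1 : ℂ) ≠ 0)]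
  simp only [zpow_one]
  ring

lemma thetaTerm_mul_q {t q : ℂ} (ht : t ≠ 0) (hq : q ≠ 0) (k : ℤ) :
    thetaTerm (q * t) q k = -(q * t)⁻¹ * thetaTerm t q (k + 1) := by
  rw [thetaTerm_succ ht hq, thetaTerm, thetaTerm, mul_zpow, zpow_add_one₀ hq]
  field_simp

lemma theta_mul_q {t q : ℂ} (ht : t ≠ 0) (hq : q ≠ 0) :
    theta (q * t) q = -(q * t)⁻¹ * theta t q := by
  simp only [theta_eq_tsum, thetaTerm_mul_q ht hq]
  rw [tsum_mul_left, (Equiv.addRight (1 : ℤ)).tsum_eq (thetaTerm t q) |>.symm]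
  rfl

lemma theta_div_q {t q : ℂ} (ht : t ≠ 0) (hq : q ≠ 0) :
    theta (q⁻¹ * t) q = -t * theta t q := by
  have := theta_mul_q (mul_ne_zero (inv_ne_zero hq) ht) hq
  rw [mul_inv_cancel_left₀ hq] at this
  rw [this]
  field_simp

lemma thetaTerm_inv {t q : ℂ} (ht : t ≠ 0) (hq : q ≠ 0) (k : ℤ) :
    thetaTerm (q⁻¹ * t⁻¹) q (-k) = thetaTerm t q k := by
  have h : -k * (-k + 1) / 2 = k * (k + 1) / 2 - k := by
    have h1 := two_mul_half_int k
    have h2 := two_mul_half_int (-k)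
    nlinarith
  rw [thetaTerm, thetaTerm, h, mul_zpow, zpow_sub₀ hq]
  simp only [inv_zpow', zpow_neg]
  have : ((-1 : ℂ) ^ k)⁻¹ = (-1) ^ k := by
    rw [← inv_zpow]; norm_num
  rw [this]
  field_simp

lemma theta_q_inv {t q : ℂ} (ht : t ≠ 0) (hq : q ≠ 0) : theta (q⁻¹ * t⁻¹) q = theta t q := by
  simp only [theta_eq_tsum]
  rw [← (Equiv.neg ℤ).tsum_eq (thetaTerm (q⁻¹ * t⁻¹) q)]
  exact tsum_congr (thetaTerm_inv ht hq)

lemma theta_inv {t q : ℂ} (ht : t ≠ 0) (hq : q ≠ 0) : theta t⁻¹ q = -t * theta t q := by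
  have := theta_div_q (inv_ne_zero ht) hq
  rw [theta_q_inv ht hq] at this
  rw [this]
  field_simp

/-! ### The Jacobi triple product -/

/-- The finite Pochhammer symbol `(q;q)_n`. -/
def qFac (q : ℂ) (n : ℕ) : ℂ := ∏ j ∈ Finset.range n, (1 - q ^ (j + 1))

lemma qFac_succ (q : ℂ) (n : ℕ) : qFac q (n + 1) = qFac q n * (1 - q ^ (n + 1)) :=
  Finset.prod_range_succ _ _

lemma one_sub_pow_ne_zero {q : ℂ} (hq1 : ‖q‖ < 1) (n : ℕ) : 1 - q ^ (n + 1) ≠ 0 := by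
  intro h
  have h1 : ‖q ^ (n + 1)‖ < 1 := by
    rw [norm_pow]; exact pow_lt_one₀ (norm_nonneg _) hq1 (by omega)
  rw [← sub_eq_zero.1 h] at h1
  simp at h1

lemma qFac_ne_zero {q : ℂ} (hq1 : ‖q‖ < 1) (n : ℕ) : qFac q n ≠ 0 :=
  Finset.prod_ne_zero_iff.2 fun j _ => one_sub_pow_ne_zero hq1 j

/-- `1 / (q;q)_n`, extended by zero to negative `n`. -/
def rFac (q : ℂ) (n : ℤ) : ℂ := if 0 ≤ n then (qFac q n.toNat)⁻¹ else 0

/-- At n = 0 the factor 1 - q⁰ vanishes together with the left side, so the recursion holds on all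
of ℤ and sums can be shifted without boundary terms. -/
lemma rFac_sub_one {q : ℂ} (hq1 : ‖q‖ < 1) (n : ℤ) :
    rFac q (n - 1) = (1 - q ^ n) * rFac q n := by
  rcases lt_trichotomy n 0 with h | rfl | h
  · simp [rFac, not_le.2 h, show ¬ (1 ≤ n) by omega]
  · simp [rFac]
  · obtain ⟨m, rfl⟩ : ∃ m : ℕ, n = m + 1 := ⟨(n - 1).toNat, by omega⟩
    have h1 : ((m : ℤ) + 1 - 1).toNat = m := by omega
    have h2 : ((m : ℤ) + 1).toNat = m + 1 := by omega
    rw [rFac, rFac, if_pos (by omega), if_pos (by omega), h1, h2, qFac_succ]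
    have := one_sub_pow_ne_zero hq1 m
    have h3 := qFac_ne_zero hq1 m
    rw [show q ^ ((m : ℤ) + 1) = q ^ (m + 1) by exact_mod_cast zpow_natCast q (m + 1)]
    field_simp

/-- The coefficients in the finite triple product. -/
lemma hasSum_finite_triple_product {q x : ℂ} (hq : q ≠ 0) (hq1 : ‖q‖ < 1) (hx : x ≠ 0)
    (a b : ℕ) :
    HasSum (fun k : ℤ => thetaTerm x q k * (qFac q (a + b) * (rFac q (b + k) * rFac q (a - k))))
      ((∏ j ∈ Finset.range a, (1 - x * q ^ (j + 1))) *
        ∏ j ∈ Finset.range b, (1 - q ^ j * x⁻¹)) := by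
  -- The coefficient is the q-binomial of a + b over b + k. Each new linear factor subtracts a copy
  -- of the sum shifted by one index, and the coefficients recombine by the q-Pascal rule.
  induction b with
  | zero =>
    induction a with
    | zero =>
      simp only [Finset.range_zero, Finset.prod_empty, mul_one, Nat.cast_zero, zero_add, zero_sub]
      convert hasSum_single (f := fun k : ℤ => thetaTerm x q k *
        (qFac q 0 * (rFac q k * rFac q (-k)))) 0 ?_ using 1
      · simp [thetaTerm, qFac, rFac]
      · intro k hk
        rcases lt_or_gt_of_ne hk with h | h
        · simp [rFac, not_le.2 h]
        · simp [rFac, not_le.2 h]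
    | succ a ih =>
      simp only [Finset.range_zero, Finset.prod_empty, mul_one, Nat.cast_zero, zero_add,
        add_zero] at ih ⊢
      rw [Finset.prod_range_succ]
      have h1 := ih.mul_left (x * q ^ (a + 1))
      rw [← (Equiv.subRight (1 : ℤ)).hasSum_iff] at h1
      have h2 := ih.sub h1
      convert! h2 using 1
      · ext k
        simp only [Function.comp_apply, Equiv.subRight_apply]
        have e1 := thetaTerm_succ hx hq (k - 1)
        rw [sub_add_cancel] at e1
        have e2 : rFac q (a - k) = (1 - q ^ ((a : ℤ) + 1 - k)) * rFac q (a + 1 - k) := by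
          rw [← rFac_sub_one hq1]; congr 1; ring
        have e3 := rFac_sub_one hq1 k
        have e4 : (a : ℤ) - (k - 1) = a + 1 - k := by ring
        rw [e1, e2, e3, e4, qFac_succ]
        have e5 : q ^ ((a : ℤ) + 1 - k) * q ^ k = q ^ (a + 1) := by
          rw [← zpow_add₀ hq, ← zpow_natCast]; congr 1; push_cast; ring
        push_cast
        linear_combination (thetaTerm x q (k - 1) * qFac q a * rFac q k * rFac q (a + 1 - k) * x) *
          (-1) * e5
      · ring
  | succ b ih =>
    rw [Finset.prod_range_succ]
    have h1 := ih.mul_left (q ^ b * x⁻¹)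
    rw [← (Equiv.addRight (1 : ℤ)).hasSum_iff] at h1
    have h2 := ih.sub h1
    convert! h2 using 1
    · ext k
      simp only [Function.comp_apply, Equiv.coe_addRight]
      have e1 := thetaTerm_succ hx hq k
      have e2 : rFac q (b + k) = (1 - q ^ ((b : ℤ) + 1 + k)) * rFac q (b + 1 + k) := by
        rw [← rFac_sub_one hq1]; congr 1; ring
      have e3 : rFac q (a - (k + 1)) = (1 - q ^ ((a : ℤ) - k)) * rFac q (a - k) := by
        rw [← rFac_sub_one hq1]; congr 1; ring
      have e4 : (b : ℤ) + (k + 1) = b + 1 + k := by ring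
      rw [e1, e2, e3, e4, ← add_assoc, qFac_succ]
      have e5 : q ^ ((b : ℤ) + 1 + k) * q ^ ((a : ℤ) - k) = q ^ (a + b + 1) := by
        rw [← zpow_add₀ hq, ← zpow_natCast]; congr 1; push_cast; ring
      have e6 : q ^ b * q ^ (k + 1) = q ^ ((b : ℤ) + 1 + k) := by
        rw [← zpow_natCast, ← zpow_add₀ hq]; congr 1
      have e7 : x * x⁻¹ = 1 := mul_inv_cancel₀ hx
      rw [← e5]
      push_cast
      linear_combination (thetaTerm x q k * qFac q (a + b) * rFac q (b + 1 + k) * rFac q (a - k)) *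
        (1 - q ^ ((a : ℤ) - k)) * (- e6 - q ^ b * q ^ (k + 1) * e7)
    · ring

lemma summable_norm_q {q : ℂ} (hq1 : ‖q‖ < 1) (x : ℂ) : Summable fun j : ℕ => ‖-(x * q ^ j)‖ := by
  simp only [norm_neg, norm_mul, norm_pow]
  exact (summable_geometric_of_lt_one (norm_nonneg _) hq1).mul_left _

lemma multipliable_one_sub {q : ℂ} (hq1 : ‖q‖ < 1) (x : ℂ) :
    Multipliable fun j : ℕ => 1 - x * q ^ j := by
  simpa only [sub_eq_add_neg] using multipliable_one_add_of_summable (summable_norm_q hq1 x)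

lemma tendsto_qPochhammerInf {q : ℂ} (hq1 : ‖q‖ < 1) (x : ℂ) :
    Tendsto (fun n => ∏ j ∈ Finset.range n, (1 - x * q ^ j)) atTop (𝓝 (qPochhammerInf x q)) :=
  (multipliable_one_sub hq1 x).hasProd.tendsto_prod_nat

lemma qPochhammerInf_ne_zero {q x : ℂ} (hq1 : ‖q‖ < 1) (h : ∀ j : ℕ, x * q ^ j ≠ 1) :
    qPochhammerInf x q ≠ 0 := by
  simp only [qPochhammerInf, sub_eq_add_neg]
  refine tprod_one_add_ne_zero_of_summable (fun j hj => h j ?_) (summable_norm_q hq1 x)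
  linear_combination -hj

lemma qPochhammerInf_self_ne_zero {q : ℂ} (hq1 : ‖q‖ < 1) : qPochhammerInf q q ≠ 0 := by
  refine qPochhammerInf_ne_zero hq1 fun j hj => one_sub_pow_ne_zero hq1 j ?_
  rw [pow_succ, mul_comm, hj, sub_self]

lemma qPochhammerInf_eq_mul {q : ℂ} (hq1 : ‖q‖ < 1) (x : ℂ) :
    qPochhammerInf x q = (1 - x) * qPochhammerInf (q * x) q := by
  have h1 := (tendsto_qPochhammerInf hq1 x).comp (tendsto_add_atTop_nat 1)
  refine tendsto_nhds_unique h1 ?_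
  refine ((tendsto_qPochhammerInf hq1 (q * x)).const_mul (1 - x)).congr fun n => ?_
  simp only [Function.comp_apply]
  rw [Finset.prod_range_succ', mul_comm]
  congr 1
  · exact Finset.prod_congr rfl fun j _ => by ring
  · ring

lemma tendsto_qFac {q : ℂ} (hq1 : ‖q‖ < 1) :
    Tendsto (qFac q) atTop (𝓝 (qPochhammerInf q q)) := by
  refine (tendsto_qPochhammerInf hq1 q).congr fun n => ?_
  exact Finset.prod_congr rfl fun j _ => by ring

lemma tendsto_rFac {q : ℂ} (hq1 : ‖q‖ < 1) :
    Tendsto (rFac q) atTop (𝓝 (qPochhammerInf q q)⁻¹) := by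
  have h1 : Tendsto (fun n : ℤ => n.toNat) atTop atTop :=
    tendsto_atTop.2 fun b => (eventually_ge_atTop (b : ℤ)).mono fun n hn => by omega
  refine (((tendsto_qFac hq1).inv₀ (qPochhammerInf_self_ne_zero hq1)).comp h1).congr' ?_
  filter_upwards [eventually_ge_atTop (0 : ℤ)] with n hn
  simp [rFac, hn]

/-- Supplies the dominating constant for the limit of the finite triple product. -/
lemma exists_norm_rFac_le {q : ℂ} (hq1 : ‖q‖ < 1) : ∃ C, ∀ n, ‖rFac q n‖ ≤ C := by
  obtain ⟨C, hC⟩ := ((tendsto_qFac hq1).inv₀ (qPochhammerInf_self_ne_zero hq1)).norm.bddAbove_range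
  refine ⟨max C 0, fun n => ?_⟩
  rw [rFac]
  split_ifs
  · exact (hC ⟨n.toNat, rfl⟩).trans (le_max_left _ _)
  · simp

/-- The Jacobi triple product. -/
theorem theta_eq_prod {q x : ℂ} (hq : q ≠ 0) (hq1 : ‖q‖ < 1) (hx : x ≠ 0) :
    theta x q = qPochhammerInf q q * qPochhammerInf (q * x) q * qPochhammerInf x⁻¹ q := by
  set Q := qPochhammerInf q q with hQ
  have hQ0 : Q ≠ 0 := qPochhammerInf_self_ne_zero hq1
  obtain ⟨C, hC⟩ := exists_norm_rFac_le hq1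
  obtain ⟨D, hD⟩ := (tendsto_qFac hq1).norm.bddAbove_range
  have hC0 : 0 ≤ C := (norm_nonneg _).trans (hC 0)
  have hD0 : 0 ≤ D := (norm_nonneg _).trans (hD ⟨0, rfl⟩)
  -- With a = b = n every coefficient tends to Q·Q⁻¹·Q⁻¹ = Q⁻¹, and the theta series times a
  -- constant dominates.
  have key : Tendsto (fun n : ℕ => ∑' k : ℤ,
      thetaTerm x q k * (qFac q (n + n) * (rFac q (n + k) * rFac q (n - k)))) atTop
      (𝓝 (∑' k : ℤ, thetaTerm x q k * (Q * (Q⁻¹ * Q⁻¹)))) := by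
    refine tendsto_tsum_of_dominated_convergence
      (bound := fun k => ‖thetaTerm x q k‖ * (D * (C * C))) ?_ ?_ ?_
    · exact (summable_thetaTerm hx hq hq1).norm.mul_right _
    · intro k
      have hn : Tendsto (fun n : ℕ => (n : ℤ)) atTop atTop := tendsto_natCast_atTop_atTop
      refine Tendsto.const_mul _ (Tendsto.mul ?_ (Tendsto.mul ?_ ?_))
      · exact (tendsto_qFac hq1).comp (tendsto_id.atTop_add_atTop tendsto_id)
      · exact (tendsto_rFac hq1).comp (tendsto_atTop_add_const_right _ _ hn)
      · exact (tendsto_rFac hq1).comp (by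
          simpa only [sub_eq_add_neg] using tendsto_atTop_add_const_right _ (-k) hn)
    · refine Eventually.of_forall fun n k => ?_
      rw [norm_mul, norm_mul, norm_mul]
      have := hD ⟨n + n, rfl⟩
      have h1 := hC (n + k)
      have h2 := hC (n - k)
      gcongr
  have key2 : Tendsto (fun n : ℕ => ∑' k : ℤ,
      thetaTerm x q k * (qFac q (n + n) * (rFac q (n + k) * rFac q (n - k)))) atTop
      (𝓝 (qPochhammerInf (q * x) q * qPochhammerInf x⁻¹ q)) := by
    refine ((tendsto_qPochhammerInf hq1 (q * x)).mul (tendsto_qPochhammerInf hq1 x⁻¹)).congr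
      fun n => ?_
    rw [(hasSum_finite_triple_product hq hq1 hx n n).tsum_eq]
    congr 1
    · exact Finset.prod_congr rfl fun j _ => by ring
    · exact Finset.prod_congr rfl fun j _ => by ring
  have h := tendsto_nhds_unique key key2
  rw [tsum_mul_right, ← theta_eq_tsum, mul_inv_cancel_left₀ hQ0] at h
  rw [mul_assoc, ← h]
  field_simp

/-- The theta function divided by its factor `1 - x⁻¹`. -/
lemma theta_eq_one_sub_mul {q x : ℂ} (hq : q ≠ 0) (hq1 : ‖q‖ < 1) (hx : x ≠ 0) :
    theta x q = (1 - x⁻¹) *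
      (qPochhammerInf q q * qPochhammerInf (q * x) q * qPochhammerInf (q * x⁻¹) q) := by
  rw [theta_eq_prod hq hq1 hx, qPochhammerInf_eq_mul hq1 x⁻¹]; ring

/-- A zero must come from a factor 1 - x q^{j+1} or 1 - x⁻¹ q^j of the triple product. -/
lemma theta_ne_zero {q x : ℂ} (hq : q ≠ 0) (hq1 : ‖q‖ < 1) (hx : x ≠ 0)
    (h : ∀ n : ℤ, x ≠ q ^ n) : theta x q ≠ 0 := by
  rw [theta_eq_prod hq hq1 hx]
  refine mul_ne_zero (mul_ne_zero (qPochhammerInf_self_ne_zero hq1) ?_) ?_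
  · refine qPochhammerInf_ne_zero hq1 fun j hj => h (-(j + 1 : ℕ)) ?_
    rw [zpow_neg, zpow_natCast]
    refine eq_inv_of_mul_eq_one_left ?_
    rw [← hj]; ring
  · refine qPochhammerInf_ne_zero hq1 fun j hj => h j ?_
    rw [zpow_natCast]
    field_simp at hj
    exact hj.symm

/-! ### Theta functions on the lattice -/

lemma e_mem_zpow_iff {z τ : ℂ} : (∃ n : ℤ, e z = e τ ^ n) ↔ z ∈ lattice τ := by
  constructor
  · rintro ⟨n, hn⟩
    rw [← e_int_mul, e_eq_e_iff] at hn
    obtain ⟨m, hm⟩ := hn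
    exact ⟨m, n, by rw [hm]; ring⟩
  · rintro ⟨m, n, rfl⟩
    exact ⟨n, by rw [add_comm, e_add_int, e_int_mul]⟩

lemma theta_e_ne_zero {z τ : ℂ} (hτ : 0 < τ.im) (hz : z ∉ lattice τ) :
    theta (e z) (e τ) ≠ 0 :=
  theta_ne_zero (e_ne_zero _) (norm_e_lt_one hτ) (e_ne_zero _) fun n hn =>
    hz (e_mem_zpow_iff.1 ⟨n, hn⟩)

lemma theta_one (q : ℂ) (hq : q ≠ 0) (hq1 : ‖q‖ < 1) : theta 1 q = 0 := by
  rw [theta_eq_one_sub_mul hq hq1 one_ne_zero]; simp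

lemma differentiable_theta_e {τ : ℂ} (hτ : 0 < τ.im) :
    Differentiable ℂ fun z => theta (e z) (e τ) := by
  simp only [theta_e]
  intro z
  exact (differentiableAt_jacobiTheta₂_fst _ hτ).comp z (by fun_prop)

/-! ### Sums of simple fractions along a geometric progression -/

/-- On the ball ‖x₀‖/2 ≤ ‖x‖ ≤ 2‖x₀‖, so x q^l is uniformly large as l → -∞ and uniformly small as l
→ ∞. The thresholds for ‖q‖^l are chosen to make ‖x q^l‖ at least 3/2, respectively at most 1/2. -/
lemma eventually_half_le_norm_one_sub {q x₀ : ℂ} (hq : q ≠ 0) (hq1 : ‖q‖ < 1) (hx₀ : x₀ ≠ 0) :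
    ∀ᶠ l : ℤ in cofinite, ∀ x ∈ Metric.ball x₀ (‖x₀‖ / 2), 1 / 2 ≤ ‖1 - x * q ^ l‖ := by
  have hx : 0 < ‖x₀‖ := norm_pos_iff.2 hx₀
  have hq0 : 0 < ‖q‖ := norm_pos_iff.2 hq
  have hbd : ∀ x ∈ Metric.ball x₀ (‖x₀‖ / 2), ‖x₀‖ / 2 ≤ ‖x‖ ∧ ‖x‖ ≤ 2 * ‖x₀‖ := by
    intro x hxb
    rw [mem_ball_iff_norm] at hxb
    have h1 := norm_sub_norm_le x₀ x
    have h2 := norm_sub_norm_le x x₀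
    rw [norm_sub_rev] at h1
    constructor <;> linarith
  rw [Int.cofinite_eq, eventually_sup]
  constructor
  · have h : Tendsto (fun l : ℤ => ‖q‖ ^ l) atBot atTop := by
      have h1 : Tendsto (fun n : ℕ => ‖q‖⁻¹ ^ n) atTop atTop :=
        tendsto_pow_atTop_atTop_of_one_lt ((one_lt_inv₀ hq0).2 hq1)
      have h2 : Tendsto (fun l : ℤ => (-l).toNat) atBot atTop :=
        tendsto_atTop.2 fun b => (eventually_le_atBot (-b : ℤ)).mono fun n hn => by omega
      refine (h1.comp h2).congr' ?_
      filter_upwards [eventually_le_atBot 0] with l hl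
      obtain ⟨m, rfl⟩ : ∃ m : ℕ, l = -m := ⟨(-l).toNat, by omega⟩
      simp
    filter_upwards [h.eventually_ge_atTop (3 / ‖x₀‖)] with l hl x hxb
    have h3 := norm_sub_norm_le (x * q ^ l) 1
    rw [norm_sub_rev, norm_mul, norm_zpow, norm_one] at h3
    have h4 : ‖x₀‖ / 2 * (3 / ‖x₀‖) ≤ ‖x‖ * ‖q‖ ^ l := by
      gcongr
      exact (hbd x hxb).1
    have h5 : ‖x₀‖ / 2 * (3 / ‖x₀‖) = 3 / 2 := by field_simp
    linarith
  · have h : Tendsto (fun l : ℤ => ‖q‖ ^ l) atTop (𝓝 0) := by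
      have h1 : Tendsto (fun n : ℕ => ‖q‖ ^ n) atTop (𝓝 0) :=
        tendsto_pow_atTop_nhds_zero_of_lt_one hq0.le hq1
      have h2 : Tendsto (fun l : ℤ => l.toNat) atTop atTop :=
        tendsto_atTop.2 fun b => (eventually_ge_atTop (b : ℤ)).mono fun n hn => by omega
      refine (h1.comp h2).congr' ?_
      filter_upwards [eventually_ge_atTop 0] with l hl
      obtain ⟨m, rfl⟩ : ∃ m : ℕ, l = m := ⟨l.toNat, by omega⟩
      simp
    filter_upwards [h.eventually_le_const (show 0 < 1 / (4 * ‖x₀‖) by positivity)] with l hl x hxb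
    have h3 := norm_sub_norm_le 1 (x * q ^ l)
    rw [norm_mul, norm_zpow, norm_one] at h3
    have h4 : ‖x‖ * ‖q‖ ^ l ≤ 2 * ‖x₀‖ * (1 / (4 * ‖x₀‖)) := by
      gcongr
      exact (hbd x hxb).2
    have h5 : 2 * ‖x₀‖ * (1 / (4 * ‖x₀‖)) = 1 / 2 := by field_simp; norm_num
    linarith

/-- The sum `∑ c_l / (1 - x q^l)`. -/
def fracSum (c : ℤ → ℂ) (q x : ℂ) : ℂ := ∑' l : ℤ, c l / (1 - x * q ^ l)

/-- Once the finitely many terms with small denominators are split off, the rest is bounded by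
2‖c_l‖ and the Weierstrass test applies. The index 0 is put into the finite set so that the pole at
x = 1 can be isolated. -/
lemma exists_hasSum_frac {c : ℤ → ℂ} (hc : Summable c) {q x₀ : ℂ} (hq : q ≠ 0) (hq1 : ‖q‖ < 1)
    (hx₀ : x₀ ≠ 0) : ∃ (s : Finset ℤ) (g : ℂ → ℂ), 0 ∈ s ∧
      DifferentiableOn ℂ g (Metric.ball x₀ (‖x₀‖ / 2)) ∧
      ∀ x ∈ Metric.ball x₀ (‖x₀‖ / 2),
        HasSum (fun l => c l / (1 - x * q ^ l)) (∑ l ∈ s, c l / (1 - x * q ^ l) + g x) := by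
  have hfin := eventually_half_le_norm_one_sub hq hq1 hx₀
  rw [eventually_cofinite] at hfin
  set s : Finset ℤ := insert 0 hfin.toFinset with hs
  have hsn : ∀ l ∉ s, ∀ x ∈ Metric.ball x₀ (‖x₀‖ / 2), 1 / 2 ≤ ‖1 - x * q ^ l‖ := by
    intro l hl
    simp only [hs, Finset.mem_insert, Set.Finite.mem_toFinset, Set.mem_ofPred_eq, not_or,
      not_not] at hl
    exact hl.2
  have hbd : ∀ (l : ℤ) (x : ℂ), x ∈ Metric.ball x₀ (‖x₀‖ / 2) →
      ‖if l ∈ s then 0 else c l / (1 - x * q ^ l)‖ ≤ 2 * ‖c l‖ := by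
    intro l x hx
    split_ifs with h
    · simp
    · have h1 := hsn l h x hx
      rw [norm_div, div_le_iff₀ (by linarith)]
      nlinarith [norm_nonneg (c l)]
  refine ⟨s, fun x => ∑' l, if l ∈ s then 0 else c l / (1 - x * q ^ l),
    Finset.mem_insert_self _ _, ?_, ?_⟩
  · refine differentiableOn_tsum_of_summable_norm (hc.norm.mul_left 2) ?_ Metric.isOpen_ball hbd
    intro l
    split_ifs with h
    · exact differentiableOn_const _
    · refine DifferentiableOn.div (by fun_prop) (by fun_prop) fun x hx h0 => ?_
      have := hsn l h x hx
      rw [h0, norm_zero] at this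
      norm_num at this
  · intro x hx
    have h1 : HasSum (fun l => if l ∈ s then 0 else c l / (1 - x * q ^ l)) _ :=
      (Summable.of_norm_bounded (hc.norm.mul_left 2) fun l => hbd l x hx).hasSum
    have h2 : HasSum (fun l => if l ∈ s then c l / (1 - x * q ^ l) else 0)
        (∑ l ∈ s, if l ∈ s then c l / (1 - x * q ^ l) else 0) :=
      hasSum_sum_of_ne_finset_zero fun l hl => if_neg hl
    convert! h2.add h1 using 1
    · ext l
      split_ifs <;> simp
    · congr 1
      exact Finset.sum_congr rfl fun l hl => (if_pos hl).symm

lemma summable_frac {c : ℤ → ℂ} (hc : Summable c) {q x : ℂ} (hq : q ≠ 0) (hq1 : ‖q‖ < 1)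
    (hx : x ≠ 0) : Summable fun l => c l / (1 - x * q ^ l) := by
  obtain ⟨s, g, -, -, h⟩ := exists_hasSum_frac hc hq hq1 hx
  exact (h x (Metric.mem_ball_self (by positivity))).summable

lemma fracSum_differentiableAt {c : ℤ → ℂ} (hc : Summable c) {q x : ℂ} (hq : q ≠ 0)
    (hq1 : ‖q‖ < 1) (hx : x ≠ 0) (h : ∀ l : ℤ, x * q ^ l ≠ 1) :
    DifferentiableAt ℂ (fracSum c q) x := by
  obtain ⟨s, g, -, hg, hs⟩ := exists_hasSum_frac hc hq hq1 hx
  have hnhds : Metric.ball x (‖x‖ / 2) ∈ 𝓝 x := Metric.ball_mem_nhds _ (by positivity)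
  have heq : fracSum c q =ᶠ[𝓝 x] fun x => ∑ l ∈ s, c l / (1 - x * q ^ l) + g x := by
    filter_upwards [hnhds] with y hy using (hs y hy).tsum_eq
  refine DifferentiableAt.congr_of_eventuallyEq ?_ heq
  refine DifferentiableAt.add ?_ (hg.differentiableAt hnhds)
  refine DifferentiableAt.fun_sum fun l _ => ?_
  exact DifferentiableAt.div (by fun_prop) (by fun_prop) (sub_ne_zero.2 (h l).symm)

/-- Only the term l = 0 is singular at x = 1, since q^l ≠ 1 for l ≠ 0. -/
lemma fracSum_tendsto_one {c : ℤ → ℂ} (hc : Summable c) {q : ℂ} (hq : q ≠ 0) (hq1 : ‖q‖ < 1) :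
    Tendsto (fun x => (1 - x) * fracSum c q x) (𝓝[≠] 1) (𝓝 (c 0)) := by
  obtain ⟨s, g, h0, hg, hs⟩ := exists_hasSum_frac hc hq hq1 one_ne_zero
  have hnhds : Metric.ball (1 : ℂ) (‖(1 : ℂ)‖ / 2) ∈ 𝓝 1 := Metric.ball_mem_nhds _ (by simp)
  have heq : (fun x => c 0 + (1 - x) * (∑ l ∈ s.erase 0, c l / (1 - x * q ^ l) + g x)) =ᶠ[𝓝[≠] 1]
      fun x => (1 - x) * fracSum c q x := by
    filter_upwards [nhdsWithin_le_nhds hnhds, self_mem_nhdsWithin] with x hx hx1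
    rw [fracSum, (hs x hx).tsum_eq, ← Finset.add_sum_erase _ _ h0]
    have : 1 - x ≠ 0 := sub_ne_zero.2 (Ne.symm hx1)
    rw [zpow_zero, mul_one, add_assoc, mul_add _ (c 0 / (1 - x)), mul_div_cancel₀ _ this]
  refine Tendsto.congr' heq ?_
  have hq2 : ∀ l ∈ s.erase 0, 1 - 1 * q ^ l ≠ 0 := by
    intro l hl h
    rw [one_mul, sub_eq_zero] at h
    have h2 : ‖q‖ ^ l = 1 := by rw [← norm_zpow, ← h, norm_one]
    have hl0 := Finset.ne_of_mem_erase hl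
    exact (zpow_eq_one_iff_right₀ (norm_nonneg q) hq1.ne |>.not.2 hl0) h2
  have hcont : ContinuousAt (fun x => c 0 + (1 - x) *
      (∑ l ∈ s.erase 0, c l / (1 - x * q ^ l) + g x)) 1 := by
    refine continuousAt_const.add (ContinuousAt.mul (by fun_prop) (ContinuousAt.add ?_
      (hg.differentiableAt hnhds).continuousAt))
    refine tendsto_finsetSum _ fun l hl => ?_
    exact ContinuousAt.div (by fun_prop) (by fun_prop) (hq2 l hl)
  have := hcont.tendsto.mono_left (nhdsWithin_le_nhds (s := {1}ᶜ))
  simpa using this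

/-! ### The solutions of the Appell–Lerch equation -/

lemma f0_eq_fracSum (t lam q : ℂ) :
    f0 t lam q = (theta lam q)⁻¹ * fracSum (thetaTerm lam q) q (lam * t) := by
  rw [f0, fracSum]
  congr 1
  refine tsum_congr fun l => ?_
  rw [thetaTerm]; ring

/-- This is 1/(1 - x) = 1 + x/(1 - x) together with x T' = -t T. -/
lemma fracSum_thetaTerm_shift_aux {T T' x y t : ℂ} (h : 1 - x ≠ 0) (hT : T = -y * T')
    (hx : x = y * t) : T' / (1 - x) = T' - t * (T / (1 - x)) := by
  rw [hT]
  field_simp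
  rw [hx]
  ring

/-- The term of index l - 1 at qt has the same denominator as the term of index l at t; the
numerators are compared by the recursion of the theta terms. -/
lemma fracSum_thetaTerm_shift {t lam q : ℂ} (ht : t ≠ 0) (hl : lam ≠ 0) (hq : q ≠ 0)
    (hq1 : ‖q‖ < 1) (h : ∀ l : ℤ, lam * t * q ^ l ≠ 1) :
    fracSum (thetaTerm lam q) q (lam * (q * t)) =
      theta lam q - t * fracSum (thetaTerm lam q) q (lam * t) := by
  have hs := summable_thetaTerm hl hq hq1
  have hs2 := summable_frac hs hq hq1 (mul_ne_zero hl ht)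
  have h1 : HasSum (fun l => thetaTerm lam q (l - 1)) (∑' l, thetaTerm lam q l) :=
    (Equiv.subRight (1 : ℤ)).hasSum_iff (f := thetaTerm lam q) |>.2 hs.hasSum
  have h2 := h1.sub (hs2.hasSum.mul_left t)
  have h3 : HasSum (fun l => thetaTerm lam q (l - 1) / (1 - lam * (q * t) * q ^ (l - 1)))
      (theta lam q - t * fracSum (thetaTerm lam q) q (lam * t)) := by
    rw [theta_eq_tsum, fracSum]
    refine h2.congr_fun fun l => ?_
    have h1 := thetaTerm_succ hl hq (l - 1)
    rw [sub_add_cancel] at h1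
    have h2 : lam * (q * t) * q ^ (l - 1) = lam * t * q ^ l := by
      rw [zpow_sub_one₀ hq]; field_simp
    rw [h2]
    exact fracSum_thetaTerm_shift_aux (sub_ne_zero.2 (h l).symm) h1 (by ring)
  exact ((Equiv.subRight (1 : ℤ)).hasSum_iff
    (f := fun l => thetaTerm lam q l / (1 - lam * (q * t) * q ^ l)) |>.1 h3).tsum_eq

/-- Division by θ(λ) normalises the inhomogeneous term to 1, independently of λ; this is what makes
differences of such sums quasi-periodic. -/
lemma f0_mul_q {t lam q : ℂ} (ht : t ≠ 0) (hl : lam ≠ 0) (hq : q ≠ 0)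
    (hq1 : ‖q‖ < 1) (hth : theta lam q ≠ 0) (h : ∀ l : ℤ, lam * t * q ^ l ≠ 1) :
    f0 (q * t) lam q = 1 - t * f0 t lam q := by
  rw [f0_eq_fracSum, f0_eq_fracSum, fracSum_thetaTerm_shift ht hl hq hq1 h]
  field_simp

/-- After an index shift the series and θ(qλ) acquire the same factor -(qλ)⁻¹. Needed when u and v
are congruent modulo the lattice. -/
lemma f0_lam_mul_q {t lam q : ℂ} (hl : lam ≠ 0) (hq : q ≠ 0) :
    f0 t (q * lam) q = f0 t lam q := by
  rw [f0_eq_fracSum, f0_eq_fracSum, theta_mul_q hl hq, fracSum, fracSum,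
    ← (Equiv.addRight (1 : ℤ)).tsum_eq fun l => thetaTerm lam q l / (1 - lam * t * q ^ l)]
  simp only [thetaTerm_mul_q hl hq, Equiv.coe_addRight, mul_div_assoc]
  have h : ∀ l : ℤ, q * lam * t * q ^ l = lam * t * q ^ (l + 1) := fun l => by
    rw [zpow_add_one₀ hq]; ring
  simp only [h]
  rw [tsum_mul_left, mul_inv, mul_mul_mul_comm, inv_mul_cancel₀, one_mul]
  simp [hl, hq]

/-- Under l ↦ -l every summand gains the factor -λt, while θ(λ⁻¹) = -λ θ(λ). This is the action of
-1 on the first column. -/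
lemma f0_inv {t lam q : ℂ} (ht : t ≠ 0) (hl : lam ≠ 0) (hq : q ≠ 0)
    (h : ∀ l : ℤ, lam * t * q ^ l ≠ 1) :
    f0 t⁻¹ lam⁻¹ q = t * f0 t lam q := by
  rw [f0_eq_fracSum, f0_eq_fracSum, theta_inv hl hq, fracSum, fracSum,
    ← (Equiv.neg ℤ).tsum_eq]
  have h1 : ∀ l : ℤ, thetaTerm lam⁻¹ q (-l) / (1 - lam⁻¹ * t⁻¹ * q ^ (-l)) =
      -(lam * t) * (thetaTerm lam q l / (1 - lam * t * q ^ l)) := by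
    intro l
    have h2 : thetaTerm lam⁻¹ q (-l) = (q ^ l)⁻¹ * thetaTerm lam q l := by
      rw [← thetaTerm_inv hl hq l, thetaTerm, thetaTerm, mul_zpow]
      rw [zpow_neg, zpow_neg, zpow_neg, inv_zpow, inv_zpow, inv_inv]
      field_simp
    have h3 : 1 - lam * t * q ^ l ≠ 0 := sub_ne_zero.2 (h l).symm
    have h4 : q ^ l ≠ 0 := zpow_ne_zero _ hq
    have h5 : 1 - lam⁻¹ * t⁻¹ * q ^ (-l) = -(1 - lam * t * q ^ l) / (lam * t * q ^ l) := by
      rw [zpow_neg]; field_simp; ring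
    rw [h2, h5]
    field_simp
  simp only [Equiv.neg_apply, h1]
  rw [tsum_mul_left]
  by_cases hth : theta lam q = 0
  · simp [hth]
  field_simp

lemma fNeg1_mul_q {t q : ℂ} (ht : t ≠ 0) (hq : q ≠ 0) : fNeg1 (q * t) q = -t * fNeg1 t q := by
  rw [fNeg1, fNeg1, inv_mul_cancel_left₀ hq, theta_div_q ht hq]
  by_cases hth : theta t q = 0
  · simp [hth]
  field_simp

lemma fNeg1_inv {t q : ℂ} (ht : t ≠ 0) (hq : q ≠ 0) : fNeg1 t⁻¹ q = -t * fNeg1 t q := by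
  rw [← fNeg1_mul_q ht hq, fNeg1, fNeg1, theta_q_inv ht hq, inv_mul_cancel_left₀ hq]

/-! ### Elliptic functions without poles -/

/-- A function on `ℂ` that is bounded on a period parallelogram and doubly periodic is bounded. -/
lemma isBounded_range_of_periods {τ : ℂ} (hτ : 0 < τ.im) {f : ℂ → ℂ} (hf : Continuous f)
    (hper : ∀ (z : ℂ) (m n : ℤ), f (z + (m + n * τ)) = f z) :
    Bornology.IsBounded (Set.range f) := by
  have hK : IsCompact ((fun p : ℝ × ℝ => (p.1 : ℂ) + p.2 * τ) ''
      (Set.Icc (0 : ℝ) 1 ×ˢ Set.Icc (0 : ℝ) 1)) :=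
    (isCompact_Icc.prod isCompact_Icc).image (by fun_prop)
  refine (hK.image hf).isBounded.subset ?_
  rintro _ ⟨z, rfl⟩
  set b : ℝ := z.im / τ.im with hb
  set a : ℝ := z.re - b * τ.re with ha
  have hz : z = a + b * τ := by
    apply Complex.ext
    · simp [ha]
    · simp [hb, hτ.ne']
  refine ⟨Int.fract a + Int.fract b * τ, ⟨(Int.fract a, Int.fract b),
    ⟨⟨Int.fract_nonneg _, (Int.fract_lt_one _).le⟩, ⟨Int.fract_nonneg _, (Int.fract_lt_one _).le⟩⟩,
    rfl⟩, ?_⟩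
  rw [← hper _ ⌊a⌋ ⌊b⌋]
  congr 1
  rw [hz]
  have h1 : ((Int.fract a : ℝ) : ℂ) + (⌊a⌋ : ℂ) = a := by exact_mod_cast Int.fract_add_floor a
  have h2 : ((Int.fract b : ℝ) : ℂ) + (⌊b⌋ : ℂ) = b := by exact_mod_cast Int.fract_add_floor b
  linear_combination h1 + τ * h2

/-- A doubly periodic function with isolated removable singularities that vanishes somewhere
vanishes identically. -/
theorem elliptic_eq_zero {τ : ℂ} (hτ : 0 < τ.im) {B : Set ℂ} {F : ℂ → ℂ}
    (hB1 : ∀ z, z + 1 ∈ B ↔ z ∈ B) (hBτ : ∀ z, z + τ ∈ B ↔ z ∈ B)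
    (hiso : ∀ p, ∀ᶠ z in 𝓝[≠] p, z ∉ B)
    (hF1 : ∀ z ∉ B, F (z + 1) = F z) (hFτ : ∀ z ∉ B, F (z + τ) = F z)
    (hd : ∀ z ∉ B, DifferentiableAt ℂ F z)
    (hres : ∀ p ∈ B, ∃ m n : ℤ, Tendsto (fun z => (z - (p + (m + n * τ))) * F z)
      (𝓝[≠] (p + (m + n * τ))) (𝓝 0))
    {z₀ : ℂ} (hz₀ : z₀ ∉ B) (h0 : F z₀ = 0) : ∀ z ∉ B, F z = 0 := by
  -- The common periods of B and F form a group, so 1 and τ generate all lattice periods. They also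
  -- carry the residue condition from a lattice translate of p back to p.
  let P : AddSubgroup ℂ :=
    { carrier := {w | ∀ z, (z + w ∈ B ↔ z ∈ B) ∧ (z ∉ B → F (z + w) = F z)}
      zero_mem' := by simp
      add_mem' := by
        intro a b ha hb z
        have h1 := ha z
        have h2 := hb (z + a)
        rw [← add_assoc]
        refine ⟨h2.1.trans h1.1, fun hz => ?_⟩
        rw [h2.2 (h1.1.not.2 hz), h1.2 hz]
      neg_mem' := by
        intro a ha z
        have h1 := ha (z + -a)
        rw [neg_add_cancel_right] at h1
        refine ⟨h1.1.symm, fun hz => ?_⟩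
        exact (h1.2 (h1.1.not.1 hz)).symm }
  have hP : ∀ m n : ℤ, (m + n * τ : ℂ) ∈ P := by
    intro m n
    have h1 : (1 : ℂ) ∈ P := fun z => ⟨hB1 z, hF1 z⟩
    have h2 : τ ∈ P := fun z => ⟨hBτ z, hFτ z⟩
    have := P.add_mem (P.zsmul_mem h1 m) (P.zsmul_mem h2 n)
    simpa using this
  have hshift : ∀ w ∈ P, ∀ p, Tendsto (fun z => z + w) (𝓝[≠] p) (𝓝[≠] (p + w)) := by
    intro w _ p
    refine tendsto_nhdsWithin_iff.2 ⟨?_, ?_⟩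
    · exact ((continuous_add_const w).tendsto p).mono_left nhdsWithin_le_nhds
    · filter_upwards [self_mem_nhdsWithin] with z hz
      simpa using hz
  have hlim : ∀ p, Tendsto (fun z => (z - p) * F z) (𝓝[≠] p) (𝓝 0) := by
    intro p
    by_cases hp : p ∈ B
    · obtain ⟨m, n, h⟩ := hres p hp
      refine (h.comp (hshift _ (hP m n) p)).congr' ?_
      filter_upwards [hiso p] with z hz
      simp only [Function.comp_apply]
      rw [((hP m n) z).2 hz]
      ring
    · have h1 : ContinuousAt (fun z => (z - p) * F z) p :=
        ContinuousAt.mul (by fun_prop) (hd p hp).continuousAt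
      simpa using h1.tendsto.mono_left (nhdsWithin_le_nhds (s := {p}ᶜ))
  -- The vanishing of lim (z - p) F(z), rewritten in the form in which the removable singularity
  -- theorem is applied.
  have hlittle : ∀ p, (fun z => F z - F p) =o[𝓝[≠] p] fun z => (z - p)⁻¹ := by
    intro p
    rw [Asymptotics.isLittleO_iff_tendsto']
    · have h1 : Tendsto (fun z => (z - p) * F z - (z - p) * F p) (𝓝[≠] p) (𝓝 (0 - (p - p) * F p)) :=
        (hlim p).sub (ContinuousAt.tendsto (by fun_prop) |>.mono_left nhdsWithin_le_nhds)
      rw [sub_self, zero_mul, sub_zero] at h1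
      refine h1.congr fun z => ?_
      rw [div_inv_eq_mul]; ring
    · filter_upwards [self_mem_nhdsWithin] with z hz h
      exact absurd (inv_eq_zero.1 h) (sub_ne_zero.2 hz)
  -- G is the entire extension of F. It inherits the periods, hence is bounded and constant by
  -- Liouville.
  set G : ℂ → ℂ := fun p => limUnder (𝓝[≠] p) F with hG
  have hdiff : ∀ p, ∀ᶠ z in 𝓝[≠] p, DifferentiableAt ℂ F z := fun p => (hiso p).mono fun z => hd z
  have hGlim : ∀ p, Tendsto F (𝓝[≠] p) (𝓝 (G p)) := fun p =>
    tendsto_limUnder_of_differentiable_on_punctured_nhds_of_isLittleO (hdiff p) (hlittle p)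
  have hGF : ∀ z ∉ B, G z = F z := fun z hz =>
    tendsto_nhds_unique (hGlim z) ((hd z hz).continuousAt.tendsto.mono_left nhdsWithin_le_nhds)
  have hGd : Differentiable ℂ G := by
    intro p
    obtain ⟨s, hs, hsd⟩ := (eventually_nhdsWithin_iff.1 ((hdiff p).and (hiso p))).exists_mem
    have h1 : DifferentiableOn ℂ (Function.update F p (G p)) s :=
      differentiableOn_update_limUnder_of_isLittleO hs
        (fun z hz => ((hsd z hz.1 hz.2).1).differentiableWithinAt) (hlittle p)
    refine (h1.differentiableAt hs).congr_of_eventuallyEq ?_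
    filter_upwards [hs] with z hz
    by_cases hzp : z = p
    · subst hzp; simp
    · rw [Function.update_of_ne hzp]
      exact hGF z (hsd z hz hzp).2
  have hGper : ∀ (z : ℂ) (m n : ℤ), G (z + (m + n * τ)) = G z := by
    intro z m n
    refine tendsto_nhds_unique ((hGlim (z + (m + n * τ))).comp (hshift _ (hP m n) z))
      ((hGlim z).congr' ?_)
    filter_upwards [hiso z] with y hy
    exact (((hP m n) y).2 hy).symm
  intro z hz
  rw [← hGF z hz, hGd.apply_eq_apply_of_bounded
    (isBounded_range_of_periods hτ hGd.continuous hGper) z z₀, hGF z₀ hz₀, h0]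

/-! ### The lattice -/

lemma add_int_mem_lattice {τ z : ℂ} (m : ℤ) : z + m ∈ lattice τ ↔ z ∈ lattice τ := by
  constructor
  · rintro ⟨a, b, h⟩
    exact ⟨a - m, b, by push_cast; linear_combination h⟩
  · rintro ⟨a, b, h⟩
    exact ⟨a + m, b, by push_cast; linear_combination h⟩

lemma add_one_mem_lattice {τ z : ℂ} : z + 1 ∈ lattice τ ↔ z ∈ lattice τ := by
  simpa using add_int_mem_lattice (τ := τ) (z := z) 1

lemma add_tau_mem_lattice {τ z : ℂ} : z + τ ∈ lattice τ ↔ z ∈ lattice τ := by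
  constructor
  · rintro ⟨a, b, h⟩
    exact ⟨a, b - 1, by push_cast; linear_combination h⟩
  · rintro ⟨a, b, h⟩
    exact ⟨a, b + 1, by push_cast; linear_combination h⟩

lemma neg_mem_lattice {τ z : ℂ} : -z ∈ lattice τ ↔ z ∈ lattice τ := by
  constructor
  · rintro ⟨a, b, h⟩
    exact ⟨-a, -b, by push_cast; linear_combination -h⟩
  · rintro ⟨a, b, h⟩
    exact ⟨-a, -b, by push_cast; linear_combination -h⟩

/-- The zero at t = 1 is carried to all powers of q by quasi-periodicity; the triple product
excludes other zeros. -/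
lemma theta_e_eq_zero_iff {τ z : ℂ} (hτ : 0 < τ.im) :
    theta (e z) (e τ) = 0 ↔ z ∈ lattice τ := by
  refine ⟨fun h => by_contra fun hz => theta_e_ne_zero hτ hz h, ?_⟩
  intro hz
  obtain ⟨n, hn⟩ := e_mem_zpow_iff.2 hz
  have hq := e_ne_zero τ
  have step : ∀ m : ℤ, theta (e τ ^ (m + 1)) (e τ) = 0 ↔ theta (e τ ^ m) (e τ) = 0 := by
    intro m
    rw [zpow_add_one₀ hq, mul_comm, theta_mul_q (zpow_ne_zero _ hq) hq]
    simp [hq, zpow_ne_zero]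
  have h1 := theta_one _ hq (norm_e_lt_one hτ)
  rw [hn]
  induction n using Int.induction_on generalizing z with
  | zero => simpa using h1
  | succ i ih => 
    rw [step]
    exact ih (z := i * τ) ⟨0, i, by simp⟩ (by rw [← e_int_mul]; simp)
  | pred i ih =>
    rw [← step, sub_add_cancel]
    exact ih (z := -i * τ) ⟨0, -i, by simp⟩ (by rw [← e_int_mul]; simp)

/-- The lattice is the zero set of an entire function of z that is not identically zero, since τ/2
is not a lattice point; hence it is discrete. -/
lemma eventually_notMem_lattice {τ : ℂ} (hτ : 0 < τ.im) (p : ℂ) :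
    ∀ᶠ z in 𝓝[≠] p, z ∉ lattice τ := by
  have hd := differentiable_theta_e hτ
  have han : AnalyticOnNhd ℂ (fun z => theta (e z) (e τ)) Set.univ := fun z _ => hd.analyticAt z
  rcases (han p trivial).eventually_eq_zero_or_eventually_ne_zero with h | h
  · exfalso
    have h2 := han.eqOn_zero_of_preconnected_of_eventuallyEq_zero isPreconnected_univ trivial h
    have h3 : theta (e (τ / 2)) (e τ) = 0 := h2 trivial
    rw [theta_e_eq_zero_iff hτ] at h3
    obtain ⟨m, n, h4⟩ := h3
    have h5 := congrArg Complex.im h4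
    simp at h5
    have h6 : (n : ℝ) = 1 / 2 := by
      have : τ.im * (n - 1 / 2) = 0 := by linarith
      rcases mul_eq_zero.1 this with h | h
      · exact absurd h hτ.ne'
      · linarith
    have h7 : (2 * n : ℝ) = 1 := by linarith
    have h8 : 2 * n = 1 := by exact_mod_cast h7
    omega
  · filter_upwards [h] with z hz hzl
    exact hz ((theta_e_eq_zero_iff hτ).2 hzl)

lemma eventually_add_notMem_lattice {τ : ℂ} (hτ : 0 < τ.im) (u p : ℂ) :
    ∀ᶠ z in 𝓝[≠] p, z + u ∉ lattice τ := by
  have h : Tendsto (fun z => z + u) (𝓝[≠] p) (𝓝[≠] (p + u)) := by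
    refine tendsto_nhdsWithin_iff.2 ⟨?_, ?_⟩
    · exact ((continuous_add_const u).tendsto p).mono_left nhdsWithin_le_nhds
    · filter_upwards [self_mem_nhdsWithin] with z hz
      simpa using hz
  exact h.eventually (eventually_notMem_lattice hτ (p + u))

/-! ### The Appell–Lerch sum as a function of the elliptic variable -/

lemma lam_t_ne_one {z u τ : ℂ} (h : z + u ∉ lattice τ) (l : ℤ) : e u * e z * e τ ^ l ≠ 1 := by
  intro h1
  rw [← e_int_mul, ← e_add, ← e_add, e_eq_one_iff] at h1
  obtain ⟨n, hn⟩ := h1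
  exact h ⟨n, -l, by push_cast; linear_combination hn⟩

lemma f0_e_add_tau {z u τ : ℂ} (hτ : 0 < τ.im) (hu : u ∉ lattice τ) (h : z + u ∉ lattice τ) :
    f0 (e (z + τ)) (e u) (e τ) = 1 - e z * f0 (e z) (e u) (e τ) := by
  rw [add_comm, e_add]
  exact f0_mul_q (e_ne_zero _) (e_ne_zero _) (e_ne_zero _) (norm_e_lt_one hτ)
    (theta_e_ne_zero hτ hu) (lam_t_ne_one h)

lemma e_add_one (z : ℂ) : e (z + 1) = e z := by rw [e_add, e_one, mul_one]

lemma f0_e_differentiableAt {z u τ : ℂ} (hτ : 0 < τ.im) (h : z + u ∉ lattice τ) :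
    DifferentiableAt ℂ (fun z => f0 (e z) (e u) (e τ)) z := by
  simp only [f0_eq_fracSum]
  have h1 := fracSum_differentiableAt (summable_thetaTerm (e_ne_zero u) (e_ne_zero τ)
    (norm_e_lt_one hτ)) (e_ne_zero τ) (norm_e_lt_one hτ)
    (mul_ne_zero (e_ne_zero u) (e_ne_zero z)) (lam_t_ne_one h)
  refine DifferentiableAt.const_mul ?_ _
  exact h1.comp z ((differentiable_e z).const_mul _)

lemma hasDerivAt_e (z : ℂ) : HasDerivAt e (2 * Real.pi * I * e z) z := by
  have h := (((hasDerivAt_id z).const_mul (2 * Real.pi * I)).cexp)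
  unfold e
  convert! h using 1
  simp; ring

/-- The negative reciprocal of the difference quotient at -u of e(u)e(z), which has value 1 and
derivative 2πi there. -/
lemma tendsto_linear_div {u : ℂ} :
    Tendsto (fun z => (z + u) / (1 - e u * e z)) (𝓝[≠] (-u)) (𝓝 (-(2 * Real.pi * I)⁻¹)) := by
  have h1 : HasDerivAt (fun z => e u * e z) (2 * Real.pi * I) (-u) := by
    convert! (hasDerivAt_e (-u)).const_mul (e u) using 1
    rw [e_neg]
    field_simp [e_ne_zero u]
  have h2 := (hasDerivAt_iff_tendsto_slope.1 h1).inv₀ Complex.two_pi_I_ne_zero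
  refine h2.neg.congr fun z => ?_
  rw [slope_def_field, e_neg, mul_inv_cancel₀ (e_ne_zero u), inv_div, ← neg_sub 1, div_neg,
    neg_neg, sub_neg_eq_add]

lemma tendsto_lam_t {u τ : ℂ} (hτ : 0 < τ.im) :
    Tendsto (fun z => e u * e z) (𝓝[≠] (-u)) (𝓝[≠] 1) := by
  refine tendsto_nhdsWithin_iff.2 ⟨?_, ?_⟩
  · have h : ContinuousAt (fun z => e u * e z) (-u) :=
      ((differentiable_e.continuous).const_mul _).continuousAt
    have h2 := h.tendsto
    simp only [e_neg, mul_inv_cancel₀ (e_ne_zero u)] at h2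
    exact h2.mono_left nhdsWithin_le_nhds
  · filter_upwards [eventually_add_notMem_lattice hτ u (-u)] with z hz
    simpa using lam_t_ne_one hz 0

/-- The only singular term at z = -u is l = 0, whose numerator is 1. -/
lemma f0_residue {u τ : ℂ} (hτ : 0 < τ.im) :
    Tendsto (fun z => (z + u) * f0 (e z) (e u) (e τ)) (𝓝[≠] (-u))
      (𝓝 (-(2 * Real.pi * I)⁻¹ * (theta (e u) (e τ))⁻¹)) := by
  have h1 := (fracSum_tendsto_one (summable_thetaTerm (e_ne_zero u) (e_ne_zero τ)
    (norm_e_lt_one hτ)) (e_ne_zero τ) (norm_e_lt_one hτ)).comp (tendsto_lam_t (u := u) hτ)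
  have h2 := (tendsto_linear_div (u := u)).mul (h1.mul_const (theta (e u) (e τ))⁻¹)
  have h3 : thetaTerm (e u) (e τ) 0 = 1 := by simp [thetaTerm]
  rw [h3, one_mul] at h2
  refine h2.congr' ?_
  filter_upwards [(tendsto_lam_t (u := u) hτ).eventually self_mem_nhdsWithin] with z hz
  have h4 : 1 - e u * e z ≠ 0 := sub_ne_zero.2 (Ne.symm hz)
  simp only [Function.comp_apply]
  rw [f0_eq_fracSum]
  field_simp

/-! ### The connection formula -/

lemma continuous_qPochhammerInf {q : ℂ} (hq1 : ‖q‖ < 1) :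
    Continuous fun x => qPochhammerInf x q := by
  rw [continuous_iff_continuousAt]
  intro x
  have h := (Summable.hasProdLocallyUniformlyOn_nat_one_add (K := Metric.ball (0 : ℂ) (‖x‖ + 1))
    (f := fun n x => -(x * q ^ n)) (u := fun n => (‖x‖ + 1) * ‖q‖ ^ n) Metric.isOpen_ball
    ((summable_geometric_of_lt_one (norm_nonneg _) hq1).mul_left _)
    (Eventually.of_forall fun n y hy => ?_)
    (fun n => by fun_prop)).tendstoLocallyUniformlyOn_finsetRange
  · have h2 := h.continuousOn (Frequently.of_forall fun n => by fun_prop)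
    have h3 := h2.continuousAt (Metric.isOpen_ball.mem_nhds (x := x) (by simp))
    simpa only [qPochhammerInf, sub_eq_add_neg] using h3
  · rw [norm_neg, norm_mul, norm_pow]
    have : ‖y‖ ≤ ‖x‖ + 1 := by simpa using (mem_ball_zero_iff.1 hy).le
    gcongr

/-- In the triple product the factor 1 - x splits off, and the three remaining products all become
(q;q)_∞ at x = 1. This is the origin of the cube in the connection formula. -/
lemma tendsto_theta_inv_div {q : ℂ} (hq : q ≠ 0) (hq1 : ‖q‖ < 1) :
    Tendsto (fun x => theta x⁻¹ q / (1 - x)) (𝓝[≠] 1) (𝓝 (qPochhammerInf q q ^ 3)) := by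
  have hc := continuous_qPochhammerInf hq1
  have h1 : ContinuousAt (fun x => qPochhammerInf q q * qPochhammerInf (q * x⁻¹) q *
      qPochhammerInf (q * x) q) 1 := by
    refine (continuousAt_const.mul (hc.continuousAt.comp ?_)).mul (hc.continuousAt.comp ?_)
    · exact continuousAt_const.mul (continuousAt_inv₀ one_ne_zero)
    · fun_prop
  have h2 := h1.tendsto.mono_left (nhdsWithin_le_nhds (s := {1}ᶜ))
  have h3 : qPochhammerInf q q * qPochhammerInf (q * 1⁻¹) q * qPochhammerInf (q * 1) q =
      qPochhammerInf q q ^ 3 := by rw [inv_one, mul_one]; ring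
  rw [h3] at h2
  refine h2.congr' ?_
  have h4 : ∀ᶠ x : ℂ in 𝓝[≠] 1, x ≠ 0 :=
    nhdsWithin_le_nhds (isOpen_ne.mem_nhds one_ne_zero)
  filter_upwards [h4, self_mem_nhdsWithin] with x hx hx1
  rw [theta_eq_one_sub_mul hq hq1 (inv_ne_zero hx), inv_inv,
    mul_div_cancel_left₀ _ (sub_ne_zero.2 (Ne.symm hx1))]

/-- The theta quotient that is the difference of two Appell–Lerch sums. -/
def connQuot (t lam mu q : ℂ) : ℂ :=
  -(qPochhammerInf q q ^ 3 * theta (lam⁻¹ * mu) q * theta (lam⁻¹ * mu⁻¹ * t⁻¹) q) /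
    (theta lam⁻¹ q * theta mu q * theta (lam⁻¹ * t⁻¹) q * theta (mu⁻¹ * t⁻¹) q)

lemma M21_eq (t lam mu q : ℂ) : M21 t lam mu q = connQuot t lam mu q * theta (q⁻¹ * t) q := by
  rw [M21, connQuot]; ring

/-- Lets the pole at z = -v be treated by exchanging u and v. If a theta value in the denominator
vanishes, both sides are 0 by the convention for division by zero. -/
lemma connQuot_swap {t lam mu q : ℂ} (hl : lam ≠ 0) (hm : mu ≠ 0) (hq : q ≠ 0) :
    connQuot t mu lam q = -connQuot t lam mu q := by
  have h1 := theta_inv (t := lam⁻¹ * mu) (by simp [hl, hm]) hq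
  rw [mul_inv, inv_inv, mul_comm] at h1
  rw [connQuot, connQuot, h1, theta_inv hm hq, theta_inv hl hq, mul_comm mu⁻¹ lam⁻¹]
  by_cases h2 : theta lam q = 0
  · simp [h2]
  by_cases h3 : theta mu q = 0
  · simp [h3]
  by_cases h4 : theta (lam⁻¹ * t⁻¹) q = 0
  · simp [h4]
  by_cases h5 : theta (mu⁻¹ * t⁻¹) q = 0
  · simp [h5]
  field_simp

lemma theta_mul_inv_e_ne_zero {z u τ : ℂ} (hτ : 0 < τ.im) (h : z + u ∉ lattice τ) :
    theta ((e u)⁻¹ * (e z)⁻¹) (e τ) ≠ 0 := by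
  rw [← e_neg, ← e_neg, ← e_add]
  refine theta_e_ne_zero hτ fun h1 => h ?_
  rw [← neg_mem_lattice]
  convert! h1 using 1
  ring

lemma theta_mul_inv_e_differentiable {u τ : ℂ} (hτ : 0 < τ.im) :
    Differentiable ℂ fun z => theta ((e u)⁻¹ * (e z)⁻¹) (e τ) := by
  have h : (fun z => theta ((e u)⁻¹ * (e z)⁻¹) (e τ)) =
      (fun z => theta (e z) (e τ)) ∘ fun z => -u + -z := by
    ext z
    simp only [Function.comp_apply, e_add, e_neg]
  rw [h]
  exact (differentiable_theta_e hτ).comp (by fun_prop)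

lemma theta_div_q_e_differentiable {τ : ℂ} (hτ : 0 < τ.im) :
    Differentiable ℂ fun z => theta ((e τ)⁻¹ * e z) (e τ) := by
  have h : (fun z => theta ((e τ)⁻¹ * e z) (e τ)) =
      (fun z => theta (e z) (e τ)) ∘ fun z => -τ + z := by
    ext z
    simp only [Function.comp_apply, e_add, e_neg]
  rw [h]
  exact (differentiable_theta_e hτ).comp (by fun_prop)

lemma connQuot_e_differentiableAt {z u v τ : ℂ} (hτ : 0 < τ.im) (hu : u ∉ lattice τ)
    (hv : v ∉ lattice τ) (hzu : z + u ∉ lattice τ) (hzv : z + v ∉ lattice τ) :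
    DifferentiableAt ℂ (fun z => connQuot (e z) (e u) (e v) (e τ)) z := by
  unfold connQuot
  refine DifferentiableAt.div ?_ ?_ ?_
  · refine ((differentiableAt_const _).mul ?_).neg
    rw [← mul_inv, ← e_add]
    exact theta_mul_inv_e_differentiable hτ z
  · exact ((differentiableAt_const _).mul (theta_mul_inv_e_differentiable hτ z)).mul
      (theta_mul_inv_e_differentiable hτ z)
  · refine mul_ne_zero (mul_ne_zero (mul_ne_zero ?_ (theta_e_ne_zero hτ hv))
      (theta_mul_inv_e_ne_zero hτ hzu)) (theta_mul_inv_e_ne_zero hτ hzv)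
    rw [← e_neg]
    exact theta_e_ne_zero hτ (neg_mem_lattice.not.2 hu)

/-- The theta values containing t contribute -(λμt)⁻¹ to the numerator and (λμt²)⁻¹ to the
denominator. -/
lemma connQuot_mul_q {t lam mu q : ℂ} (ht : t ≠ 0) (hl : lam ≠ 0) (hm : mu ≠ 0) (hq : q ≠ 0) :
    connQuot (q * t) lam mu q = -t * connQuot t lam mu q := by
  have h : ∀ x : ℂ, x ≠ 0 → theta (x * (q * t)⁻¹) q = -(x * t⁻¹) * theta (x * t⁻¹) q := by
    intro x hx
    rw [← theta_div_q (mul_ne_zero hx (inv_ne_zero ht)) hq]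
    congr 1
    rw [mul_inv]; ring
  rw [connQuot, connQuot, h _ (by simp [hl, hm]), h _ (inv_ne_zero hl), h _ (inv_ne_zero hm)]
  field_simp

/-- The pole comes from the simple zero of θ(λ⁻¹t⁻¹), with leading coefficient (q;q)³. The other
factors, collected in C, take the value (q;q)³/θ(λ), so the residue is that of the Appell–Lerch sum.
-/
lemma connQuot_residue {u v τ : ℂ} (hτ : 0 < τ.im) (hu : u ∉ lattice τ)
    (hv : v ∉ lattice τ) (huv : -u + v ∉ lattice τ) :
    Tendsto (fun z => (z + u) * connQuot (e z) (e u) (e v) (e τ)) (𝓝[≠] (-u))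
      (𝓝 (-(2 * Real.pi * I)⁻¹ * (theta (e u) (e τ))⁻¹)) := by
  have hq := e_ne_zero τ
  have hq1 := norm_e_lt_one hτ
  set Q := qPochhammerInf (e τ) (e τ) with hQ
  have hQ0 : Q ≠ 0 := qPochhammerInf_self_ne_zero hq1
  have h1 := ((tendsto_theta_inv_div hq hq1).comp (tendsto_lam_t (u := u) hτ)).inv₀
    (pow_ne_zero 3 hQ0)
  have h2 := (tendsto_linear_div (u := u)).mul h1
  set C : ℂ → ℂ := fun z => -(Q ^ 3 * theta ((e u)⁻¹ * e v) (e τ) *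
      theta ((e u)⁻¹ * (e v)⁻¹ * (e z)⁻¹) (e τ)) /
    (theta (e u)⁻¹ (e τ) * theta (e v) (e τ) * theta ((e v)⁻¹ * (e z)⁻¹) (e τ)) with hC
  have hth : theta (e u)⁻¹ (e τ) ≠ 0 := by
    rw [← e_neg]; exact theta_e_ne_zero hτ (neg_mem_lattice.not.2 hu)
  have hCc : ContinuousAt C (-u) := by
    refine ContinuousAt.div ?_ ?_ ?_
    · refine (continuousAt_const.mul ?_).neg
      rw [← mul_inv, ← e_add]
      exact (theta_mul_inv_e_differentiable hτ).continuous.continuousAt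
    · exact continuousAt_const.mul (theta_mul_inv_e_differentiable hτ).continuous.continuousAt
    · exact mul_ne_zero (mul_ne_zero hth (theta_e_ne_zero hτ hv)) (theta_mul_inv_e_ne_zero hτ huv)
  have h3 := h2.mul (hCc.tendsto.mono_left (nhdsWithin_le_nhds (s := {-u}ᶜ)))
  have h4 : C (-u) = Q ^ 3 * (theta (e u) (e τ))⁻¹ := by
    have a1 : theta (e u) (e τ) ≠ 0 := theta_e_ne_zero hτ hu
    have a2 : theta (e v) (e τ) ≠ 0 := theta_e_ne_zero hτ hv
    have a3 := theta_inv (t := (e u)⁻¹ * e v) (by simp) hq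
    rw [mul_inv, inv_inv, mul_comm] at a3
    have a4 : theta ((e v)⁻¹ * e u) (e τ) ≠ 0 := by
      have := theta_mul_inv_e_ne_zero hτ huv
      rwa [e_neg, inv_inv] at this
    have a5 : theta ((e u)⁻¹ * e v) (e τ) ≠ 0 := fun h => a4 (by rw [a3, h, mul_zero])
    have a6 : (e u)⁻¹ * (e v)⁻¹ * (e (-u))⁻¹ = (e v)⁻¹ := by
      rw [e_neg, inv_inv]; field_simp [e_ne_zero]
    simp only [hC]
    rw [a6, e_neg, inv_inv, a3, theta_inv (e_ne_zero v) hq, theta_inv (e_ne_zero u) hq]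
    generalize theta ((e u)⁻¹ * e v) (e τ) = T at a5 ⊢
    field_simp [e_ne_zero]
  have h5 : -(2 * Real.pi * I)⁻¹ * (Q ^ 3)⁻¹ * C (-u) =
      -(2 * Real.pi * I)⁻¹ * (theta (e u) (e τ))⁻¹ := by
    rw [h4]; field_simp
  rw [h5] at h3
  refine h3.congr' ?_
  filter_upwards [(tendsto_lam_t (u := u) hτ).eventually self_mem_nhdsWithin] with z hz
  have h6 : 1 - e u * e z ≠ 0 := sub_ne_zero.2 (Ne.symm hz)
  simp only [Function.comp_apply, hC, connQuot]
  rw [mul_inv, inv_div, ← hQ]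
  field_simp

/-- The connection formula for Appell–Lerch sums. -/
theorem f0_sub_f0 {z u v τ : ℂ} (hτ : 0 < τ.im) (hu : u ∉ lattice τ) (hv : v ∉ lattice τ)
    (hz : z ∉ lattice τ) (hzu : z + u ∉ lattice τ) (hzv : z + v ∉ lattice τ) :
    f0 (e z) (e u) (e τ) - f0 (e z) (e v) (e τ) = connQuot (e z) (e u) (e v) (e τ) := by
  have hq := e_ne_zero τ
  have hq1 := norm_e_lt_one hτ
  -- In the congruent case the poles at -u and -v coincide modulo the lattice; then the quotient is
  -- zero and the two sums agree by q-periodicity in λ.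
  by_cases huv : -u + v ∈ lattice τ
  · have h1 : theta ((e u)⁻¹ * e v) (e τ) = 0 := by
      rw [← e_neg, ← e_add, theta_e_eq_zero_iff hτ]; exact huv
    have h2 : connQuot (e z) (e u) (e v) (e τ) = 0 := by simp [connQuot, h1]
    obtain ⟨n, hn⟩ := e_mem_zpow_iff.2 huv
    have h3 : e v = e τ ^ n * e u := by
      rw [← hn, e_add, e_neg]; field_simp [e_ne_zero]
    have h4 : ∀ n : ℤ, f0 (e z) (e τ ^ n * e u) (e τ) = f0 (e z) (e u) (e τ) := by
      intro n
      induction n using Int.induction_on with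
      | zero => simp
      | succ i ih =>
        rw [zpow_add_one₀ hq, mul_comm (_ ^ _), mul_assoc, f0_lam_mul_q (by simp) hq,
          ih]
      | pred i ih =>
        rw [← ih, ← f0_lam_mul_q (lam := e τ ^ (-(i : ℤ) - 1) * e u) (by simp [zpow_ne_zero]) hq,
          ← mul_assoc, mul_comm (e τ), ← zpow_add_one₀ hq, sub_add_cancel]
    rw [h2, h3, h4, sub_self]
  -- The theta factor has multiplier -t⁻¹, which cancels the multiplier -t of the bracket, and it
  -- provides the zero at z = 0.
  set F : ℂ → ℂ → ℂ → ℂ := fun u v z => (f0 (e z) (e u) (e τ) - f0 (e z) (e v) (e τ) -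
    connQuot (e z) (e u) (e v) (e τ)) * theta ((e τ)⁻¹ * e z) (e τ) with hF
  have hres : ∀ u v : ℂ, u ∉ lattice τ → v ∉ lattice τ → -u + v ∉ lattice τ →
      Tendsto (fun z => (z - (-u)) * F u v z) (𝓝[≠] (-u)) (𝓝 0) := by
    intro u v hu hv huv
    have h1 : Tendsto (fun z => (z + u) * f0 (e z) (e v) (e τ)) (𝓝[≠] (-u)) (𝓝 0) := by
      have : ContinuousAt (fun z => (z + u) * f0 (e z) (e v) (e τ)) (-u) :=
        ContinuousAt.mul (by fun_prop) (f0_e_differentiableAt hτ huv).continuousAt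
      simpa using this.tendsto.mono_left (nhdsWithin_le_nhds (s := {-u}ᶜ))
    have h2 := (((f0_residue (u := u) hτ).sub h1).sub (connQuot_residue hτ hu hv huv)).mul
      (((theta_div_q_e_differentiable hτ).continuous.tendsto (-u)).mono_left
        (nhdsWithin_le_nhds (s := {-u}ᶜ)))
    rw [sub_zero, sub_self, zero_mul] at h2
    refine h2.congr fun z => ?_
    simp only [hF]
    ring
  have hswap : ∀ z, F v u z = -F u v z := by
    intro z
    simp only [hF]
    rw [connQuot_swap (e_ne_zero _) (e_ne_zero _) hq]
    ring
  have hB : ∀ {z}, z ∉ {z | z + u ∈ lattice τ ∨ z + v ∈ lattice τ} →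
      z + u ∉ lattice τ ∧ z + v ∉ lattice τ := fun h => not_or.1 h
  have key := elliptic_eq_zero hτ (B := {z | z + u ∈ lattice τ ∨ z + v ∈ lattice τ}) (F := F u v)
    ?_ ?_ ?_ ?_ ?_ ?_ ?_ (z₀ := 0) ?_ ?_ z (not_or.2 ⟨hzu, hzv⟩)
  · have h1 : theta ((e τ)⁻¹ * e z) (e τ) ≠ 0 := by
      rw [theta_div_q (e_ne_zero z) hq]
      exact mul_ne_zero (neg_ne_zero.2 (e_ne_zero z)) (theta_e_ne_zero hτ hz)
    exact sub_eq_zero.1 ((mul_eq_zero.1 key).resolve_right h1)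
  · intro z
    simp only [Set.mem_ofPred_eq, add_right_comm z 1, add_one_mem_lattice]
  · intro z
    simp only [Set.mem_ofPred_eq, add_right_comm z τ, add_tau_mem_lattice]
  · intro p
    filter_upwards [eventually_add_notMem_lattice hτ u p, eventually_add_notMem_lattice hτ v p]
      with z h1 h2 using not_or.2 ⟨h1, h2⟩
  · intro z hz
    simp only [hF, e_add_one]
  · intro z hz
    have h1 : theta ((e τ)⁻¹ * e (z + τ)) (e τ) = -(e z)⁻¹ * theta ((e τ)⁻¹ * e z) (e τ) := by
      rw [e_add, mul_comm (e z), inv_mul_cancel_left₀ hq, theta_div_q (e_ne_zero z) hq]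
      field_simp [e_ne_zero]
    have h2 : connQuot (e (z + τ)) (e u) (e v) (e τ) =
        -e z * connQuot (e z) (e u) (e v) (e τ) := by
      rw [add_comm, e_add]
      exact connQuot_mul_q (e_ne_zero _) (e_ne_zero _) (e_ne_zero _) hq
    simp only [hF]
    rw [f0_e_add_tau hτ hu (hB hz).1, f0_e_add_tau hτ hv (hB hz).2, h1, h2]
    field_simp [e_ne_zero]
    ring
  · intro z hz
    exact (((f0_e_differentiableAt hτ (hB hz).1).sub (f0_e_differentiableAt hτ (hB hz).2)).sub
      (connQuot_e_differentiableAt hτ hu hv (hB hz).1 (hB hz).2)).mul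
      (theta_div_q_e_differentiable hτ z)
  · rintro p (⟨m, n, h⟩ | ⟨m, n, h⟩)
    · refine ⟨-m, -n, ?_⟩
      have h1 : p + (((-m : ℤ) : ℂ) + ((-n : ℤ) : ℂ) * τ) = -u := by
        push_cast; linear_combination h
      rw [h1]
      exact hres u v hu hv huv
    · refine ⟨-m, -n, ?_⟩
      have h1 : p + (((-m : ℤ) : ℂ) + ((-n : ℤ) : ℂ) * τ) = -v := by
        push_cast; linear_combination h
      rw [h1]
      have h2 : -v + u ∉ lattice τ := by
        rw [← neg_mem_lattice]; convert! huv using 2; ring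
      have h3 := (hres v u hv hu h2).neg
      rw [neg_zero] at h3
      refine h3.congr fun z => ?_
      rw [hswap]; ring
  · simp only [Set.mem_ofPred_eq, zero_add]
    exact not_or.2 ⟨hu, hv⟩
  · simp only [hF]
    rw [theta_div_q (e_ne_zero 0) hq, e_zero, theta_one _ hq hq1]
    simp

/-! ### Integrals against the hyperbolic secant -/

lemma norm_cosh_ge (w : ℂ) : Real.sinh |w.re| ≤ ‖Complex.cosh w‖ := by
  have h1 : 2 * Complex.cosh w = cexp w - -cexp (-w) := by rw [Complex.cosh]; ring
  have h2 : 2 * ‖Complex.cosh w‖ = ‖cexp w - -cexp (-w)‖ := by rw [← h1, norm_mul]; simp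
  have h3 := abs_norm_sub_norm_le (cexp w) (-cexp (-w))
  rw [norm_neg, Complex.norm_exp, Complex.norm_exp, Complex.neg_re] at h3
  have h4 := le_abs_self (Real.exp w.re - Real.exp (-w.re))
  have h5 := neg_abs_le (Real.exp w.re - Real.exp (-w.re))
  rw [Real.sinh_eq]
  rcases abs_cases w.re with ⟨h, _⟩ | ⟨h, _⟩ <;> rw [h]
  · linarith
  · rw [neg_neg]; linarith

lemma one_le_norm_cosh_ofReal (x : ℝ) : 1 ≤ ‖Complex.cosh (x : ℂ)‖ := by
  rw [← Complex.ofReal_cosh, Complex.norm_real]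
  exact (Real.one_le_cosh x).trans (le_abs_self _)

lemma integrable_inv_cosh : Integrable fun x : ℝ => (Real.cosh (Real.pi * x))⁻¹ := by
  refine integrable_inv_one_add_sq.mono' (by fun_prop) (Eventually.of_forall fun x => ?_)
  rw [norm_inv, Real.norm_of_nonneg (Real.cosh_pos _).le]
  have h1 : 1 + (Real.pi * x) ^ 2 / 2 ≤ Real.cosh (Real.pi * x) := by
    have h2 := Real.cosh_sq (Real.pi * x / 2)
    have h3 := Real.cosh_two_mul (Real.pi * x / 2)
    have h4 : |Real.pi * x / 2| ≤ |Real.sinh (Real.pi * x / 2)| := by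
      rw [Real.abs_sinh]
      exact Real.self_le_sinh_iff.2 (abs_nonneg _)
    have h5 := sq_le_sq.2 h4
    rw [mul_div_cancel₀ _ two_ne_zero] at h3
    nlinarith
  have h2 : 1 + x ^ 2 ≤ Real.cosh (Real.pi * x) := by
    nlinarith [Real.pi_gt_three, sq_nonneg x, mul_self_nonneg (Real.pi * x),
      mul_nonneg (sq_nonneg x) (sub_nonneg.2 Real.pi_gt_three.le)]
  gcongr

/-- A primitive is (2/π) arctan(e^{πx}). -/
lemma integral_inv_cosh : ∫ x : ℝ, (Real.cosh (Real.pi * x))⁻¹ = 1 := by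
  have hd : ∀ x : ℝ, HasDerivAt (fun x => 2 / Real.pi * Real.arctan (Real.exp (Real.pi * x)))
      (Real.cosh (Real.pi * x))⁻¹ x := by
    intro x
    have h := (((hasDerivAt_id x).const_mul Real.pi).exp.arctan).const_mul (2 / Real.pi)
    convert! h using 1
    rw [Real.cosh_eq, Real.exp_neg]
    simp only [id, mul_one]
    have := Real.exp_pos (Real.pi * x)
    field_simp
    ring
  have hpi : Tendsto (fun x : ℝ => Real.pi * x) atTop atTop :=
    tendsto_id.const_mul_atTop Real.pi_pos
  have hpi2 : Tendsto (fun x : ℝ => Real.pi * x) atBot atBot :=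
    tendsto_id.const_mul_atBot Real.pi_pos
  rw [integral_of_hasDerivAt_of_tendsto (m := 0) (n := 2 / Real.pi * (Real.pi / 2)) hd
    integrable_inv_cosh]
  · have := Real.pi_ne_zero
    field_simp
    simp
  · have h := ((Real.continuous_arctan.tendsto 0).comp (Real.tendsto_exp_atBot.comp hpi2)).const_mul
      (2 / Real.pi)
    simpa using h
  · exact ((Real.tendsto_arctan_atTop.mono_right nhdsWithin_le_nhds).comp
      (Real.tendsto_exp_atTop.comp hpi)).const_mul (2 / Real.pi)

lemma cosh_add_pi_I (x : ℂ) : Complex.cosh (Real.pi * (x + I)) = -Complex.cosh (Real.pi * x) := by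
  rw [mul_add, Complex.cosh_add, Complex.cosh_mul_I, Complex.sinh_mul_I]
  simp

/-- The zeros of cosh(πw) are the odd multiples of i/2, and only one of them lies in the strip. -/
lemma eq_half_I_of_cosh_eq_zero {w : ℂ} (h0 : 0 ≤ w.im) (h1 : w.im ≤ 1)
    (h : Complex.cosh (Real.pi * w) = 0) : w = I / 2 := by
  rw [← Complex.cos_mul_I, Complex.cos_eq_zero_iff] at h
  obtain ⟨k, hk⟩ := h
  have hpi : (Real.pi : ℂ) ≠ 0 := by exact_mod_cast Real.pi_ne_zero
  have h2 : w * I = (2 * k + 1) / 2 := by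
    apply mul_left_cancel₀ hpi
    linear_combination hk
  have h3 : w = -((2 * k + 1) / 2) * I := by
    linear_combination (-I) * h2 - w * (by simp : (I * I + 1 : ℂ) = 0) + 2 * w * (by simp : (I * I + 1 : ℂ) = 0)
  have h4 : w.im = -((2 * k + 1) / 2) := by
    rw [h3]
    simp
  have h5 : (k : ℝ) < 0 := by linarith
  have h6 : (-2 : ℝ) < k := by linarith
  have h7 : k = -1 := by
    have : k < 0 := by exact_mod_cast h5
    have : -2 < k := by exact_mod_cast h6
    omega
  rw [h3, h7]
  push_cast
  ring

/-- Shifting the line of integration by `i` across the pole of `1 / cosh (π w)`. -/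
theorem integral_div_cosh_sub {N : ℂ → ℂ} (hN : Differentiable ℂ N) {C : ℝ}
    (hC : ∀ w : ℂ, 0 ≤ w.im → w.im ≤ 1 → ‖N w‖ ≤ C)
    (h0 : Integrable fun x : ℝ => N x) (h1 : Integrable fun x : ℝ => N (x + I)) :
    (∫ x : ℝ, N x / (2 * Complex.cosh (Real.pi * x))) -
      ∫ x : ℝ, N (x + I) / (2 * Complex.cosh (Real.pi * (x + I))) = N (I / 2) := by
  set D : ℂ → ℂ := fun w => 2 * Complex.cosh (Real.pi * w) with hD
  have hDd : Differentiable ℂ D := by simp only [hD]; fun_prop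
  have hD0 : D (I / 2) = 0 := by
    simp only [hD]
    rw [show (Real.pi : ℂ) * (I / 2) = (Real.pi / 2 : ℂ) * I by ring, Complex.cosh_mul_I,
      Complex.cos_pi_div_two, mul_zero]
  have hD' : deriv D (I / 2) ≠ 0 := by
    have h : HasDerivAt D (2 * (Complex.sinh (Real.pi * (I / 2)) * (Real.pi * 1))) (I / 2) :=
      (((hasDerivAt_id _).const_mul (Real.pi : ℂ)).ccosh).const_mul 2
    rw [h.deriv, show (Real.pi : ℂ) * (I / 2) = (Real.pi / 2 : ℂ) * I by ring,
      Complex.sinh_mul_I, Complex.sin_pi_div_two]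
    simp [Real.pi_ne_zero]
  -- Subtracting the constant N(i/2) from N cancels the pole, so Cauchy's theorem for rectangles
  -- replaces the residue theorem. The constant is restored at the end: ∫ 1/D = 1/2, and D changes
  -- sign under the shift by i, so it contributes 1/2 + 1/2 times N(i/2).
  set Ψ : ℂ → ℂ := fun w => dslope N (I / 2) w / dslope D (I / 2) w with hΨ
  have hΨne : ∀ w, w ≠ I / 2 → Ψ w = (N w - N (I / 2)) / D w := by
    intro w hw
    have h2 : w - I / 2 ≠ 0 := sub_ne_zero.2 hw
    simp only [hΨ, dslope_of_ne _ hw, slope_def_field, hD0, sub_zero]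
    rw [div_div_div_cancel_right₀ h2]
  have hne : ∀ w : ℂ, 0 ≤ w.im → w.im ≤ 1 → dslope D (I / 2) w ≠ 0 := by
    intro w hw0 hw1
    by_cases hw : w = I / 2
    · rwa [hw, dslope_same]
    · rw [dslope_of_ne _ hw, slope_def_field, hD0, sub_zero]
      refine div_ne_zero (fun h => hw ?_) (sub_ne_zero.2 hw)
      exact eq_half_I_of_cosh_eq_zero hw0 hw1 ((mul_eq_zero.1 h).resolve_left two_ne_zero)
  have hds : ∀ f : ℂ → ℂ, Differentiable ℂ f → Differentiable ℂ (dslope f (I / 2)) := by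
    intro f hf
    rw [← differentiableOn_univ, differentiableOn_dslope univ_mem]
    exact hf.differentiableOn
  have hΨd : ∀ w : ℂ, 0 ≤ w.im → w.im ≤ 1 → DifferentiableAt ℂ Ψ w := fun w hw0 hw1 =>
    ((hds N hN) w).div ((hds D hDd) w) (hne w hw0 hw1)
  have hrect : ∀ T : ℝ, (∫ x : ℝ in -T..T, Ψ x) - (∫ x : ℝ in -T..T, Ψ (x + I)) +
      I * (∫ y : ℝ in 0..1, Ψ (T + y * I)) - I * (∫ y : ℝ in 0..1, Ψ (-T + y * I)) = 0 := by
    intro T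
    have := Complex.integral_boundary_rect_eq_zero_of_differentiableOn Ψ (-T) (T + I) (by
      intro w hw
      rw [Complex.mem_reProdIm] at hw
      have h2 := hw.2
      simp only [Complex.neg_im, Complex.ofReal_im, neg_zero, Complex.add_im, Complex.I_im,
        zero_add, Set.uIcc_of_le zero_le_one] at h2
      exact (hΨd w h2.1 h2.2).differentiableWithinAt)
    simpa using this
  -- On the vertical sides the numerator is at most 2C and the denominator at least 2 sinh(πT) ≥ 2T.
  have hvert : ∀ s : ℝ, (s = 1 ∨ s = -1) →
      Tendsto (fun T : ℝ => ∫ y : ℝ in 0..1, Ψ (s * T + y * I)) atTop (𝓝 0) := by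
    intro s hs
    have hlim : Tendsto (fun T : ℝ => C / T) atTop (𝓝 0) := tendsto_const_nhds.div_atTop tendsto_id
    refine squeeze_zero_norm' ?_ hlim
    filter_upwards [eventually_gt_atTop 0] with T hT
    have hsT : |s * T| = T := by
      rcases hs with rfl | rfl
      · rw [one_mul, abs_of_pos hT]
      · rw [neg_one_mul, abs_neg, abs_of_pos hT]
    have h2 := intervalIntegral.norm_integral_le_of_norm_le_const (a := 0) (b := 1) (C := C / T)
      (f := fun y : ℝ => Ψ (s * T + y * I)) (fun y hy => ?_)
    · simpa using h2
    · rw [Set.uIoc_of_le zero_le_one] at hy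
      have him : ((s : ℂ) * T + y * I).im = y := by simp
      have hre : ((s : ℂ) * T + y * I).re = s * T := by simp
      rw [hΨne]
      · rw [norm_div]
        have h3 : ‖N (s * T + y * I) - N (I / 2)‖ ≤ 2 * C := by
          have h4 := hC (s * T + y * I) (by rw [him]; exact hy.1.le) (by rw [him]; exact hy.2)
          have h5 := hC (I / 2) (by simp) (by simp; norm_num)
          exact (norm_sub_le _ _).trans (by linarith)
        have h4 : 2 * T ≤ ‖D (s * T + y * I)‖ := by
          simp only [hD]
          rw [norm_mul, Complex.norm_ofNat]
          have h5 := norm_cosh_ge (Real.pi * (s * T + y * I))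
          rw [Complex.re_ofReal_mul, hre, abs_mul, abs_of_pos Real.pi_pos, hsT] at h5
          have h6 : Real.pi * T ≤ Real.sinh (Real.pi * T) := Real.self_le_sinh_iff.2 (by positivity)
          nlinarith [Real.pi_gt_three]
        calc _ ≤ 2 * C / (2 * T) := by
              have := (norm_nonneg _).trans h3
              gcongr
          _ = C / T := by field_simp
      · intro h
        have := congrArg Complex.re h
        rw [hre] at this
        simp only [Complex.div_ofNat_re, Complex.I_re, zero_div] at this
        rw [this, abs_zero] at hsT
        exact hT.ne hsT
  have hcosh : ∀ x : ℝ, D x = ((2 * Real.cosh (Real.pi * x) : ℝ) : ℂ) := by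
    intro x; simp [hD]
  have hDI : ∀ x : ℂ, D (x + I) = -D x := by
    intro x; simp only [hD]; rw [cosh_add_pi_I]; ring
  have hDint : Integrable fun x : ℝ => (D x)⁻¹ := by
    have h2 : (fun x : ℝ => (D x)⁻¹) =
        fun x : ℝ => (((1 / 2 : ℝ) * (Real.cosh (Real.pi * x))⁻¹ : ℝ) : ℂ) := by
      ext x; rw [hcosh]; push_cast; ring
    rw [h2]
    exact (integrable_inv_cosh.const_mul _).ofReal
  have hDval : ∫ x : ℝ, (D x)⁻¹ = 1 / 2 := by
    have h2 : (fun x : ℝ => (D x)⁻¹) =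
        fun x : ℝ => (((1 / 2 : ℝ) * (Real.cosh (Real.pi * x))⁻¹ : ℝ) : ℂ) := by
      ext x; rw [hcosh]; push_cast; ring
    rw [h2, integral_complex_ofReal, integral_const_mul, integral_inv_cosh]
    simp
  have hDbd : ∀ x : ℝ, ‖(D x)⁻¹‖ ≤ 1 := by
    intro x
    rw [norm_inv]
    refine inv_le_one_of_one_le₀ ?_
    simp only [hD, norm_mul, Complex.norm_ofNat]
    have := one_le_norm_cosh_ofReal (Real.pi * x)
    push_cast at this
    linarith
  have hDcont : Continuous fun x : ℝ => (D x)⁻¹ := by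
    refine Continuous.inv₀ (hDd.continuous.comp Complex.continuous_ofReal) fun x => ?_
    rw [hcosh]
    exact_mod_cast (mul_pos two_pos (Real.cosh_pos _)).ne'
  have hN0 : Integrable fun x : ℝ => N x / D x := by
    simp only [div_eq_mul_inv]
    exact h0.mul_bdd (c := 1) hDcont.aestronglyMeasurable (Eventually.of_forall hDbd)
  have hN1 : Integrable fun x : ℝ => N (x + I) / D (x + I) := by
    simp only [div_eq_mul_inv, hDI, inv_neg, mul_neg]
    exact (h1.mul_bdd (c := 1) hDcont.aestronglyMeasurable (Eventually.of_forall hDbd)).neg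
  have hΨ0 : ∀ x : ℝ, Ψ x = N x / D x - N (I / 2) * (D x)⁻¹ := by
    intro x
    rw [hΨne, sub_div, div_eq_mul_inv (N (I / 2))]
    intro h
    have := congrArg Complex.im h
    simp at this
  have hΨ1 : ∀ x : ℝ, Ψ (x + I) = N (x + I) / D (x + I) + N (I / 2) * (D x)⁻¹ := by
    intro x
    rw [hΨne, sub_div, div_eq_mul_inv (N (I / 2)), hDI, inv_neg, mul_neg, sub_neg_eq_add]
    intro h
    have := congrArg Complex.im h
    norm_num at this
  have hint0 : Integrable fun x : ℝ => Ψ x := by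
    simp only [hΨ0]; exact hN0.sub (hDint.const_mul _)
  have hint1 : Integrable fun x : ℝ => Ψ (x + I) := by
    simp only [hΨ1]; exact hN1.add (hDint.const_mul _)
  have hlim := (((intervalIntegral_tendsto_integral hint0 tendsto_neg_atTop_atBot tendsto_id).sub
    (intervalIntegral_tendsto_integral hint1 tendsto_neg_atTop_atBot tendsto_id)).add
    ((hvert 1 (Or.inl rfl)).const_mul I)).sub ((hvert (-1) (Or.inr rfl)).const_mul I)
  have hzero : (∫ x : ℝ, Ψ x) - ∫ x : ℝ, Ψ (x + I) = 0 := by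
    have h2 := tendsto_nhds_unique hlim (tendsto_const_nhds (x := (0 : ℂ)) |>.congr fun T => by
      rw [← hrect T]; simp)
    simpa using h2
  simp only [hΨ0, hΨ1] at hzero
  rw [integral_sub hN0 (hDint.const_mul _), integral_add hN1 (hDint.const_mul _),
    integral_const_mul, hDval] at hzero
  linear_combination hzero

/-! ### The Mordell integral -/

/-- The Gaussian factor of the integrand of the Mordell integral. -/
def mordellNum (z τ w : ℂ) : ℂ := cexp (Real.pi * I * (τ * w ^ 2 + 2 * I * z * w))

lemma mordell_eq (z τ : ℂ) :
    mordell z τ = ∫ x : ℝ, mordellNum z τ x / (2 * Complex.cosh (Real.pi * x)) := rfl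

lemma norm_mordellNum (z τ w : ℂ) : ‖mordellNum z τ w‖ =
    Real.exp (-Real.pi * (τ.im * (w.re ^ 2 - w.im ^ 2) + 2 * τ.re * w.re * w.im +
      2 * (z.re * w.re - z.im * w.im))) := by
  rw [mordellNum, Complex.norm_exp]
  congr 1
  simp [pow_two]
  ring

lemma integrable_mordellNum {z τ : ℂ} (hτ : 0 < τ.im) :
    Integrable fun x : ℝ => mordellNum z τ x := by
  have h := integrable_cexp_quadratic' (b := Real.pi * I * τ)
    (by simpa using mul_pos Real.pi_pos hτ) (-2 * Real.pi * z) 0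
  refine h.congr (Eventually.of_forall fun x => ?_)
  simp only [mordellNum]
  congr 1
  linear_combination -2 * Real.pi * z * x * I_mul_I

/-- Shifting the contour by i amounts to shifting z by τ; this turns the contour shift into a
functional equation. -/
lemma mordellNum_add_I (z τ w : ℂ) :
    mordellNum z τ (w + I) = e (-τ / 2 - z) * mordellNum (z + τ) τ w := by
  rw [mordellNum, mordellNum, e, ← Complex.exp_add]
  congr 1
  linear_combination (Real.pi * I * (τ + 2 * z)) * I_mul_I

/-- The terms linear in Re w are absorbed by the Gaussian through 2a|x| ≤ a²/Im τ + (Im τ)x². -/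
lemma norm_mordellNum_le {z τ : ℂ} (hτ : 0 < τ.im) : ∃ C : ℝ, ∀ w : ℂ, 0 ≤ w.im → w.im ≤ 1 →
    ‖mordellNum z τ w‖ ≤ C := by
  set a : ℝ := |τ.re| + |z.re| with ha
  refine ⟨Real.exp (Real.pi * (a ^ 2 / τ.im + τ.im + 2 * |z.im|)), fun w h0 h1 => ?_⟩
  rw [norm_mordellNum, Real.exp_le_exp, neg_mul, ← mul_neg]
  refine mul_le_mul_of_nonneg_left ?_ Real.pi_pos.le
  have h2 : -(2 * τ.re * w.re * w.im) ≤ 2 * |τ.re| * |w.re| := by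
    have h3 : |τ.re * w.re * w.im| ≤ |τ.re| * |w.re| * 1 := by
      rw [abs_mul, abs_mul]
      gcongr
      rw [abs_of_nonneg h0]; exact h1
    have := neg_abs_le (τ.re * w.re * w.im)
    linarith
  have h3 : -(z.re * w.re) ≤ |z.re| * |w.re| := by
    rw [← abs_mul]; exact neg_le_abs _
  have h4 : z.im * w.im ≤ |z.im| := by
    calc z.im * w.im ≤ |z.im| * 1 := by
          refine mul_le_mul (le_abs_self _) h1 h0 (abs_nonneg _)
      _ = _ := mul_one _
  have h5 : τ.im * w.im ^ 2 ≤ τ.im := mul_le_of_le_one_right hτ.le (pow_le_one₀ h0 h1)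
  have h6 : 2 * a * |w.re| ≤ a ^ 2 / τ.im + τ.im * w.re ^ 2 := by
    rw [← sq_abs w.re, div_add' _ _ _ hτ.ne', le_div_iff₀ hτ]
    nlinarith [sq_nonneg (a - τ.im * |w.re|)]
  rw [ha] at h6 ⊢
  nlinarith

/-- The first functional equation of the Mordell integral. -/
theorem mordell_add_tau {z τ : ℂ} (hτ : 0 < τ.im) :
    mordell z τ + e (-τ / 2 - z) * mordell (z + τ) τ = e (-τ / 8 - z / 2) := by
  obtain ⟨C, hC⟩ := norm_mordellNum_le (z := z) hτ
  have hd : Differentiable ℂ (mordellNum z τ) := by unfold mordellNum; fun_prop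
  have h := integral_div_cosh_sub hd hC (integrable_mordellNum hτ) (by
    simp only [mordellNum_add_I]
    exact (integrable_mordellNum hτ).const_mul _)
  simp only [mordellNum_add_I, cosh_add_pi_I, mul_neg, div_neg, mul_div_assoc] at h
  rw [integral_neg, integral_const_mul, sub_neg_eq_add, ← mordell_eq] at h
  rw [mordell_eq (z + τ), h, mordellNum, e]
  congr 1
  linear_combination (Real.pi * I * τ / 4 + Real.pi * I * z) * I_mul_I

/-- The argument of τ lies in [0, π], so subtracting π/2 does not cross the branch cut. -/
lemma neg_I_mul_cpow {τ : ℂ} (hτ : 0 < τ.im) :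
    (-I * τ) ^ (1 / 2 : ℂ) = e (-1 / 8) * τ ^ (1 / 2 : ℂ) := by
  have h0 : τ ≠ 0 := by rintro rfl; simp at hτ
  have h1 : Complex.log (-I * τ) = Complex.log (-I) + Complex.log τ := by
    refine Complex.log_mul (by simp) h0 ?_
    have h2 := Complex.arg_le_pi τ
    have h3 := Complex.arg_nonneg_iff.2 hτ.le
    rw [Complex.arg_neg_I]
    constructor <;> linarith [Real.pi_pos]
  rw [Complex.cpow_def_of_ne_zero (by simp [h0]), Complex.cpow_def_of_ne_zero h0, h1,
    Complex.log_neg_I, e, ← Complex.exp_add]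
  congr 1
  ring

/-- The second functional equation of the Mordell integral. -/
theorem mordell_add_one {z τ : ℂ} (hτ : 0 < τ.im) :
    mordell z τ + mordell (z + 1) τ =
      e (1 / 8) / τ ^ (1 / 2 : ℂ) * e ((z + 1 / 2) ^ 2 / (2 * τ)) := by
  have h0 : τ ≠ 0 := by rintro rfl; simp at hτ
  have hint : ∀ z : ℂ, Integrable fun x : ℝ =>
      mordellNum z τ x / (2 * Complex.cosh (Real.pi * x)) := by
    intro z
    have hcosh : ∀ x : ℝ, 1 ≤ ‖Complex.cosh (Real.pi * x)‖ := fun x => by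
      have := one_le_norm_cosh_ofReal (Real.pi * x)
      push_cast at this
      exact this
    simp only [div_eq_mul_inv]
    refine (integrable_mordellNum hτ).mul_bdd (c := 1) ?_ (Eventually.of_forall fun x => ?_)
    · refine (Continuous.inv₀ (by fun_prop) fun x hx => ?_).aestronglyMeasurable
      have := hcosh x
      rw [(mul_eq_zero.1 hx).resolve_left two_ne_zero, norm_zero] at this
      linarith
    · rw [norm_inv, norm_mul, Complex.norm_ofNat]
      refine inv_le_one_of_one_le₀ ?_
      linarith [hcosh x]
  rw [mordell_eq, mordell_eq, ← integral_add (hint _) (hint _)]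
  -- The two numerators are e^{πx} and e^{-πx} times the Gaussian with parameter z + 1/2; their sum
  -- cancels 2cosh(πx).
  have h1 : ∀ x : ℝ, mordellNum z τ x / (2 * Complex.cosh (Real.pi * x)) +
      mordellNum (z + 1) τ x / (2 * Complex.cosh (Real.pi * x)) =
      cexp (Real.pi * I * τ * x ^ 2 + (-2 * Real.pi * (z + 1 / 2)) * x + 0) := by
    intro x
    have hne : 2 * Complex.cosh (Real.pi * x) ≠ 0 := by
      rw [← Complex.ofReal_mul, ← Complex.ofReal_cosh]
      exact_mod_cast (mul_pos two_pos (Real.cosh_pos _)).ne'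
    rw [← add_div, div_eq_iff hne, Complex.two_cosh, mul_add, mordellNum, mordellNum,
      ← Complex.exp_add, ← Complex.exp_add]
    congr 2
    · linear_combination 2 * Real.pi * z * x * I_mul_I
    · linear_combination 2 * Real.pi * (z + 1) * x * I_mul_I
  simp only [h1]
  rw [integral_cexp_quadratic (by simpa using mul_pos Real.pi_pos hτ)]
  have hpi : (Real.pi : ℂ) ≠ 0 := by exact_mod_cast Real.pi_ne_zero
  have h2 : (Real.pi : ℂ) / -(Real.pi * I * τ) = (-I * τ)⁻¹ := by
    field_simp
  have harg : (-I * τ).arg ≠ Real.pi := by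
    intro h
    have := (Complex.arg_eq_pi_iff.1 h).1
    simp at this
    linarith
  rw [h2, Complex.inv_cpow _ _ harg, neg_I_mul_cpow hτ, mul_inv, ← e_neg, neg_div, neg_neg,
    ← div_eq_mul_inv]
  congr 1
  rw [e]
  congr 1
  field_simp
  linear_combination (-16 * Real.pi * (z + 1 / 2) ^ 2) * (by simp : (I * I + 1 : ℂ) = 0)

/-! ### Osgood's lemma -/

/-- The integral of a continuous function on a circle against `dζ`, as a functional. -/
def circleFunctional (c : ℂ) {r : ℝ} (hr : 0 ≤ r) : C(Metric.sphere c r, ℂ) →L[ℂ] ℂ :=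
  LinearMap.mkContinuous
    { toFun := fun g => ∫ θ in 0..2 * Real.pi,
        deriv (circleMap c r) θ * g ⟨circleMap c r θ, circleMap_mem_sphere c hr θ⟩
      map_add' := by
        intro f g
        simp only [ContinuousMap.add_apply, mul_add]
        have h : ∀ g : C(Metric.sphere c r, ℂ), Continuous fun θ =>
            deriv (circleMap c r) θ * g ⟨circleMap c r θ, circleMap_mem_sphere c hr θ⟩ := by
          intro g
          simp only [deriv_circleMap]
          fun_prop
        exact intervalIntegral.integral_add ((h f).intervalIntegrable _ _)
          ((h g).intervalIntegrable _ _)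
      map_smul' := by
        intro a g
        simp only [ContinuousMap.smul_apply, smul_eq_mul, RingHom.id_apply]
        rw [← intervalIntegral.integral_const_mul]
        congr 1
        ext θ
        ring }
    (r * |2 * Real.pi|) (by
      intro g
      have h := intervalIntegral.norm_integral_le_of_norm_le_const (a := 0) (b := 2 * Real.pi)
        (C := r * ‖g‖)
        (f := fun θ => deriv (circleMap c r) θ *
          g ⟨circleMap c r θ, circleMap_mem_sphere c hr θ⟩) (fun θ _ => by
          rw [norm_mul, deriv_circleMap, norm_mul, Complex.norm_I, mul_one, norm_circleMap_zero,
            abs_of_nonneg hr]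
          gcongr
          exact g.norm_coe_le_norm _)
      simp only [LinearMap.coe_mk, AddHom.coe_mk]
      refine h.trans (le_of_eq ?_)
      rw [sub_zero]; ring)

lemma circleFunctional_apply (c : ℂ) {r : ℝ} (hr : 0 ≤ r) (g : C(Metric.sphere c r, ℂ))
    (f : ℂ → ℂ) (h : ∀ ζ : Metric.sphere c r, f ζ = g ζ) : circleFunctional c hr g = ∮ ζ in C(c, r), f ζ := by
  simp only [circleFunctional, LinearMap.mkContinuous_apply, LinearMap.coe_mk, AddHom.coe_mk,
    circleIntegral, smul_eq_mul]
  exact intervalIntegral.integral_congr fun θ _ => by rw [← h]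

/-- A holomorphic function of one variable, depending continuously on a parameter in a compact
space, is analytic as a function with values in the continuous functions of the parameter. -/
lemma analyticAt_continuousMap {Y : Type*} [TopologicalSpace Y] [CompactSpace Y] {G : ℂ → C(Y, ℂ)}
    {c : ℂ} {r : ℝ} (hr : 0 < r) (hc : ContinuousOn G (Metric.closedBall c r))
    (hd : ∀ y, ∀ w ∈ Metric.closedBall c r, DifferentiableAt ℂ (fun w => G w y) w) :
    AnalyticAt ℂ G c := by
  lift r to NNReal using hr.le
  have hr' : 0 < r := by exact_mod_cast hr
  have hci : CircleIntegrable G c r :=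
    (hc.mono Metric.sphere_subset_closedBall).circleIntegrable r.2
  -- The vector-valued Cauchy integral is analytic. Evaluation at y commutes with it, so its
  -- equality with G is the scalar Cauchy formula.
  refine (hasFPowerSeriesOn_cauchy_integral hci hr').analyticAt.congr ?_
  filter_upwards [Metric.ball_mem_nhds c hr] with w hw
  ext y
  have hdc : DiffContOnCl ℂ (fun w => G w y) (Metric.ball c r) := by
    refine DifferentiableOn.diffContOnCl fun w hw => ?_
    exact (hd y w (Metric.closure_ball_subset_closedBall hw)).differentiableWithinAt
  have h1 := hdc.two_pi_i_inv_smul_circleIntegral_sub_inv_smul hw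
  rw [← h1, ContinuousMap.smul_apply]
  congr 1
  have hcont : ContinuousOn (fun z => (z - w)⁻¹ • G z) (Metric.sphere c r) := by
    refine ContinuousOn.smul (ContinuousOn.inv₀ (f := fun z => z - w) (by fun_prop) fun z hz h => ?_)
      (hc.mono Metric.sphere_subset_closedBall)
    rw [sub_eq_zero.1 h, Metric.mem_sphere] at hz
    exact (Metric.mem_ball.1 hw).ne hz
  have hint : IntervalIntegrable (fun θ => deriv (circleMap c r) θ •
      ((circleMap c r θ - w)⁻¹ • G (circleMap c r θ))) volume 0 (2 * Real.pi) := by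
    refine (CircleIntegrable.out (f := fun z => (z - w)⁻¹ • G z) ?_)
    exact hcont.circleIntegrable r.2
  have h2 := ContinuousLinearMap.intervalIntegral_comp_comm
    (ContinuousMap.evalCLM (M := ℂ) ℂ y) hint
  simp only [circleIntegral]
  exact h2.symm

open scoped Classical in
/-- **Osgood's lemma** in two variables: a continuous function that is holomorphic in each
variable separately is analytic. -/
theorem analyticAt_of_separately_differentiable {f : ℂ × ℂ → ℂ} {U : Set (ℂ × ℂ)} (hU : IsOpen U)
    (hc : ContinuousOn f U) (h1 : ∀ p ∈ U, DifferentiableAt ℂ (fun z => f (z, p.2)) p.1)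
    (h2 : ∀ p ∈ U, DifferentiableAt ℂ (fun w => f (p.1, w)) p.2) {p : ℂ × ℂ} (hp : p ∈ U) :
    AnalyticAt ℂ f p := by
  obtain ⟨r, hr, hrU⟩ := Metric.nhds_basis_closedBall.mem_iff.1 (hU.mem_nhds hp)
  have hprod : ∀ {z w : ℂ}, z ∈ Metric.closedBall p.1 r → w ∈ Metric.closedBall p.2 r →
      (z, w) ∈ U := by
    intro z w hz hw
    apply hrU
    rw [← closedBall_prod_same]
    exact ⟨hz, hw⟩
  have hsph : ∀ ζ : Metric.sphere p.1 r, (ζ : ℂ) ∈ Metric.closedBall p.1 r := fun ζ =>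
    Metric.sphere_subset_closedBall ζ.2
  -- Cauchy's formula in the first variable writes f(z, w) as a continuous functional of (ζ - z)⁻¹
  -- G(w). Joint analyticity follows because each factor is an analytic Banach-valued function of
  -- one variable. The value 0 outside the ball is irrelevant.
  let G : ℂ → C(Metric.sphere p.1 r, ℂ) := fun w =>
    if hw : w ∈ Metric.closedBall p.2 r then
      ⟨fun ζ => f (ζ, w), hc.comp_continuous (by fun_prop) fun ζ => hprod (hsph ζ) hw⟩ else 0
  have hG : ∀ w ∈ Metric.closedBall p.2 r, ∀ ζ, G w ζ = f (ζ, w) := by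
    intro w hw ζ
    simp only [G, dif_pos hw, ContinuousMap.coe_mk]
  have hGc : ContinuousOn G (Metric.closedBall p.2 r) := by
    rw [continuousOn_iff_continuous_domRestrict]
    let H : C(Metric.closedBall p.2 r × Metric.sphere p.1 r, ℂ) :=
      ⟨fun x => f (x.2, x.1), hc.comp_continuous (by fun_prop) fun x => hprod (hsph x.2) x.1.2⟩
    convert! H.curry.continuous using 1
    ext w ζ
    exact hG w w.2 ζ
  have hGan : AnalyticAt ℂ G p.2 := by
    -- The radius is halved so that G is given by f on a neighbourhood of every point considered.
    refine analyticAt_continuousMap (half_pos hr)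
      (hGc.mono (Metric.closedBall_subset_closedBall (half_le_self hr.le))) fun ζ w hw => ?_
    have hw2 : w ∈ Metric.ball p.2 r :=
      Metric.closedBall_subset_ball (half_lt_self hr) hw
    refine (h2 (ζ, w) (hprod (hsph ζ) (Metric.ball_subset_closedBall hw2))).congr_of_eventuallyEq ?_
    filter_upwards [Metric.isOpen_ball.mem_nhds hw2] with w' hw'
    exact hG w' (Metric.ball_subset_closedBall hw') ζ
  let ι : C(Metric.sphere p.1 r, ℂ) := ⟨fun ζ => (ζ : ℂ), continuous_subtype_val⟩
  -- The Cauchy kernel is the inverse of k(z) in the Banach algebra of continuous functions on the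
  -- circle, where inversion is analytic at units.
  let k : ℂ → C(Metric.sphere p.1 r, ℂ) := fun z => ι - z • 1
  have hk0 : ∀ z ∈ Metric.ball p.1 r, ∀ ζ, k z ζ ≠ 0 := by
    intro z hz ζ h
    have h3 : (ζ : ℂ) - z = 0 := by simpa [k, ι] using h
    have h4 : (ζ : ℂ) ∈ Metric.sphere p.1 r := ζ.2
    rw [sub_eq_zero.1 h3, Metric.mem_sphere] at h4
    exact (Metric.mem_ball.1 hz).ne h4
  have hku : ∀ z ∈ Metric.ball p.1 r, IsUnit (k z) := fun z hz =>
    (ContinuousMap.isUnit_iff_forall_ne_zero _).2 (hk0 z hz)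
  have hkinv : ∀ z ∈ Metric.ball p.1 r, ∀ ζ : Metric.sphere p.1 r,
      Ring.inverse (k z) ζ = ((ζ : ℂ) - z)⁻¹ := by
    intro z hz ζ
    have h3 := congrArg (fun g : C(Metric.sphere p.1 r, ℂ) => g ζ)
      (Ring.inverse_mul_cancel _ (hku z hz))
    simp only [ContinuousMap.mul_apply, ContinuousMap.one_apply] at h3
    have h4 : k z ζ = ζ - z := by simp [k, ι]
    rw [← h4]
    exact eq_inv_of_mul_eq_one_left h3
  have hkan : AnalyticAt ℂ k p.1 := by
    exact analyticAt_const.sub (analyticAt_id.smul analyticAt_const)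
  have hinv : AnalyticAt ℂ (fun z => Ring.inverse (k z)) p.1 := by
    obtain ⟨u, hu⟩ := hku p.1 (Metric.mem_ball_self hr)
    have h3 : AnalyticAt ℂ Ring.inverse (k p.1) := by
      rw [← hu]; exact analyticAt_inverse u
    exact h3.comp hkan
  have han : AnalyticAt ℂ (fun x : ℂ × ℂ => (2 * Real.pi * I : ℂ)⁻¹ *
      circleFunctional p.1 hr.le (Ring.inverse (k x.1) * G x.2)) p := by
    have h3 : AnalyticAt ℂ (fun x : ℂ × ℂ => Ring.inverse (k x.1) * G x.2) p :=
      (AnalyticAt.comp (f := Prod.fst) hinv analyticAt_fst).mul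
        (AnalyticAt.comp (f := Prod.snd) hGan analyticAt_snd)
    exact analyticAt_const.mul ((circleFunctional p.1 hr.le).analyticAt _ |>.comp h3)
  refine han.congr ?_
  have hnhds : Metric.ball p.1 r ×ˢ Metric.ball p.2 r ∈ 𝓝 p :=
    prod_mem_nhds (Metric.ball_mem_nhds _ hr) (Metric.ball_mem_nhds _ hr)
  filter_upwards [hnhds] with x hx
  have hx2 := Metric.ball_subset_closedBall hx.2
  have hdc : DiffContOnCl ℂ (fun z => f (z, x.2)) (Metric.ball p.1 r) := by
    refine DifferentiableOn.diffContOnCl fun z hz => ?_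
    exact (h1 (z, x.2) (hprod (Metric.closure_ball_subset_closedBall hz) hx2)).differentiableWithinAt
  have h3 := hdc.two_pi_i_inv_smul_circleIntegral_sub_inv_smul hx.1
  rw [smul_eq_mul] at h3
  rw [circleFunctional_apply p.1 hr.le _ (fun ζ => (ζ - x.1)⁻¹ • f (ζ, x.2)) fun ζ => ?_]
  · exact h3
  · rw [ContinuousMap.mul_apply, hkinv _ hx.1, hG _ hx2, smul_eq_mul]

/-! ### Holomorphic dependence of integrals on parameters -/

/-- Cauchy's estimate on discs of radius r/4 bounds the derivative by 4b/r, so no separate bound on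
it is needed; its measurability comes from difference quotients. -/
lemma differentiableAt_integral_of_dominated {F : ℂ → ℝ → ℂ} {z₀ : ℂ} {r : ℝ} (hr : 0 < r)
    {b : ℝ → ℝ} (hb : Integrable b)
    (hd : ∀ x, DifferentiableOn ℂ (F · x) (Metric.ball z₀ r))
    (hm : ∀ z ∈ Metric.ball z₀ r, AEStronglyMeasurable (F z))
    (hF : ∀ z ∈ Metric.ball z₀ r, ∀ x, ‖F z x‖ ≤ b x) :
    DifferentiableAt ℂ (fun z => ∫ x, F z x) z₀ := by
  have hr2 : 0 < r / 2 := half_pos hr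
  have hsub : ∀ z ∈ Metric.ball z₀ (r / 2), Metric.closedBall z (r / 4) ⊆ Metric.ball z₀ r := by
    intro z hz w hw
    rw [Metric.mem_ball] at hz ⊢
    rw [Metric.mem_closedBall] at hw
    linarith [dist_triangle w z z₀]
  have hz₀ : z₀ ∈ Metric.ball z₀ r := Metric.mem_ball_self hr
  have hF' : ∀ z ∈ Metric.ball z₀ (r / 2), ∀ x, HasDerivAt (F · x) (deriv (F · x) z) z := by
    intro z hz x
    exact ((hd x).differentiableAt (Metric.isOpen_ball.mem_nhds
      (Metric.ball_subset_ball (half_le_self hr.le) hz))).hasDerivAt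
  have hmeas : AEStronglyMeasurable (fun x => deriv (F · x) z₀) := by
    obtain ⟨u, hu0, hu⟩ : ∃ u : ℕ → ℂ, (∀ n, u n ∈ Metric.ball z₀ r \ {z₀}) ∧
        Tendsto u atTop (𝓝[≠] z₀) := by
      have h3 : (𝓝[≠] z₀).NeBot := inferInstance
      obtain ⟨u, hu⟩ := exists_seq_tendsto (𝓝[≠] z₀)
      have h4 : ∀ᶠ n in atTop, u n ∈ Metric.ball z₀ r \ {z₀} :=
        hu.eventually (inter_mem (nhdsWithin_le_nhds (Metric.ball_mem_nhds _ hr))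
          self_mem_nhdsWithin)
      obtain ⟨N, hN⟩ := eventually_atTop.1 h4
      exact ⟨fun n => u (n + N), fun n => hN _ (Nat.le_add_left _ _),
        hu.comp (tendsto_add_atTop_nat N)⟩
    refine aestronglyMeasurable_of_tendsto_ae atTop
      (f := fun n x => (u n - z₀)⁻¹ • (F (u n) x - F z₀ x)) (fun n => ?_) ?_
    · exact ((hm _ (hu0 n).1).sub (hm _ hz₀)).const_smul (u n - z₀)⁻¹
    · refine Eventually.of_forall fun x => ?_
      have h3 := (hasDerivAt_iff_tendsto_slope.1 (hF' z₀ (Metric.mem_ball_self hr2) x)).comp hu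
      exact h3
  refine (hasDerivAt_integral_of_dominated_loc_of_deriv_le (μ := volume)
    (bound := fun x => b x / (r / 4)) (F' := fun z x => deriv (F · x) z)
    (Metric.ball_mem_nhds z₀ hr2) ?_ ?_ hmeas ?_ ?_ ?_).2.differentiableAt
  · filter_upwards [Metric.ball_mem_nhds z₀ hr] with z hz using hm z hz
  · exact hb.mono' (hm z₀ hz₀) (Eventually.of_forall (hF z₀ hz₀))
  · refine Eventually.of_forall fun x z hz => ?_
    refine norm_deriv_le_of_forall_mem_sphere_norm_le (by positivity) ?_ fun w hw => ?_
    · refine DifferentiableOn.diffContOnCl ((hd x).mono ?_)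
      exact Metric.closure_ball_subset_closedBall.trans (hsub z hz)
    · exact hF w (hsub z hz (Metric.sphere_subset_closedBall hw)) x
  · exact hb.div_const _
  · exact Eventually.of_forall fun x z hz => hF' z hz x

/-! ### Rotation of the contour of the Mordell integral -/

/-- The integrand of the Mordell integral on a rotated line. -/
def mordellKernel (s w z : ℂ) (x : ℝ) : ℂ :=
  cexp (-Real.pi * s * x ^ 2 - 2 * Real.pi * z * w * x) / (2 * Complex.cosh (Real.pi * w * x))

/-- For |x| ≤ 1/(4β) the imaginary part of πwx is at most π/4 in size, and the real part of cosh is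
at least 1/2. For larger |x| the bound sinh(π Re w |x|) ≥ πα|x| takes over. -/
lemma le_norm_cosh {w : ℂ} {α β : ℝ} (hα : 0 < α) (hβ : 0 < β) (h1 : α ≤ w.re) (h2 : ‖w‖ ≤ β)
    (x : ℝ) : min (1 / 2) (Real.pi * α / (4 * β)) ≤ ‖Complex.cosh (Real.pi * w * x)‖ := by
  have hre : (Real.pi * w * x : ℂ).re = Real.pi * w.re * x := by simp
  have him : (Real.pi * w * x : ℂ).im = Real.pi * w.im * x := by simp
  rcases le_or_gt |x| (1 / (4 * β)) with hx | hx
  · refine (min_le_left _ _).trans ?_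
    have h3 : |Real.pi * w.im * x| ≤ Real.pi / 4 := by
      rw [abs_mul, abs_mul, abs_of_pos Real.pi_pos]
      calc Real.pi * |w.im| * |x| ≤ Real.pi * β * (1 / (4 * β)) := by
            gcongr
            exact (Complex.abs_im_le_norm w).trans h2
        _ = Real.pi / 4 := by field_simp
    have h4 : 1 / 2 ≤ Real.cos (Real.pi * w.im * x) := by
      have h5 := Real.one_sub_sq_div_two_le_cos (x := Real.pi * w.im * x)
      have h6 : (Real.pi * w.im * x) ^ 2 ≤ 1 := by
        rw [← sq_abs]
        have := Real.pi_lt_four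
        exact pow_le_one₀ (abs_nonneg _) (by linarith)
      linarith
    have h5 : (Complex.cosh (Real.pi * w * x)).re =
        Real.cosh (Real.pi * w.re * x) * Real.cos (Real.pi * w.im * x) := by
      rw [← Complex.re_add_im (Real.pi * w * x), hre, him, Complex.cosh_add, Complex.cosh_mul_I,
        Complex.sinh_mul_I, ← Complex.ofReal_cosh, ← Complex.ofReal_cos, ← Complex.ofReal_sinh,
        ← Complex.ofReal_sin, ← mul_assoc, ← Complex.ofReal_mul, ← Complex.ofReal_mul]
      simp only [Complex.add_re, Complex.ofReal_re, Complex.re_ofReal_mul, Complex.I_re, mul_zero,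
        add_zero]
    refine le_trans ?_ (Complex.re_le_norm _)
    rw [h5]
    nlinarith [Real.one_le_cosh (Real.pi * w.re * x)]
  · refine (min_le_right _ _).trans (le_trans ?_ (norm_cosh_ge _))
    rw [hre, abs_mul, abs_mul, abs_of_pos Real.pi_pos, abs_of_pos (hα.trans_le h1)]
    have hw := hα.trans_le h1
    have hpi := Real.pi_pos
    refine le_trans ?_ (Real.self_le_sinh_iff.2 (by positivity))
    calc Real.pi * α / (4 * β) = Real.pi * α * (1 / (4 * β)) := by ring
      _ ≤ Real.pi * w.re * |x| := by gcongr

lemma cosh_ne_zero_of_re_pos {w : ℂ} (h : 0 < w.re) (x : ℝ) :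
    Complex.cosh (Real.pi * w * x) ≠ 0 := by
  have hw : 0 < ‖w‖ := norm_pos_iff.2 fun h0 => by simp [h0] at h
  have h1 := le_norm_cosh h hw le_rfl le_rfl x
  have h2 : 0 < min (1 / 2) (Real.pi * w.re / (4 * ‖w‖)) :=
    lt_min (by norm_num) (by have := Real.pi_pos; positivity)
  exact norm_pos_iff.1 (h2.trans_le h1)

lemma continuous_mordellKernel {s w z : ℂ} (h : 0 < w.re) : Continuous (mordellKernel s w z) := by
  unfold mordellKernel
  refine Continuous.div (by fun_prop) (by fun_prop) fun x => ?_
  exact mul_ne_zero two_ne_zero (cosh_ne_zero_of_re_pos h x)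

/-- Near the given parameters the real parts of s and w exceed half their values, while the norms of
w and z grow by at most 1. The resulting bound exp(-πσx² + A|x|) is replaced by the sum over both
signs of A to get rid of |x|. -/
lemma exists_bound_mordellKernel {s₀ w₀ z₀ : ℂ} (hs : 0 < s₀.re) (hw : 0 < w₀.re) :
    ∃ b : ℝ → ℝ, Integrable b ∧ ∀ᶠ p : ℂ × ℂ × ℂ in 𝓝 (s₀, w₀, z₀),
      0 < p.2.1.re ∧ ∀ x, ‖mordellKernel p.1 p.2.1 p.2.2 x‖ ≤ b x := by
  set σ := s₀.re / 2 with hσ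
  set α := w₀.re / 2 with hα
  set β := ‖w₀‖ + 1 with hβ
  set ζ := ‖z₀‖ + 1 with hζ
  have hσ0 : 0 < σ := half_pos hs
  have hα0 : 0 < α := half_pos hw
  have hβ0 : 0 < β := by positivity
  set δ := min (1 / 2) (Real.pi * α / (4 * β)) with hδ
  have hδ0 : 0 < δ := lt_min (by norm_num) (by have := Real.pi_pos; positivity)
  set A := 2 * Real.pi * ζ * β with hA
  have hgauss : ∀ B : ℝ, Integrable fun x : ℝ => Real.exp (-(Real.pi * σ) * x ^ 2 + B * x) := by
    intro B
    have h := (integrable_cexp_quadratic (b := (Real.pi * σ : ℝ)) (by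
      rw [Complex.ofReal_re]; exact mul_pos Real.pi_pos hσ0) B 0).norm
    refine h.congr (Eventually.of_forall fun x => ?_)
    simp only
    rw [Complex.norm_exp]
    congr 1
    simp [pow_two]
  refine ⟨fun x => (2 * δ)⁻¹ * (Real.exp (-(Real.pi * σ) * x ^ 2 + A * x) +
    Real.exp (-(Real.pi * σ) * x ^ 2 + -A * x)), ((hgauss A).add (hgauss (-A))).const_mul _, ?_⟩
  have c1 : ∀ᶠ p : ℂ × ℂ × ℂ in 𝓝 (s₀, w₀, z₀), σ < p.1.re :=
    (continuous_re.comp continuous_fst).continuousAt.eventually_const_lt (by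
      simp only [Function.comp_apply, hσ]; linarith)
  have c2 : ∀ᶠ p : ℂ × ℂ × ℂ in 𝓝 (s₀, w₀, z₀), α < p.2.1.re :=
    (continuous_re.comp (continuous_fst.comp continuous_snd)).continuousAt.eventually_const_lt (by
      simp only [Function.comp_apply, hα]; linarith)
  have c3 : ∀ᶠ p : ℂ × ℂ × ℂ in 𝓝 (s₀, w₀, z₀), ‖p.2.1‖ < β :=
    (continuous_norm.comp (continuous_fst.comp continuous_snd)).continuousAt.eventually_lt_const (by
      simp only [Function.comp_apply, hβ]; linarith)
  have c4 : ∀ᶠ p : ℂ × ℂ × ℂ in 𝓝 (s₀, w₀, z₀), ‖p.2.2‖ < ζ :=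
    (continuous_norm.comp (continuous_snd.comp continuous_snd)).continuousAt.eventually_lt_const (by
      simp only [Function.comp_apply, hζ]; linarith)
  filter_upwards [c1, c2, c3, c4] with p h1 h2 h3 h4
  refine ⟨hα0.trans h2, fun x => ?_⟩
  obtain ⟨s, w, z⟩ := p
  simp only at h1 h2 h3 h4 ⊢
  rw [mordellKernel, norm_div, norm_mul, Complex.norm_ofNat, div_eq_inv_mul]
  have hden := le_norm_cosh hα0 hβ0 h2.le h3.le x
  have hnum : ‖cexp (-Real.pi * s * x ^ 2 - 2 * Real.pi * z * w * x)‖ ≤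
      Real.exp (-(Real.pi * σ) * x ^ 2 + A * |x|) := by
    rw [Complex.norm_exp, Real.exp_le_exp]
    have e1 : (-Real.pi * s * x ^ 2 - 2 * Real.pi * z * w * x : ℂ).re =
        -(Real.pi * s.re) * x ^ 2 + 2 * Real.pi * -((z * w).re * x) := by
      simp [pow_two]; ring
    rw [e1]
    have e2 : -((z * w).re * x) ≤ ζ * β * |x| := by
      refine (neg_le_abs _).trans ?_
      rw [abs_mul]
      gcongr
      refine (Complex.abs_re_le_norm _).trans ?_
      rw [norm_mul]
      gcongr
    have e3 := Real.pi_pos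
    have e4 : -(Real.pi * s.re) * x ^ 2 ≤ -(Real.pi * σ) * x ^ 2 := by gcongr
    have e5 : 2 * Real.pi * -((z * w).re * x) ≤ 2 * Real.pi * (ζ * β * |x|) := by gcongr
    rw [hA]
    linarith
  have hsum : Real.exp (-(Real.pi * σ) * x ^ 2 + A * |x|) ≤
      Real.exp (-(Real.pi * σ) * x ^ 2 + A * x) + Real.exp (-(Real.pi * σ) * x ^ 2 + -A * x) := by
    rcases abs_cases x with ⟨h, _⟩ | ⟨h, _⟩ <;> rw [h]
    · linarith [Real.exp_pos (-(Real.pi * σ) * x ^ 2 + -A * x)]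
    · rw [mul_neg, neg_mul A]
      linarith [Real.exp_pos (-(Real.pi * σ) * x ^ 2 + A * x)]
  have hsum2 := hnum.trans hsum
  gcongr

/-- The Mordell integral along a rotated line, without the factor from the differential. -/
def mordellRot (s w z : ℂ) : ℂ := ∫ x : ℝ, mordellKernel s w z x

lemma continuousAt_mordellRot {X : Type*} [TopologicalSpace X] [FirstCountableTopology X]
    {s w z : X → ℂ} {p : X} (hs : ContinuousAt s p) (hw : ContinuousAt w p) (hz : ContinuousAt z p)
    (hs0 : 0 < (s p).re) (hw0 : 0 < (w p).re) :
    ContinuousAt (fun y => mordellRot (s y) (w y) (z y)) p := by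
  obtain ⟨b, hb, h⟩ := exists_bound_mordellKernel (z₀ := z p) hs0 hw0
  have h2 := (hs.prodMk (hw.prodMk hz)).eventually h
  refine continuousAt_of_dominated (bound := b) ?_ ?_ hb (Eventually.of_forall fun x => ?_)
  · filter_upwards [h2] with y hy using (continuous_mordellKernel hy.1).aestronglyMeasurable
  · filter_upwards [h2] with y hy using Eventually.of_forall hy.2
  · unfold mordellKernel
    refine ContinuousAt.div ?_ ?_ (mul_ne_zero two_ne_zero (cosh_ne_zero_of_re_pos hw0 x))
    · exact ContinuousAt.cexp (by fun_prop)
    · exact continuousAt_const.mul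
        (Complex.continuous_cosh.continuousAt.comp (by fun_prop))

lemma differentiableAt_mordellRot {s w z : ℂ → ℂ} {p : ℂ} {U : Set ℂ} (hU : U ∈ 𝓝 p)
    (hs : DifferentiableOn ℂ s U) (hw : DifferentiableOn ℂ w U) (hz : DifferentiableOn ℂ z U)
    (hs0 : 0 < (s p).re) (hw0 : 0 < (w p).re) :
    DifferentiableAt ℂ (fun y => mordellRot (s y) (w y) (z y)) p := by
  obtain ⟨b, hb, h⟩ := exists_bound_mordellKernel (z₀ := z p) hs0 hw0
  have h2 := (((hs.differentiableAt hU).continuousAt).prodMk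
    (((hw.differentiableAt hU).continuousAt).prodMk
      ((hz.differentiableAt hU).continuousAt))).eventually h
  obtain ⟨r, hr, hrs⟩ := Metric.mem_nhds_iff.1 (inter_mem hU h2)
  refine differentiableAt_integral_of_dominated hr hb (fun x => ?_) (fun y hy => ?_) fun y hy => ?_
  · have hsub : Metric.ball p r ⊆ U := fun y hy => (hrs hy).1
    have hs' := hs.mono hsub
    have hw' := hw.mono hsub
    have hz' := hz.mono hsub
    unfold mordellKernel
    refine DifferentiableOn.div ?_ ?_ fun y hy =>
      mul_ne_zero two_ne_zero (cosh_ne_zero_of_re_pos (hrs hy).2.1 x)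
    · exact DifferentiableOn.cexp (by fun_prop)
    · exact DifferentiableOn.const_mul (DifferentiableOn.ccosh (by fun_prop)) _
  · exact (continuous_mordellKernel (hrs hy).2.1).aestronglyMeasurable
  · exact (hrs hy).2.2

lemma mordell_eq_mordellRot (z τ : ℂ) : mordell z τ = mordellRot (-I * τ) 1 z := by
  refine integral_congr_ae (Eventually.of_forall fun x => ?_)
  simp only [mordellKernel, mul_one]
  congr 2
  linear_combination 2 * Real.pi * z * x * I_mul_I

lemma differentiable_mordell {τ : ℂ} (hτ : 0 < τ.im) : Differentiable ℂ fun z => mordell z τ := by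
  intro z
  simp only [mordell_eq_mordellRot]
  exact differentiableAt_mordellRot univ_mem (differentiableOn_const _) (differentiableOn_const _)
    differentiableOn_id (by simpa using hτ) (by simp)

/-- The direction of the rotated line. -/
def rotDir (τ : ℂ) : ℂ := cexp (Real.pi / 4 * I - Complex.log τ / 4)

/-- The analytic continuation of the Mordell integral to the plane cut along `(-∞, 0]`. -/
def mordellExt (z τ : ℂ) : ℂ :=
  rotDir τ * mordellRot (cexp (Complex.log τ / 2)) (rotDir τ) z

/-- For the direction w = e^{πi/4} τ^{-1/4} the Gaussian coefficient -iτw² is τ^{1/2}. With this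
choice both arguments, arg τ/2 and π/4 - arg τ/4, stay in (-π/2, π/2) on the whole slit plane: the
Gaussian decays and the line avoids the poles of 1/cosh. -/
lemma exp_log_div_two_re_pos {τ : ℂ} (h : τ ∈ slitPlane) : 0 < (cexp (Complex.log τ / 2)).re := by
  rw [Complex.exp_re]
  refine mul_pos (Real.exp_pos _) (Real.cos_pos_of_mem_Ioo ?_)
  have h1 := Complex.neg_pi_lt_arg τ
  have h2 := Complex.arg_le_pi τ
  have h3 : τ.arg ≠ Real.pi := (Complex.mem_slitPlane_iff_arg.1 h).1
  have h4 : τ.arg < Real.pi := lt_of_le_of_ne h2 h3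
  simp only [Complex.div_ofNat_im, Complex.log_im]
  constructor <;> linarith

lemma rotDir_re_pos {τ : ℂ} (h : τ ∈ slitPlane) : 0 < (rotDir τ).re := by
  rw [rotDir, Complex.exp_re]
  refine mul_pos (Real.exp_pos _) (Real.cos_pos_of_mem_Ioo ?_)
  have h1 := Complex.neg_pi_lt_arg τ
  have h2 := Complex.arg_le_pi τ
  have h3 : τ.arg ≠ Real.pi := (Complex.mem_slitPlane_iff_arg.1 h).1
  have h4 : τ.arg < Real.pi := lt_of_le_of_ne h2 h3
  have h5 : ((Real.pi : ℂ) / 4 * I - Complex.log τ / 4).im = Real.pi / 4 - τ.arg / 4 := by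
    simp [Complex.log_im]
  rw [h5]
  constructor <;> linarith

lemma differentiableOn_exp_log_div_two :
    DifferentiableOn ℂ (fun τ => cexp (Complex.log τ / 2)) slitPlane := fun _ hτ =>
  (((differentiableAt_log hτ).div_const 2).cexp).differentiableWithinAt

lemma differentiableOn_rotDir : DifferentiableOn ℂ rotDir slitPlane := fun _ hτ =>
  (((differentiableAt_const _).sub
    ((differentiableAt_log hτ).div_const 4)).cexp).differentiableWithinAt

theorem analyticAt_mordellExt {p : ℂ × ℂ} (hp : p.2 ∈ slitPlane) :
    AnalyticAt ℂ (fun x : ℂ × ℂ => mordellExt x.1 x.2) p := by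
  have hrot : ∀ τ ∈ slitPlane, DifferentiableAt ℂ rotDir τ := fun τ hτ =>
    differentiableOn_rotDir.differentiableAt (isOpen_slitPlane.mem_nhds hτ)
  have hsq : ∀ τ ∈ slitPlane, DifferentiableAt ℂ (fun τ => cexp (Complex.log τ / 2)) τ :=
    fun τ hτ => differentiableOn_exp_log_div_two.differentiableAt (isOpen_slitPlane.mem_nhds hτ)
  refine analyticAt_of_separately_differentiable (U := Prod.snd ⁻¹' slitPlane)
    (isOpen_slitPlane.preimage continuous_snd) (fun x hx => ?_) (fun x hx => ?_) (fun x hx => ?_) hp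
  · refine ContinuousAt.continuousWithinAt ?_
    have h1 : ContinuousAt (fun x : ℂ × ℂ => rotDir x.2) x :=
      (hrot x.2 hx).continuousAt.comp continuousAt_snd
    have h2 : ContinuousAt (fun x : ℂ × ℂ => cexp (Complex.log x.2 / 2)) x :=
      ContinuousAt.comp (f := Prod.snd) (hsq x.2 hx).continuousAt continuousAt_snd
    exact h1.mul (continuousAt_mordellRot h2 h1 continuousAt_fst (exp_log_div_two_re_pos hx)
      (rotDir_re_pos hx))
  · exact (differentiableAt_mordellRot (z := fun y => y) univ_mem (differentiableOn_const _)
      (differentiableOn_const _) differentiableOn_id (exp_log_div_two_re_pos hx)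
      (rotDir_re_pos hx)).const_mul (rotDir x.2)
  · exact (hrot x.2 hx).mul (differentiableAt_mordellRot (isOpen_slitPlane.mem_nhds hx)
      differentiableOn_exp_log_div_two differentiableOn_rotDir (differentiableOn_const _)
      (exp_log_div_two_re_pos hx) (rotDir_re_pos hx))

/-- For real a this is only the substitution x ↦ e^a x; the rotation is reached by analytic
continuation in a. -/
lemma mordellRot_ofReal {τ z : ℂ} (a : ℝ) :
    cexp a * mordellRot (-I * τ * cexp (2 * a)) (cexp a) z = mordell z τ := by
  have h1 : ∀ x : ℝ, mordellKernel (-I * τ * cexp (2 * a)) (cexp a) z x =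
      mordellKernel (-I * τ) 1 z (Real.exp a * x) := by
    intro x
    simp only [mordellKernel, mul_one]
    rw [show (2 * a : ℂ) = a + a by ring, Complex.exp_add]
    push_cast
    congr 2
    · ring
    · congr 1; ring
  rw [mordell_eq_mordellRot, mordellRot, mordellRot]
  simp only [h1]
  rw [Measure.integral_comp_mul_left (fun x : ℝ => mordellKernel (-I * τ) 1 z x) (Real.exp a),
    abs_of_pos (by positivity), Complex.real_smul, ← Complex.ofReal_exp, ← mul_assoc,
    ← Complex.ofReal_mul, mul_inv_cancel₀ (Real.exp_pos a).ne', Complex.ofReal_one, one_mul]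

/-- The continuation agrees with the Mordell integral on the upper half plane. -/
theorem mordellExt_eq {τ : ℂ} (hτ : 0 < τ.im) (z : ℂ) : mordellExt z τ = mordell z τ := by
  have hτ0 : τ ≠ 0 := by rintro rfl; simp at hτ
  have harg0 : 0 < τ.arg := by
    refine lt_of_le_of_ne (Complex.arg_nonneg_iff.2 hτ.le) fun h => ?_
    exact hτ.ne' (Complex.arg_eq_zero_iff.1 h.symm).2
  have hargpi : τ.arg < Real.pi := by
    refine lt_of_le_of_ne (Complex.arg_le_pi τ) fun h => ?_
    exact hτ.ne' (Complex.arg_eq_pi_iff.1 h).2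
  -- The strip of ν = log w on which both e^ν and -iτe^{2ν} have positive real part; the bound Im ν
  -- > -π/2 is implied by arg τ < π.
  set S : Set ℂ := {ν | -τ.arg / 2 < ν.im} ∩ {ν | ν.im < min (Real.pi / 2) ((Real.pi - τ.arg) / 2)}
    with hS
  have hSo : IsOpen S := (isOpen_lt continuous_const continuous_im).inter
    (isOpen_lt continuous_im continuous_const)
  have hSc : IsPreconnected S :=
    ((convex_halfSpace_im_gt _).inter (convex_halfSpace_im_lt _)).isPreconnected
  have hreal : ∀ a : ℝ, (a : ℂ) ∈ S := by
    intro a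
    simp only [hS, Set.mem_inter_iff, Set.mem_ofPred_eq, Complex.ofReal_im, lt_min_iff]
    have := Real.pi_pos
    refine ⟨?_, ?_, ?_⟩ <;> linarith
  set J : ℂ → ℂ := fun ν => cexp ν * mordellRot (-I * τ * cexp (2 * ν)) (cexp ν) z with hJ
  have hJd : DifferentiableOn ℂ J S := by
    intro ν hν
    simp only [hS, Set.mem_inter_iff, Set.mem_ofPred_eq, lt_min_iff] at hν
    obtain ⟨h1, h2, h3⟩ := hν
    refine (DifferentiableAt.mul (by fun_prop) (differentiableAt_mordellRot univ_mem
      (by fun_prop) (by fun_prop) (differentiableOn_const _) ?_ ?_)).differentiableWithinAt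
    · have h4 : -I * τ * cexp (2 * ν) = cexp (-(Real.pi / 2) * I + Complex.log τ + 2 * ν) := by
        rw [Complex.exp_add, Complex.exp_add, Complex.exp_log hτ0, neg_mul (_ / _), Complex.exp_neg,
          Complex.exp_pi_div_two_mul_I, Complex.inv_I]
      rw [h4, Complex.exp_re]
      refine mul_pos (Real.exp_pos _) (Real.cos_pos_of_mem_Ioo ?_)
      have h5 : (-((Real.pi : ℂ) / 2) * I + Complex.log τ + 2 * ν).im =
          -(Real.pi / 2) + τ.arg + 2 * ν.im := by
        simp [Complex.log_im]
      rw [h5]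
      constructor <;> linarith
    · rw [Complex.exp_re]
      refine mul_pos (Real.exp_pos _) (Real.cos_pos_of_mem_Ioo ⟨?_, h2⟩)
      linarith
  have hJan : AnalyticOnNhd ℂ J S := hJd.analyticOnNhd hSo
  -- J is constant on the real axis, hence on the strip by the identity theorem, and the exponent of
  -- `rotDir` lies in the strip.
  have hfreq : ∃ᶠ ν in 𝓝[≠] (0 : ℂ), J ν = mordell z τ := by
    have ht : Tendsto (fun a : ℝ => (a : ℂ)) (𝓝[≠] 0) (𝓝[≠] 0) := by
      refine tendsto_nhdsWithin_iff.2 ⟨?_, ?_⟩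
      · have h6 := (Complex.continuous_ofReal.tendsto 0).mono_left
          (nhdsWithin_le_nhds (s := {(0 : ℝ)}ᶜ))
        simpa using h6
      · filter_upwards [self_mem_nhdsWithin] with a ha
        simpa using ha
    exact ht.frequently (Frequently.of_forall fun a => mordellRot_ofReal a)
  have heq := hJan.eqOn_of_preconnected_of_frequently_eq (g := fun _ => mordell z τ)
    analyticOnNhd_const hSc (by simpa using hreal 0) hfreq
  have hmem : (Real.pi / 4 * I - Complex.log τ / 4 : ℂ) ∈ S := by
    have h5 : ((Real.pi : ℂ) / 4 * I - Complex.log τ / 4).im = Real.pi / 4 - τ.arg / 4 := by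
      simp [Complex.log_im]
    simp only [hS, Set.mem_inter_iff, Set.mem_ofPred_eq, h5, lt_min_iff]
    refine ⟨?_, ?_, ?_⟩ <;> linarith
  refine Eq.trans ?_ (heq hmem)
  simp only [hJ]
  rw [mordellExt, ← rotDir]
  congr 2
  have h6 : cexp (2 * (Real.pi / 4 * I - Complex.log τ / 4)) = I * cexp (-(Complex.log τ / 2)) := by
    have h9 : (2 * (Real.pi / 4 * I - Complex.log τ / 4) : ℂ) =
        Real.pi / 2 * I + -(Complex.log τ / 2) := by ring
    rw [h9, Complex.exp_add, Complex.exp_pi_div_two_mul_I]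
  rw [h6, Complex.exp_neg]
  have h7 : cexp (Complex.log τ / 2) * cexp (Complex.log τ / 2) = τ := by
    rw [← Complex.exp_add, add_halves, Complex.exp_log hτ0]
  have h8 := Complex.exp_ne_zero (Complex.log τ / 2)
  field_simp
  linear_combination h7 + τ * (by simp : (I * I + 1 : ℂ) = 0)

/-! ### The transformation of theta functions and Appell–Lerch sums under `τ ↦ -1/τ` -/

/-- The automorphy factor of the theta function under `τ ↦ -1/τ`. -/
def thetaFactor (z τ : ℂ) : ℂ :=
  e (1 / 8) / τ ^ (1 / 2 : ℂ) * e (-(z + 1 / 2 - τ / 2) ^ 2 / (2 * τ))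

/-- The Mordell integral with the exponential factors of its transformation law. -/
def mordellPeriod (z τ : ℂ) : ℂ :=
  e (-1 / 8) / τ ^ (1 / 2 : ℂ) * e (-z / (2 * τ)) * e (-1 / (8 * τ)) * e (-z ^ 2 / (2 * τ)) *
    mordell z τ

lemma ne_zero_of_im_pos {τ : ℂ} (hτ : 0 < τ.im) : τ ≠ 0 := by rintro rfl; simp at hτ

lemma neg_inv_im_pos {τ : ℂ} (hτ : 0 < τ.im) : 0 < (-1 / τ).im := by
  have h : 0 < Complex.normSq τ := Complex.normSq_pos.2 (ne_zero_of_im_pos hτ)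
  have h1 : (-1 / τ).im = τ.im / Complex.normSq τ := by simp [neg_div]
  rw [h1]
  exact div_pos hτ h

lemma sqrt_ne_zero {τ : ℂ} (hτ : τ ≠ 0) : τ ^ (1 / 2 : ℂ) ≠ 0 := by
  simp [Complex.cpow_eq_zero_iff, hτ]

lemma sqrt_mul_self {τ : ℂ} (hτ : τ ≠ 0) : τ ^ (1 / 2 : ℂ) * τ ^ (1 / 2 : ℂ) = τ := by
  rw [← Complex.cpow_add _ _ hτ, add_halves, Complex.cpow_one]

/-- Jacobi's inversion formula; the two arguments of `jacobiTheta₂` differ by the period 1. -/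
lemma theta_S {z τ : ℂ} (hτ : 0 < τ.im) : theta ((e τ)⁻¹ * e z) (e τ) =
    thetaFactor z τ * theta ((e (-1 / τ))⁻¹ * e (z / τ)) (e (-1 / τ)) := by
  have h0 := ne_zero_of_im_pos hτ
  have h1 : (z - τ + 1 / 2 + τ / 2) / τ + 1 = z / τ - -1 / τ + 1 / 2 + -1 / τ / 2 := by
    field_simp; ring
  rw [mul_comm, ← div_eq_mul_inv, ← e_sub, mul_comm (e (-1 / τ))⁻¹, ← div_eq_mul_inv, ← e_sub,
    theta_e, theta_e, jacobiTheta₂_functional_equation, ← h1, jacobiTheta₂_add_left,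
    neg_I_mul_cpow hτ, thetaFactor]
  congr 1
  rw [one_div, mul_inv, ← e_neg, neg_div, neg_neg, ← div_eq_mul_inv]
  congr 1
  rw [e]
  congr 1
  field_simp
  ring

lemma mordellPeriod_eq {τ : ℂ} (hτ : τ ≠ 0) (z : ℂ) : mordellPeriod z τ =
    e (-1 / 8) / τ ^ (1 / 2 : ℂ) * e (-(z + 1 / 2) ^ 2 / (2 * τ)) * mordell z τ := by
  have h : -(z + 1 / 2) ^ 2 / (2 * τ) = -z / (2 * τ) + -1 / (8 * τ) + -z ^ 2 / (2 * τ) := by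
    field_simp; ring
  rw [mordellPeriod, h, e_add, e_add]
  ring

/-- The prefactor cancels the Gaussian and the eighth root of unity in `mordell_add_one`; what
remains is (√τ)⁻² = τ⁻¹. -/
lemma mordellPeriod_add_one {z τ : ℂ} (hτ : 0 < τ.im) :
    e ((z + 1) / τ) * mordellPeriod (z + 1) τ = τ⁻¹ - mordellPeriod z τ := by
  have h0 := ne_zero_of_im_pos hτ
  have h1 : e ((z + 1) / τ) * e (-(z + 1 + 1 / 2) ^ 2 / (2 * τ)) =
      e (-(z + 1 / 2) ^ 2 / (2 * τ)) := by
    rw [← e_add]; congr 1; field_simp; ring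
  have h2 : e (-(z + 1 / 2) ^ 2 / (2 * τ)) * e ((z + 1 / 2) ^ 2 / (2 * τ)) = 1 := by
    rw [← e_add, ← e_zero]; congr 1; ring
  have h3 : e (-1 / 8) * e (1 / 8) = 1 := by
    rw [← e_add, ← e_zero]; congr 1; ring
  have h4 := mordell_add_one (z := z) hτ
  have h5 := sqrt_mul_self h0
  have h6 := sqrt_ne_zero h0
  rw [mordellPeriod_eq h0, mordellPeriod_eq h0]
  set s := τ ^ (1 / 2 : ℂ)
  set g := e (-(z + 1 / 2) ^ 2 / (2 * τ))
  have h7 : τ⁻¹ = e (-1 / 8) / s * g * (e (1 / 8) / s * e ((z + 1 / 2) ^ 2 / (2 * τ))) := by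
    have h8 : τ⁻¹ = s⁻¹ * s⁻¹ := by rw [← mul_inv, h5]
    rw [h8]
    linear_combination (-(s⁻¹ * s⁻¹)) * h3 - s⁻¹ * s⁻¹ * e (-1 / 8) * e (1 / 8) * h2
  rw [h7, ← h4]
  linear_combination (e (-1 / 8) / s * mordell (z + 1) τ) * h1

lemma neg_e (x : ℂ) : -e x = e (1 / 2 + x) := by rw [e_add, e_half, neg_one_mul]

/-- The right side of `mordell_add_tau` becomes exactly the defect that `thetaFactor` times the
Appell–Lerch sum shows under z ↦ z + τ. -/
lemma mordellPeriod_add_tau {z τ : ℂ} (hτ : 0 < τ.im) :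
    mordellPeriod (z + τ) τ = mordellPeriod z τ + thetaFactor z τ * (e z)⁻¹ := by
  have h0 := ne_zero_of_im_pos hτ
  have h1 : e (-(z + τ + 1 / 2) ^ 2 / (2 * τ)) =
      -(e (-(z + 1 / 2) ^ 2 / (2 * τ)) * e (-τ / 2 - z)) := by
    rw [← e_add, neg_e, e_eq_e_iff]
    refine ⟨-1, ?_⟩
    push_cast
    field_simp
    ring
  have h2 : e (1 / 8) * e (-(z + 1 / 2 - τ / 2) ^ 2 / (2 * τ)) * (e z)⁻¹ =
      -(e (-1 / 8) * e (-(z + 1 / 2) ^ 2 / (2 * τ)) * e (-τ / 8 - z / 2)) := by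
    rw [← e_neg z, ← e_add, ← e_add, ← e_add, ← e_add, neg_e]
    congr 1
    field_simp
    ring
  have h3 := mordell_add_tau (z := z) hτ
  rw [mordellPeriod_eq h0, mordellPeriod_eq h0, thetaFactor, h1]
  set s := τ ^ (1 / 2 : ℂ)
  linear_combination (-(e (-1 / 8) / s * e (-(z + 1 / 2) ^ 2 / (2 * τ)))) * h3 - s⁻¹ * h2

lemma div_mem_lattice_neg_inv {z τ : ℂ} (hτ : τ ≠ 0) :
    z / τ ∈ lattice (-1 / τ) ↔ z ∈ lattice τ := by
  constructor
  · rintro ⟨m, n, h⟩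
    refine ⟨-n, m, ?_⟩
    field_simp at h
    push_cast
    linear_combination h
  · rintro ⟨m, n, h⟩
    refine ⟨n, -m, ?_⟩
    field_simp
    push_cast
    linear_combination h

/-- The transformation of the Appell–Lerch sum under `τ ↦ -1/τ`. -/
theorem f0_S {z u τ : ℂ} (hτ : 0 < τ.im) (hz : z ∉ lattice τ) (hu : u ∉ lattice τ)
    (hzu : z + u ∉ lattice τ) :
    f0 (e (z / τ)) (e (u / τ)) (e (-1 / τ)) * τ⁻¹ =
      thetaFactor z τ * f0 (e z) (e u) (e τ) + mordellPeriod z τ := by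
  have h0 := ne_zero_of_im_pos hτ
  have hτ' := neg_inv_im_pos hτ
  have hlat : ∀ w : ℂ, w / τ ∈ lattice (-1 / τ) ↔ w ∈ lattice τ := fun w =>
    div_mem_lattice_neg_inv h0
  have hlat2 : ∀ w : ℂ, w + u ∉ lattice τ → w / τ + u / τ ∉ lattice (-1 / τ) := by
    intro w hw
    rw [← add_div, hlat]; exact hw
  have hu' : u / τ ∉ lattice (-1 / τ) := (hlat u).not.2 hu
  have hq := e_ne_zero τ
  have hq' := e_ne_zero (-1 / τ)
  set F₁ : ℂ → ℂ := fun z => f0 (e z) (e u) (e τ) with hF₁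
  set F₂ : ℂ → ℂ := fun z => f0 (e (z / τ)) (e (u / τ)) (e (-1 / τ)) with hF₂
  set Y : ℂ → ℂ := fun z => theta ((e τ)⁻¹ * e z) (e τ) with hY
  set T : ℂ → ℂ := fun z => theta ((e (-1 / τ))⁻¹ * e (z / τ)) (e (-1 / τ)) with hT
  set K : ℂ → ℂ := fun z => mordellPeriod z τ with hK
  -- This is T times the claimed identity, with Y = `thetaFactor`·T. The shift z ↦ z + τ is a period
  -- of F₂ and z ↦ z + 1 one of F₁; the two rules for K repair the other two cases. At z = -u the
  -- values T = θ(e(u/τ)) and Y = θ(e(u)) cancel the normalisations of the sums, so the residues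
  -- agree.
  set G : ℂ → ℂ := fun z => T z * F₂ z * τ⁻¹ - Y z * F₁ z - T z * K z with hG
  have hTY : ∀ z, Y z = thetaFactor z τ * T z := fun z => theta_S hτ
  have hYd : Differentiable ℂ Y := theta_div_q_e_differentiable hτ
  have hTd : Differentiable ℂ T := by
    have := (theta_div_q_e_differentiable hτ').comp (differentiable_id.div_const τ)
    exact this
  have hF₁d : ∀ w, w + u ∉ lattice τ → DifferentiableAt ℂ F₁ w := fun w hw =>
    f0_e_differentiableAt hτ hw
  have hF₂d : ∀ w, w + u ∉ lattice τ → DifferentiableAt ℂ F₂ w := by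
    intro w hw
    have h1 := f0_e_differentiableAt (u := u / τ) hτ' (hlat2 w hw)
    exact DifferentiableAt.comp (f := fun z => z / τ) w h1 (by fun_prop)
  have hKd : Differentiable ℂ K := by
    have hm := differentiable_mordell hτ
    have he := differentiable_e
    simp only [hK, mordellPeriod]
    refine Differentiable.mul ?_ hm
    refine Differentiable.mul (Differentiable.mul (Differentiable.mul (by fun_prop) ?_)
      (by fun_prop)) ?_
    · exact he.comp (by fun_prop)
    · exact he.comp (by fun_prop)
  have key := elliptic_eq_zero hτ (B := {w | w + u ∈ lattice τ}) (F := G)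
    ?_ ?_ ?_ ?_ ?_ ?_ ?_ (z₀ := 0) ?_ ?_ z hzu
  · have hT0 : T z ≠ 0 := by
      simp only [hT]
      rw [theta_div_q (e_ne_zero _) hq']
      exact mul_ne_zero (neg_ne_zero.2 (e_ne_zero _)) (theta_e_ne_zero hτ' ((hlat z).not.2 hz))
    apply mul_left_cancel₀ hT0
    simp only [hG] at key
    rw [hTY] at key
    linear_combination key
  · intro w
    simp only [Set.mem_ofPred_eq, add_right_comm w 1, add_one_mem_lattice]
  · intro w
    simp only [Set.mem_ofPred_eq, add_right_comm w τ, add_tau_mem_lattice]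
  · intro p
    exact eventually_add_notMem_lattice hτ u p
  · intro w hw
    have hw1 : w + 1 + u ∉ lattice τ := by
      rw [add_right_comm, add_one_mem_lattice]; exact hw
    have hsplit : w / τ = (w + 1) / τ + -1 / τ := by ring
    have e1 : F₂ w = 1 - e ((w + 1) / τ) * F₂ (w + 1) := by
      simp only [hF₂]
      rw [hsplit]
      exact f0_e_add_tau hτ' hu' (hlat2 _ hw1)
    have e2 : T (w + 1) = -e ((w + 1) / τ) * T w := by
      simp only [hT]
      rw [hsplit, e_add, mul_comm (e ((w + 1) / τ)), inv_mul_cancel_left₀ hq',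
        theta_div_q (e_ne_zero _) hq']
    have e3 : e ((w + 1) / τ) * K (w + 1) = τ⁻¹ - K w := mordellPeriod_add_one hτ
    have e4 : F₁ (w + 1) = F₁ w := by simp only [hF₁, e_add_one]
    have e5 : Y (w + 1) = Y w := by simp only [hY, e_add_one]
    simp only [hG]
    rw [e2, e4, e5]
    linear_combination T w * e3 - τ⁻¹ * T w * e1
  · intro w hw
    have hsplit : (w + τ) / τ = w / τ + 1 := by field_simp
    have e1 : F₂ (w + τ) = F₂ w := by simp only [hF₂, hsplit, e_add_one]
    have e2 : T (w + τ) = T w := by simp only [hT, hsplit, e_add_one]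
    have e3 : K (w + τ) = K w + thetaFactor w τ * (e w)⁻¹ := mordellPeriod_add_tau hτ
    have e4 : F₁ (w + τ) = 1 - e w * F₁ w := f0_e_add_tau hτ hu hw
    have e5 : Y (w + τ) = -(e w)⁻¹ * Y w := by
      simp only [hY]
      rw [e_add, mul_comm (e w), inv_mul_cancel_left₀ hq, theta_div_q (e_ne_zero w) hq]
      field_simp [e_ne_zero]
    have e6 : e w * (e w)⁻¹ = 1 := mul_inv_cancel₀ (e_ne_zero w)
    simp only [hG]
    rw [e1, e2, e3, e4, e5]
    linear_combination (e w)⁻¹ * hTY w - Y w * F₁ w * e6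
  · intro w hw
    exact ((((hTd w).mul (hF₂d w hw)).mul_const _).sub ((hYd w).mul (hF₁d w hw))).sub
      ((hTd w).mul (hKd w))
  · rintro p ⟨m, n, h⟩
    refine ⟨-m, -n, ?_⟩
    have h1 : p + (((-m : ℤ) : ℂ) + ((-n : ℤ) : ℂ) * τ) = -u := by
      push_cast; linear_combination h
    rw [h1]
    have hle : 𝓝[≠] (-u) ≤ 𝓝 (-u) := nhdsWithin_le_nhds
    have r1 := f0_residue (u := u) hτ
    have r2 : Tendsto (fun z => (z / τ + u / τ) * F₂ z) (𝓝[≠] (-u))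
        (𝓝 (-(2 * Real.pi * I)⁻¹ * (theta (e (u / τ)) (e (-1 / τ)))⁻¹)) := by
      refine (f0_residue (u := u / τ) hτ').comp (tendsto_nhdsWithin_iff.2 ⟨?_, ?_⟩)
      · have hcd : Continuous fun z : ℂ => z / τ := continuous_id.div_const τ
        have := hcd.tendsto (-u)
        rw [neg_div] at this
        exact this.mono_left hle
      · filter_upwards [self_mem_nhdsWithin] with w hw hw2
        refine hw ?_
        have hw3 : w / τ = -(u / τ) := hw2
        field_simp at hw3
        exact hw3
    have tT := (hTd.continuous.tendsto (-u)).mono_left hle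
    have tY := (hYd.continuous.tendsto (-u)).mono_left hle
    have tK : Tendsto (fun z => (z + u) * (T z * K z)) (𝓝[≠] (-u)) (𝓝 0) := by
      have : Continuous fun z => (z + u) * (T z * K z) := by
        have c1 := hTd.continuous
        have c2 := hKd.continuous
        fun_prop
      have h2 := (this.tendsto (-u)).mono_left hle
      rwa [neg_add_cancel, zero_mul] at h2
    have vT : T (-u) = theta (e (u / τ)) (e (-1 / τ)) := by
      simp only [hT]
      rw [neg_div τ u, e_neg, theta_q_inv (e_ne_zero _) hq']
    have vY : Y (-u) = theta (e u) (e τ) := by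
      simp only [hY]
      rw [e_neg, theta_q_inv (e_ne_zero _) hq]
    have hlim := ((tT.mul r2).sub (tY.mul r1)).sub tK
    have n1 : theta (e (u / τ)) (e (-1 / τ)) ≠ 0 := theta_e_ne_zero hτ' hu'
    have n2 : theta (e u) (e τ) ≠ 0 := theta_e_ne_zero hτ hu
    rw [vT, vY, mul_left_comm, mul_inv_cancel₀ n1, mul_left_comm, mul_inv_cancel₀ n2, sub_self,
      sub_zero] at hlim
    refine hlim.congr fun w => ?_
    simp only [hG]
    field_simp
    ring
  · simpa using hu
  -- All three summands of G vanish at z = 0, through the zeros of T and Y.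
  · have v1 : Y 0 = 0 := by
      simp only [hY]
      rw [theta_div_q (e_ne_zero 0) hq, e_zero, theta_one _ hq (norm_e_lt_one hτ), mul_zero]
    have v2 : T 0 = 0 := by
      simp only [hT]
      rw [zero_div, theta_div_q (e_ne_zero 0) hq', e_zero, theta_one _ hq' (norm_e_lt_one hτ'),
        mul_zero]
    simp only [hG, v1, v2]
    ring

/-! ### The fundamental matrices -/

lemma UJ_eq {z u τ : ℂ} (h : Regular z u τ) : UJ (z, u) τ =
    !![f0 (e z) (e u) (e τ), fNeg1 (e z) (e τ);
      1 - e z * f0 (e z) (e u) (e τ), -e z * fNeg1 (e z) (e τ)] := by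
  have h1 := f0_mul_q (e_ne_zero z) (e_ne_zero u) (e_ne_zero τ) (norm_e_lt_one h.1)
    (theta_e_ne_zero h.1 h.2.2.1) (lam_t_ne_one h.2.2.2)
  have h2 := fNeg1_mul_q (e_ne_zero z) (e_ne_zero τ)
  ext i j
  fin_cases i <;> fin_cases j <;> simp [UJ, U, qWronskian, solU, h1, h2]

/-- The solutions at infinity are given by the same formulas, so every statement about U applies to
V. -/
lemma VJ_eq_UJ : VJ = UJ := rfl

lemma fNeg1_ne_zero {z τ : ℂ} (hτ : 0 < τ.im) (hz : z ∉ lattice τ) : fNeg1 (e z) (e τ) ≠ 0 := by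
  rw [fNeg1, theta_div_q (e_ne_zero _) (e_ne_zero _)]
  exact inv_ne_zero (mul_ne_zero (neg_ne_zero.2 (e_ne_zero _)) (theta_e_ne_zero hτ hz))

/-- The products containing the Appell–Lerch sum cancel, leaving -1/θ(q⁻¹t). -/
lemma det_UJ_ne_zero {z u τ : ℂ} (h : Regular z u τ) : (UJ (z, u) τ).det ≠ 0 := by
  have h1 : (UJ (z, u) τ).det = -fNeg1 (e z) (e τ) := by
    rw [UJ_eq h, Matrix.det_fin_two_of]; ring
  rw [h1]
  exact neg_ne_zero.2 (fNeg1_ne_zero h.1 h.2.1)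

/-- With c = 1 or c = 0, subtract f(qt) = c - t f(t) from f(q²t) = c - qt f(qt). -/
lemma solvesAt_solU {z u τ : ℂ} (h : Regular z u τ) (j : Fin 2) :
    SolvesAt (e τ) (e z) (solU (e u) (e τ) j) := by
  have hq := e_ne_zero τ
  have ht := e_ne_zero z
  fin_cases j
  · have h0 : ∀ l : ℤ, e u * (e τ * e z) * e τ ^ l ≠ 1 := fun l => by
      have := lam_t_ne_one h.2.2.2 (l + 1)
      rw [zpow_add_one₀ hq] at this
      intro h2
      exact this (by linear_combination h2)
    have h1 := f0_mul_q ht (e_ne_zero u) hq (norm_e_lt_one h.1)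
      (theta_e_ne_zero h.1 h.2.2.1) (lam_t_ne_one h.2.2.2)
    have h2 := f0_mul_q (mul_ne_zero hq ht) (e_ne_zero u) hq (norm_e_lt_one h.1)
      (theta_e_ne_zero h.1 h.2.2.1) h0
    rw [← mul_assoc, ← sq] at h2
    simp only [SolvesAt, solU, Fin.zero_eta, Matrix.cons_val_zero]
    linear_combination h2 - h1
  · have h1 := fNeg1_mul_q ht hq
    have h2 := fNeg1_mul_q (mul_ne_zero hq ht) hq
    rw [← mul_assoc, ← sq] at h2
    simp only [SolvesAt, solU, Fin.mk_one, Matrix.cons_val_one]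
    simp only [Matrix.cons_val_fin_one]
    linear_combination h2 - h1

/-- The second solution cancels the factor θ(q⁻¹t) of the matrix entry, so the first row is the
connection formula and the second row is -t times it. -/
lemma UJ_eq_VJ_mul {z u v τ : ℂ} (hu : Regular z u τ) (hv : Regular z v τ) :
    UJ (z, u) τ = VJ (z, v) τ * !![1, 0; M21 (e z) (e u) (e v) (e τ), 1] := by
  have h1 := f0_sub_f0 hu.1 hu.2.2.1 hv.2.2.1 hu.2.1 hu.2.2.2 hv.2.2.2
  have h2 : fNeg1 (e z) (e τ) * M21 (e z) (e u) (e v) (e τ) =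
      connQuot (e z) (e u) (e v) (e τ) := by
    have h3 := fNeg1_ne_zero hu.1 hu.2.1
    rw [M21_eq, fNeg1]
    rw [fNeg1] at h3
    have h4 := inv_ne_zero h3
    rw [inv_inv] at h4
    rw [mul_comm, mul_assoc, mul_inv_cancel₀ h4, mul_one]
  rw [VJ_eq_UJ, UJ_eq hu, UJ_eq hv, Matrix.mul_fin_two]
  congr 1
  ext i j
  fin_cases i <;> fin_cases j <;> simp
  · linear_combination h1 - h2
  · linear_combination (-e z) * h1 + e z * h2

lemma M_eq {z u v τ : ℂ} (hu : Regular z u τ) (hv : Regular z v τ) :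
    M (e z) (e u) (e v) (e τ) = !![1, 0; M21 (e z) (e u) (e v) (e τ), 1] := by
  have h := UJ_eq_VJ_mul hu hv
  have hd : IsUnit (VJ (z, v) τ).det := isUnit_iff_ne_zero.2 (det_UJ_ne_zero hv)
  change (VJ (z, v) τ)⁻¹ * UJ (z, u) τ = _
  rw [h, Matrix.nonsing_inv_mul_cancel_left _ _ hd]

/-! ### The action of the modular group -/

lemma det_entries (γ : SL(2, ℤ)) : γ 0 0 * γ 1 1 - γ 0 1 * γ 1 0 = 1 := by
  have := γ.det_coe
  rwa [Matrix.det_fin_two] at this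

lemma det_entries_cast {R : Type*} [CommRing R] (γ : SL(2, ℤ)) :
    (γ 0 0 : R) * γ 1 1 - γ 0 1 * γ 1 0 = 1 := by
  exact_mod_cast congrArg (Int.cast : ℤ → R) (det_entries γ)

lemma autFactor_ne_zero (γ : SL(2, ℤ)) {τ : ℂ} (hτ : τ.im ≠ 0) : autFactor γ τ ≠ 0 := by
  intro h
  have h1 := congrArg Complex.im h
  have h2 := congrArg Complex.re h
  simp [autFactor, hτ] at h1 h2
  have h3 := det_entries γ
  simp only [h1, Int.cast_zero, zero_mul, zero_add, Int.cast_eq_zero] at h2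
  simp [h1, h2] at h3

lemma moebius_im (γ : SL(2, ℤ)) {τ : ℂ} : (moebius γ τ).im = τ.im / normSq (autFactor γ τ) := by
  have h := det_entries_cast (R := ℝ) γ
  rw [moebius, Complex.div_im, ← sub_div]
  congr 1
  simp [autFactor]
  linear_combination τ.im * h

lemma moebius_im_pos (γ : SL(2, ℤ)) {τ : ℂ} (hτ : 0 < τ.im) : 0 < (moebius γ τ).im := by
  rw [moebius_im]
  exact div_pos hτ (normSq_pos.2 (autFactor_ne_zero γ hτ.ne'))

lemma mem_lattice_of_moebius (γ : SL(2, ℤ)) {τ z : ℂ} (hj : autFactor γ τ ≠ 0)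
    (h : (autFactor γ τ)⁻¹ * z ∈ lattice (moebius γ τ)) : z ∈ lattice τ := by
  obtain ⟨m, n, h⟩ := h
  refine ⟨m * γ 1 1 + n * γ 0 1, m * γ 1 0 + n * γ 0 0, ?_⟩
  rw [moebius] at h
  have h1 : z = m * autFactor γ τ + n * (γ 0 0 * τ + γ 0 1) := by
    field_simp at h
    linear_combination h
  rw [h1, autFactor]
  push_cast
  ring

lemma Regular.moebius {z u τ : ℂ} (h : Regular z u τ) (γ : SL(2, ℤ)) :
    Regular ((autFactor γ τ)⁻¹ * z) ((autFactor γ τ)⁻¹ * u) (moebius γ τ) := by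
  have hj := autFactor_ne_zero γ h.1.ne'
  refine ⟨moebius_im_pos γ h.1, fun h1 => h.2.1 (mem_lattice_of_moebius γ hj h1),
    fun h1 => h.2.2.1 (mem_lattice_of_moebius γ hj h1), fun h1 => h.2.2.2 ?_⟩
  rw [← mul_add] at h1
  exact mem_lattice_of_moebius γ hj h1

lemma autFactor_mul (γ₁ γ₂ : SL(2, ℤ)) {τ : ℂ} (hj : autFactor γ₂ τ ≠ 0) :
    autFactor (γ₁ * γ₂) τ = autFactor γ₁ (moebius γ₂ τ) * autFactor γ₂ τ := by
  have h : moebius γ₂ τ * autFactor γ₂ τ = γ₂ 0 0 * τ + γ₂ 0 1 := div_mul_cancel₀ _ hj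
  rw [autFactor, autFactor, add_mul, mul_assoc, h, autFactor]
  simp [Matrix.mul_apply, Fin.sum_univ_two]
  ring

lemma moebius_mul (γ₁ γ₂ : SL(2, ℤ)) {τ : ℂ} (hj : autFactor γ₂ τ ≠ 0) :
    moebius (γ₁ * γ₂) τ = moebius γ₁ (moebius γ₂ τ) := by
  have h : moebius γ₂ τ * autFactor γ₂ τ = γ₂ 0 0 * τ + γ₂ 0 1 := div_mul_cancel₀ _ hj
  rw [moebius, autFactor_mul γ₁ γ₂ hj, moebius.eq_def γ₁, ← mul_div_mul_right (γ₁ 0 0 * moebius γ₂ τ + γ₁ 0 1) _ hj]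
  congr 1
  rw [add_mul, mul_assoc, h, autFactor]
  simp [Matrix.mul_apply, Fin.sum_univ_two]
  ring

lemma slash_mul {E : Type*} [AddCommGroup E] [Module ℂ E] {r : ℕ} (κ : Fin r → ℤ)
    (γ₁ γ₂ : SL(2, ℤ)) (F : E → ℂ → Matrix (Fin r) (Fin r) ℂ) (w : E) {τ : ℂ}
    (hj : autFactor γ₂ τ ≠ 0) :
    slash κ (γ₁ * γ₂) F w τ =
      slash κ γ₁ F ((autFactor γ₂ τ)⁻¹ • w) (moebius γ₂ τ) *
        Matrix.diagonal fun i => autFactor γ₂ τ ^ (-κ i) := by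
  rw [slash, slash, autFactor_mul γ₁ γ₂ hj, moebius_mul γ₁ γ₂ hj, mul_inv, mul_smul, mul_assoc,
    Matrix.diagonal_mul_diagonal]
  simp_rw [mul_zpow]

lemma autFactor_one (τ : ℂ) : autFactor 1 τ = 1 := by simp [autFactor]

lemma moebius_one (τ : ℂ) : moebius 1 τ = τ := by simp [moebius, autFactor_one]

lemma slash_one {E : Type*} [AddCommGroup E] [Module ℂ E] {r : ℕ} (κ : Fin r → ℤ)
    (F : E → ℂ → Matrix (Fin r) (Fin r) ℂ) (w : E) (τ : ℂ) : slash κ 1 F w τ = F w τ := by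
  simp [slash, autFactor_one, moebius_one]

/-! ### Holomorphic extensions of the cocycle -/

/-- `F` is an invertible holomorphic function of `(z, τ) ∈ ℂ × D` that describes the action of `γ`
on the fundamental matrix. -/
structure IsCocycleOn (γ : SL(2, ℤ)) (D : Set ℂ) (F : ℂ × ℂ → Matrix (Fin 2) (Fin 2) ℂ) :
    Prop where
  analyticAt : ∀ p : ℂ × ℂ, p.2 ∈ D → ∀ i j, AnalyticAt ℂ (fun x => F x i j) p
  det_ne_zero : ∀ p : ℂ × ℂ, p.2 ∈ D → (F p).det ≠ 0
  slash_eq : ∀ z u τ : ℂ, Regular z u τ →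
    slash weight γ UJ (z, u) τ = F (z, τ) * UJ (z, u) τ

/-- The action of `γ` on the pairs `(z, τ)`. -/
def jacobiAct (γ : SL(2, ℤ)) (p : ℂ × ℂ) : ℂ × ℂ :=
  ((autFactor γ p.2)⁻¹ * p.1, moebius γ p.2)

lemma analyticAt_jacobiAct (γ : SL(2, ℤ)) {p : ℂ × ℂ} (hp : autFactor γ p.2 ≠ 0) :
    AnalyticAt ℂ (jacobiAct γ) p := by
  have h1 : AnalyticAt ℂ (fun p : ℂ × ℂ => autFactor γ p.2) p := by
    simp only [autFactor]
    exact (analyticAt_const.mul analyticAt_snd).add analyticAt_const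
  have h2 : AnalyticAt ℂ (fun p : ℂ × ℂ => moebius γ p.2) p := by
    simp only [moebius]
    exact ((analyticAt_const.mul analyticAt_snd).add analyticAt_const).div h1 hp
  exact ((h1.inv hp).mul analyticAt_fst).prod h2

namespace IsCocycleOn

variable {γ γ₁ γ₂ : SL(2, ℤ)} {D D₁ D₂ : Set ℂ} {F F₁ F₂ : ℂ × ℂ → Matrix (Fin 2) (Fin 2) ℂ}

lemma mono (h : IsCocycleOn γ D₁ F) (hD : D ⊆ D₁) : IsCocycleOn γ D F :=
  ⟨fun p hp => h.analyticAt p (hD hp), fun p hp => h.det_ne_zero p (hD hp), h.slash_eq⟩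

lemma slash_mul_eq (h : IsCocycleOn γ₁ D₁ F₁) {z u τ : ℂ} (hr : Regular z u τ) :
    slash weight (γ₁ * γ₂) UJ (z, u) τ =
      F₁ (jacobiAct γ₂ (z, τ)) * slash weight γ₂ UJ (z, u) τ := by
  rw [slash_mul weight γ₁ γ₂ UJ (z, u) (autFactor_ne_zero γ₂ hr.1.ne'), Prod.smul_mk, smul_eq_mul,
    smul_eq_mul, h.slash_eq _ _ _ (hr.moebius γ₂), mul_assoc]
  rfl

lemma mul (h₁ : IsCocycleOn γ₁ D₁ F₁) (h₂ : IsCocycleOn γ₂ D₂ F₂) (hD : D ⊆ D₂)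
    (hj : ∀ τ ∈ D, autFactor γ₂ τ ≠ 0) (hm : ∀ τ ∈ D, moebius γ₂ τ ∈ D₁) :
    IsCocycleOn (γ₁ * γ₂) D fun p => F₁ (jacobiAct γ₂ p) * F₂ p where
  analyticAt p hp i j := by
    have h : ∀ k, AnalyticAt ℂ (fun x => F₁ (jacobiAct γ₂ x) i k) p := fun k =>
      (h₁.analyticAt (jacobiAct γ₂ p) (hm _ hp) i k).comp (analyticAt_jacobiAct γ₂ (hj _ hp))
    simp only [Matrix.mul_apply, Fin.sum_univ_two]
    exact ((h 0).mul (h₂.analyticAt p (hD hp) 0 j)).add ((h 1).mul (h₂.analyticAt p (hD hp) 1 j))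
  det_ne_zero p hp := by
    rw [Matrix.det_mul]
    exact mul_ne_zero (h₁.det_ne_zero _ (hm _ hp)) (h₂.det_ne_zero p (hD hp))
  slash_eq z u τ hr := by rw [h₁.slash_mul_eq hr, h₂.slash_eq z u τ hr, mul_assoc]

/-- The cocycle rule for γγ⁻¹ = 1 can be solved for the factor of γ⁻¹; the determinant does not
vanish, so Cramer's rule keeps the entries holomorphic. -/
lemma inv (h : IsCocycleOn γ D₁ F) (hpos : ∀ τ : ℂ, 0 < τ.im → τ ∈ D₁)
    (hj : ∀ τ ∈ D, autFactor γ⁻¹ τ ≠ 0) (hm : ∀ τ ∈ D, moebius γ⁻¹ τ ∈ D₁) :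
    IsCocycleOn γ⁻¹ D fun p => (F (jacobiAct γ⁻¹ p))⁻¹ where
  analyticAt p hp i j := by
    have h1 : ∀ i j, AnalyticAt ℂ (fun x => F (jacobiAct γ⁻¹ x) i j) p := fun i j =>
      (h.analyticAt (jacobiAct γ⁻¹ p) (hm _ hp) i j).comp (analyticAt_jacobiAct γ⁻¹ (hj _ hp))
    have h2 := h.det_ne_zero (jacobiAct γ⁻¹ p) (hm _ hp)
    have h3 : AnalyticAt ℂ (fun x => (F (jacobiAct γ⁻¹ x)).det) p := by
      simp only [Matrix.det_fin_two]
      exact ((h1 0 0).mul (h1 1 1)).sub ((h1 0 1).mul (h1 1 0))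
    simp only [Matrix.inv_def, Ring.inverse_eq_inv', Matrix.smul_apply, smul_eq_mul]
    refine (h3.inv h2).mul ?_
    simp only [Matrix.adjugate_fin_two]
    fin_cases i <;> fin_cases j <;> simp
    · exact h1 1 1
    · exact (h1 0 1).neg
    · exact (h1 1 0).neg
    · exact h1 0 0
  det_ne_zero p hp := by
    rw [Matrix.det_nonsing_inv, Ring.inverse_eq_inv']
    exact inv_ne_zero (h.det_ne_zero _ (hm _ hp))
  slash_eq z u τ hr := by
    have h1 := h.slash_mul_eq (γ₂ := γ⁻¹) hr
    have h2 : IsUnit (F (jacobiAct γ⁻¹ (z, τ))).det :=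
      isUnit_iff_ne_zero.2 (h.det_ne_zero _ (hpos _ (moebius_im_pos γ⁻¹ hr.1)))
    rw [mul_inv_cancel, slash_one] at h1
    rw [h1, Matrix.nonsing_inv_mul_cancel_left _ _ h2]

lemma cocycle_eq (h : IsCocycleOn γ D F) {z u τ : ℂ} (hr : Regular z u τ) :
    cocycle weight γ UJ (z, u) τ = F (z, τ) := by
  rw [cocycle, h.slash_eq z u τ hr,
    Matrix.mul_nonsing_inv_cancel_right _ _ (isUnit_iff_ne_zero.2 (det_UJ_ne_zero hr))]

/-- The extension has no poles, so the denominator 1 and the empty exceptional set suffice. -/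
lemma isModularOn (h : IsCocycleOn γ (cutPlane γ) F) : IsModularOn γ F := by
  refine ⟨fun i j p hp => ⟨fun x => F x i j, fun _ => 1, h.analyticAt p hp i j,
    analyticAt_const, ?_, ?_⟩, ∅, Set.finite_empty, fun p hp _ => h.analyticAt p hp⟩
  · simpa using (NeBot.ne (nhds_neBot (x := p)))
  · simp

end IsCocycleOn

/-- Provides an auxiliary u when an identity in (z, τ) alone is to be read off from U. -/
lemma exists_regular {z τ : ℂ} (hτ : 0 < τ.im) (hz : z ∉ lattice τ) : ∃ u, Regular z u τ := by
  obtain ⟨u, h1, h2⟩ := ((eventually_notMem_lattice hτ 0).and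
    (eventually_add_notMem_lattice hτ z 0)).exists
  exact ⟨u, hτ, hz, h1, by rwa [add_comm]⟩

/-! ### Elements with `c = 0` -/

lemma e_sub_int (x : ℂ) (n : ℤ) : e (x - n) = e x := by
  have := e_add_int x (-n)
  rwa [Int.cast_neg, ← sub_eq_add_neg] at this

lemma isCocycleOn_of_lower_right_eq_one {γ : SL(2, ℤ)} (hc : γ 1 0 = 0) (hd : γ 1 1 = 1) :
    IsCocycleOn γ Set.univ fun _ => 1 where
  analyticAt _ _ _ _ := analyticAt_const
  det_ne_zero _ _ := by simp
  slash_eq z u τ _ := by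
    have h := det_entries γ
    simp only [hc, hd, mul_one, mul_zero, sub_zero] at h
    have hj : autFactor γ τ = 1 := by simp [autFactor, hc, hd]
    have hm : moebius γ τ = τ + γ 0 1 := by simp [moebius, hj, h]
    simp [slash, hj, hm, UJ, e_add_int]

/-- The matrix of the action of `(z, u) ↦ (-z, -u)`. -/
def negMatrix (z : ℂ) : Matrix (Fin 2) (Fin 2) ℂ := !![-e z, 0; 1 - e z, -1]

/-- Inverting t and λ multiplies the first solution by t and the second by -t; weight 1 adds a sign
to the first column. -/
lemma isCocycleOn_of_lower_right_eq_neg_one {γ : SL(2, ℤ)} (hc : γ 1 0 = 0) (hd : γ 1 1 = -1) :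
    IsCocycleOn γ Set.univ fun p => negMatrix p.1 where
  analyticAt p _ i j := by
    have h : AnalyticAt ℂ (fun x : ℂ × ℂ => e x.1) p :=
      (differentiable_e.analyticAt p.1).comp analyticAt_fst
    fin_cases i <;> fin_cases j <;> simp [negMatrix]
    · exact h.neg
    · exact analyticAt_const
    · exact analyticAt_const.sub h
    · exact analyticAt_const
  det_ne_zero p _ := by simp [negMatrix, Matrix.det_fin_two_of, e_ne_zero]
  slash_eq z u τ hr := by
    have h := det_entries γ
    simp only [hc, hd, mul_zero, sub_zero] at h
    have h' : γ 0 0 = -1 := by linarith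
    have hj : autFactor γ τ = -1 := by simp [autFactor, hc, hd]
    have hm : moebius γ τ = τ - γ 0 1 := by
      rw [moebius, hj, h']; push_cast; ring
    have h1 : Regular (-z) (-u) τ :=
      ⟨hr.1, neg_mem_lattice.not.2 hr.2.1, neg_mem_lattice.not.2 hr.2.2.1, by
        rw [← neg_add]; exact neg_mem_lattice.not.2 hr.2.2.2⟩
    have h2 : UJ (-z, -u) (τ - γ 0 1) = UJ (-z, -u) τ := by simp only [UJ, e_sub_int]
    have h3 := f0_inv (e_ne_zero z) (e_ne_zero u) (e_ne_zero τ) (lam_t_ne_one hr.2.2.2)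
    have h4 := fNeg1_inv (e_ne_zero z) (e_ne_zero τ)
    have h5 := e_ne_zero z
    have h6 : ((-1 : ℂ)⁻¹ • (z, u)) = (-z, -u) := by
      rw [Prod.smul_mk]; norm_num
    rw [slash, hj, hm, h6, h2, UJ_eq h1, UJ_eq hr, e_neg, e_neg, h3, h4, negMatrix]
    ext i j
    fin_cases i <;> fin_cases j <;> simp [Matrix.mul_apply, Fin.sum_univ_two, weight]
    · field_simp
      ring
    · field_simp
      ring

/-! ### The inversion -/

lemma thetaFactor_ne_zero {z τ : ℂ} (hτ : τ ≠ 0) : thetaFactor z τ ≠ 0 :=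
  mul_ne_zero (div_ne_zero (e_ne_zero _) (sqrt_ne_zero hτ)) (e_ne_zero _)

/-- The continuation of `mordellPeriod` to the slit plane. -/
def mordellPeriodExt (z τ : ℂ) : ℂ :=
  e (-1 / 8) / τ ^ (1 / 2 : ℂ) * e (-z / (2 * τ)) * e (-1 / (8 * τ)) * e (-z ^ 2 / (2 * τ)) *
    mordellExt z τ

/-- The continuation of `omegaS` to the slit plane. -/
def omegaExt (z τ : ℂ) : Matrix (Fin 2) (Fin 2) ℂ :=
  !![mordellPeriodExt z τ * e z + thetaFactor z τ, mordellPeriodExt z τ;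
    (τ⁻¹ - e (z / τ) * mordellPeriodExt z τ) * e z - e (z / τ) * thetaFactor z τ,
    τ⁻¹ - e (z / τ) * mordellPeriodExt z τ]

/-- The Mordell terms cancel, so invertibility on the slit plane is visible. -/
lemma det_omegaExt (z τ : ℂ) : (omegaExt z τ).det = τ⁻¹ * thetaFactor z τ := by
  rw [omegaExt, Matrix.det_fin_two_of]; ring

lemma omegaExt_eq {z τ : ℂ} (hτ : 0 < τ.im) : omegaExt z τ = omegaS z τ := by
  have h1 : (!![0, 1; 1, -e z] : Matrix (Fin 2) (Fin 2) ℂ)⁻¹ = !![e z, 1; 1, 0] := by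
    refine Matrix.inv_eq_right_inv ?_
    rw [Matrix.mul_fin_two, Matrix.one_fin_two]
    simp
  rw [omegaExt, omegaS, h1, mordellPeriodExt, mordellExt_eq hτ, thetaFactor]
  ext i j
  fin_cases i <;> fin_cases j <;> simp <;> ring

lemma analyticAt_omegaExt {p : ℂ × ℂ} (hp : p.2 ∈ slitPlane) (i j : Fin 2) :
    AnalyticAt ℂ (fun x : ℂ × ℂ => omegaExt x.1 x.2 i j) p := by
  have h0 : p.2 ≠ 0 := slitPlane_ne_zero hp
  have he : ∀ f : ℂ × ℂ → ℂ, AnalyticAt ℂ f p → AnalyticAt ℂ (fun x => e (f x)) p := fun f hf =>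
    (differentiable_e.analyticAt (f p)).comp hf
  have hs : AnalyticAt ℂ (fun x : ℂ × ℂ => x.2 ^ (1 / 2 : ℂ)) p :=
    AnalyticAt.cpow analyticAt_snd analyticAt_const hp
  have hs0 := sqrt_ne_zero h0
  have h8 : 8 * p.2 ≠ 0 := mul_ne_zero (by norm_num) h0
  have h2 : 2 * p.2 ≠ 0 := mul_ne_zero two_ne_zero h0
  have hx : AnalyticAt ℂ (fun x : ℂ × ℂ => x.1) p := analyticAt_fst
  have hy : AnalyticAt ℂ (fun x : ℂ × ℂ => x.2) p := analyticAt_snd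
  have hz : AnalyticAt ℂ (fun x : ℂ × ℂ => e x.1) p := he _ analyticAt_fst
  have hzt : AnalyticAt ℂ (fun x : ℂ × ℂ => e (x.1 / x.2)) p :=
    he _ (analyticAt_fst.div analyticAt_snd h0)
  have hinv : AnalyticAt ℂ (fun x : ℂ × ℂ => x.2⁻¹) p := analyticAt_snd.inv h0
  have hE : AnalyticAt ℂ (fun x : ℂ × ℂ => thetaFactor x.1 x.2) p := by
    simp only [thetaFactor]
    exact (analyticAt_const.div hs hs0).mul (he _ ((((hx.add analyticAt_const).sub
      hy.div_const).pow 2).neg.div (analyticAt_const.mul hy) h2))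
  have hK : AnalyticAt ℂ (fun x : ℂ × ℂ => mordellPeriodExt x.1 x.2) p := by
    simp only [mordellPeriodExt]
    exact ((((analyticAt_const.div hs hs0).mul
      (he _ (hx.neg.div (analyticAt_const.mul hy) h2))).mul
      (he _ (analyticAt_const.div (analyticAt_const.mul hy) h8))).mul
      (he _ ((hx.pow 2).neg.div (analyticAt_const.mul hy) h2))).mul (analyticAt_mordellExt hp)
  have h22 := hinv.sub (hzt.mul hK)
  fin_cases i <;> fin_cases j <;> simp [omegaExt]
  · exact (hK.mul hz).add hE
  · exact hK
  · exact (h22.mul hz).sub (hzt.mul hE)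
  · exact h22

/-- The product of the inversion and the translation by `m`. -/
def invTranslate (m : ℤ) : SL(2, ℤ) :=
  ⟨!![0, -1; 1, m], by simp [Matrix.det_fin_two_of]⟩

lemma autFactor_invTranslate (m : ℤ) (τ : ℂ) : autFactor (invTranslate m) τ = τ + m := by
  simp [autFactor, invTranslate]

lemma moebius_invTranslate (m : ℤ) (τ : ℂ) : moebius (invTranslate m) τ = -1 / (τ + m) := by
  rw [moebius, autFactor_invTranslate]
  simp [invTranslate]

/-- U depends on τ only through e(τ), so the translation costs nothing. The first column is `f0_S`,
the second `theta_S`; the second row follows by the first-order relations. -/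
lemma isCocycleOn_invTranslate (m : ℤ) :
    IsCocycleOn (invTranslate m) {τ | τ + m ∈ slitPlane} fun p => omegaExt p.1 (p.2 + m) where
  analyticAt p hp i j := by
    have h1 : AnalyticAt ℂ (fun x : ℂ × ℂ => (x.1, x.2 + (m : ℂ))) p :=
      analyticAt_fst.prod (analyticAt_snd.add analyticAt_const)
    exact AnalyticAt.comp (f := fun x : ℂ × ℂ => (x.1, x.2 + (m : ℂ)))
      (analyticAt_omegaExt (p := (p.1, p.2 + (m : ℂ))) hp i j) h1
  det_ne_zero p hp := by
    have h0 : p.2 + m ≠ 0 := slitPlane_ne_zero hp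
    rw [det_omegaExt]
    exact mul_ne_zero (inv_ne_zero h0) (thetaFactor_ne_zero h0)
  slash_eq z u τ hr := by
    set σ : ℂ := τ + m with hσ
    have hτ : e τ = e σ := (e_add_int τ m).symm
    have hUJ : UJ (z, u) τ = UJ (z, u) σ := by simp only [UJ, hτ]
    have him : 0 < σ.im := by simpa [hσ] using hr.1
    have hl : ∀ w : ℂ, w ∈ lattice σ → w ∈ lattice τ := by
      rintro w ⟨a, b, h⟩
      exact ⟨a + b * m, b, by rw [h, hσ]; push_cast; ring⟩
    have hrσ : Regular z u σ :=
      ⟨him, mt (hl z) hr.2.1, mt (hl u) hr.2.2.1, mt (hl (z + u)) hr.2.2.2⟩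
    have h0 := ne_zero_of_im_pos him
    have hr2 : Regular (z / σ) (u / σ) (-1 / σ) :=
      ⟨neg_inv_im_pos him, (div_mem_lattice_neg_inv h0).not.2 hrσ.2.1,
        (div_mem_lattice_neg_inv h0).not.2 hrσ.2.2.1, by
        rw [← add_div]; exact (div_mem_lattice_neg_inv h0).not.2 hrσ.2.2.2⟩
    have h1 := f0_S him hrσ.2.1 hrσ.2.2.1 hrσ.2.2.2
    have h2 : fNeg1 (e (z / σ)) (e (-1 / σ)) = thetaFactor z σ * fNeg1 (e z) (e σ) := by
      rw [fNeg1, fNeg1, theta_S him, mul_inv, mul_inv_cancel_left₀ (thetaFactor_ne_zero h0)]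
    have h3 : mordellPeriodExt z σ = mordellPeriod z σ := by
      rw [mordellPeriodExt, mordellPeriod, mordellExt_eq him]
    have h4 : (σ⁻¹ • (z, u)) = (z / σ, u / σ) := by
      rw [Prod.smul_mk, smul_eq_mul, smul_eq_mul, div_eq_inv_mul, div_eq_inv_mul]
    rw [slash, autFactor_invTranslate, moebius_invTranslate, ← hσ, h4, UJ_eq hr2, hUJ, UJ_eq hrσ,
      omegaExt, h3, h2]
    ext i j
    fin_cases i <;> fin_cases j <;> simp [Matrix.mul_apply, Fin.sum_univ_two, weight]
    · linear_combination h1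
    · ring
    · linear_combination (-e (z / σ)) * h1
    · ring

/-! ### Extension of the cocycle for arbitrary `γ` -/

/-- The plane slit along `(-∞, -d/c]`, or the whole plane if `c = 0`. -/
def slitDomain (γ : SL(2, ℤ)) : Set ℂ :=
  {τ | γ 1 0 = 0 ∨ τ.im ≠ 0 ∨ -(γ 1 1 : ℝ) < γ 1 0 * τ.re}

/-- Euclidean descent on c: splitting off an inversion with translation on the right replaces c by a
remainder modulo c, and the slit domains are compatible with the factorisation. -/
lemma exists_isCocycleOn_slitDomain (n : ℕ) : ∀ γ : SL(2, ℤ), γ 1 0 = n →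
    ∃ F, IsCocycleOn γ (slitDomain γ) F := by
  induction n using Nat.strong_induction_on with
  | _ n ih =>
    intro γ hγ
    have hdet := det_entries γ
    rcases Nat.eq_zero_or_pos n with hn | hn
    · subst hn
      have hc : γ 1 0 = 0 := by simpa using hγ
      have h1 : γ 1 1 * γ 0 0 = 1 := by rw [hc] at hdet; linarith
      rcases Int.eq_one_or_neg_one_of_mul_eq_one h1 with hd | hd
      · exact ⟨_, (isCocycleOn_of_lower_right_eq_one hc hd).mono (Set.subset_univ _)⟩
      · exact ⟨_, (isCocycleOn_of_lower_right_eq_neg_one hc hd).mono (Set.subset_univ _)⟩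
    · have hc : 0 < γ 1 0 := by rw [hγ]; exact_mod_cast hn
      set c := γ 1 0 with hcdef
      set d := γ 1 1 with hddef
      -- This is the ceiling of d/c. It makes cm - d a remainder in [0, c) and gives -m ≤ -d/c, so
      -- the slit of the right factor lies inside that of γ.
      set m : ℤ := -((-d) / c) with hm
      have hmod := Int.emod_add_mul_ediv (-d) c
      have hm0 : 0 ≤ c * m - d := by
        have := Int.emod_nonneg (-d) hc.ne'
        rw [hm]; linarith
      have hm1 : c * m - d < c := by
        have := Int.emod_lt_of_pos (-d) hc
        rw [hm]; linarith
      let γ₁ : SL(2, ℤ) := ⟨!![γ 0 0 * m - γ 0 1, γ 0 0; c * m - d, c], by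
        rw [Matrix.det_fin_two_of]; linear_combination hdet⟩
      have hmul : γ = γ₁ * invTranslate m := by
        apply Subtype.ext
        change (γ : Matrix (Fin 2) (Fin 2) ℤ) =
          !![γ 0 0 * m - γ 0 1, γ 0 0; c * m - d, c] * !![0, -1; 1, m]
        rw [Matrix.mul_fin_two]
        ext i j
        fin_cases i <;> fin_cases j <;> simp [hcdef, hddef]
      have hc1 : γ₁ 1 0 = c * m - d := rfl
      have hd1 : γ₁ 1 1 = c := rfl
      obtain ⟨F₁, hF₁⟩ := ih (c * m - d).toNat (by omega) γ₁ (by rw [hc1]; omega)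
      have hcR : (0 : ℝ) < c := by exact_mod_cast hc
      have hmR : (0 : ℝ) ≤ c * m - d := by exact_mod_cast hm0
      have hslit : ∀ τ ∈ slitDomain γ, τ + m ∈ slitPlane := by
        intro τ hτ
        rw [mem_slitPlane_iff]
        rcases hτ with h | h | h
        · exact absurd h hc.ne'
        · right; simpa using h
        · left
          rw [← hcdef, ← hddef] at h
          have : 0 < (c : ℝ) * (τ.re + m) := by linarith
          simpa using pos_of_mul_pos_right this hcR.le
      refine ⟨fun p => F₁ (jacobiAct (invTranslate m) p) * omegaExt p.1 (p.2 + m), ?_⟩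
      have key := hF₁.mul (D := slitDomain γ) (isCocycleOn_invTranslate m) hslit ?_ ?_
      · rwa [← hmul] at key
      · intro τ hτ
        rw [autFactor_invTranslate]
        exact slitPlane_ne_zero (hslit τ hτ)
      · intro τ hτ
        rw [moebius_invTranslate]
        have h0 := slitPlane_ne_zero (hslit τ hτ)
        by_cases him : τ.im = 0
        · have hlt : -(d : ℝ) < c * τ.re := by
            rcases hτ with h | h | h
            · exact absurd h hc.ne'
            · exact absurd him h
            · exact h
          have hx : 0 < τ.re + m := by
            have : 0 < (c : ℝ) * (τ.re + m) := by linarith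
            exact pos_of_mul_pos_right this hcR.le
          have hre : -1 / (τ + m) = ((-1 / (τ.re + m) : ℝ) : ℂ) := by
            have : τ = (τ.re : ℂ) := Complex.ext rfl (by simpa using him)
            rw [this]; push_cast; simp
          -- For real τ, the form (cm - d)σ + c at σ = -1/(τ + m) equals (cτ + d)/(τ + m), which is
          -- positive.
          right; right
          rw [hc1, hd1, hre, ofReal_re]
          push_cast
          rw [mul_div_assoc', lt_div_iff₀ hx]
          linarith
        · right; left
          rw [← moebius_invTranslate, moebius_im]
          refine div_ne_zero him (normSq_pos.2 ?_).ne'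
          rwa [autFactor_invTranslate]

/-- For c < 0 the inverse has lower left entry -c > 0, so the extension for γ⁻¹ is available and is
inverted along γ. -/
theorem exists_isCocycleOn (γ : SL(2, ℤ)) : ∃ F, IsCocycleOn γ (cutPlane γ) F := by
  rcases le_or_gt 0 (γ 1 0) with hc | hc
  · obtain ⟨F, hF⟩ := exists_isCocycleOn_slitDomain (γ 1 0).toNat γ (by omega)
    refine ⟨F, hF.mono fun τ hτ => ?_⟩
    by_cases him : τ.im = 0
    · rcases hτ him with ⟨h1, h2⟩ | ⟨h1, _⟩
      · have hcR : (0 : ℝ) < γ 1 0 := by exact_mod_cast h1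
        rw [div_lt_iff₀ hcR] at h2
        exact Or.inr (Or.inr (by linarith))
      · exact absurd h1 hc.not_gt
    · exact Or.inr (Or.inl him)
  · have e10 : (γ⁻¹ : SL(2, ℤ)) 1 0 = -γ 1 0 := by
      simp [Matrix.SpecialLinearGroup.coe_inv, Matrix.adjugate_fin_two]
    have e11 : (γ⁻¹ : SL(2, ℤ)) 1 1 = γ 0 0 := by
      simp [Matrix.SpecialLinearGroup.coe_inv, Matrix.adjugate_fin_two]
    obtain ⟨F, hF⟩ := exists_isCocycleOn_slitDomain (-γ 1 0).toNat γ⁻¹ (by rw [e10]; omega)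
    have hcR : (γ 1 0 : ℝ) < 0 := by exact_mod_cast hc
    have hreal : ∀ τ ∈ cutPlane γ, τ.im = 0 → 0 < γ 1 0 * τ.re + γ 1 1 := by
      intro τ hτ him
      rcases hτ him with ⟨h1, _⟩ | ⟨_, h2⟩
      · exact absurd h1 hc.not_gt
      · rw [lt_div_iff_of_neg hcR] at h2
        linarith
    have haut : ∀ τ : ℂ, τ.im = 0 → autFactor γ τ = ((γ 1 0 * τ.re + γ 1 1 : ℝ) : ℂ) := by
      intro τ him
      rw [autFactor]
      apply Complex.ext <;> simp [him]
    have hj : ∀ τ ∈ cutPlane γ, autFactor γ τ ≠ 0 := by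
      intro τ hτ
      by_cases him : τ.im = 0
      · rw [haut τ him]
        exact_mod_cast (hreal τ hτ him).ne'
      · exact autFactor_ne_zero γ him
    have key := hF.inv (D := cutPlane γ) (fun τ hτ => Or.inr (Or.inl hτ.ne')) ?_ ?_
    · rw [inv_inv] at key
      exact ⟨_, key⟩
    · rwa [inv_inv]
    · rw [inv_inv]
      intro τ hτ
      by_cases him : τ.im = 0
      -- For real τ, -c·γτ + a = 1/(cτ + d), and cτ + d > 0 on the cut plane when c < 0.
      · right; right
        have h1 := hreal τ hτ him
        have h2 : moebius γ τ =
            (((γ 0 0 * τ.re + γ 0 1) / (γ 1 0 * τ.re + γ 1 1) : ℝ) : ℂ) := by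
          rw [moebius, haut τ him, ofReal_div]
          congr 1
          apply Complex.ext <;> simp [him]
        have h3 := det_entries_cast (R := ℝ) γ
        rw [h2, ofReal_re, e10, e11, mul_div_assoc', lt_div_iff₀ h1]
        push_cast
        linarith
      · right; left
        rw [moebius_im]
        exact div_ne_zero him (normSq_pos.2 (hj τ hτ)).ne'

/-- The cocycle itself is only given at z off the lattice; the explicit extension secures the
formula at every z without a uniqueness argument. -/
theorem exists_isCocycleOn_omegaS : ∃ F, IsCocycleOn ModularGroup.S (cutPlane ModularGroup.S) F ∧
    ∀ z τ : ℂ, 0 < τ.im → F (z, τ) = omegaS z τ := by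
  have hS : ModularGroup.S = invTranslate 0 := rfl
  refine ⟨fun p => omegaExt p.1 (p.2 + (0 : ℤ)), ?_, fun z τ hτ => ?_⟩
  · rw [hS]
    refine (isCocycleOn_invTranslate 0).mono fun τ hτ => ?_
    have hτ' : τ ∈ slitPlane := by
      rw [mem_slitPlane_iff]
      by_cases him : τ.im = 0
      · left
        simpa [invTranslate] using hτ him
      · exact Or.inr him
    simpa using hτ'
  · simpa using omegaExt_eq hτ

/-- U and V acquire the same invertible left factor F(z, τ), which cancels in V⁻¹U; the inverse
weight matrix of V survives as Δ. -/
lemma MJ_eq_Delta_mul_slash (γ : SL(2, ℤ)) {z u v τ : ℂ} (hu : Regular z u τ)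
    (hv : Regular z v τ) :
    MJ (z, u, v) τ = Delta weight γ τ * slash weight γ MJ (z, u, v) τ := by
  obtain ⟨F, hF⟩ := exists_isCocycleOn γ
  have hj := autFactor_ne_zero γ hu.1.ne'
  have h1 := hF.slash_eq z u τ hu
  have h2 := hF.slash_eq z v τ hv
  have hFd : IsUnit (F (z, τ)).det :=
    isUnit_iff_ne_zero.2 (hF.det_ne_zero (z, τ) fun h => absurd h hu.1.ne')
  set D := Matrix.diagonal fun i => autFactor γ τ ^ (-weight i) with hD
  have hΔ : D⁻¹ = Delta weight γ τ := by
    refine Matrix.inv_eq_left_inv ?_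
    rw [hD, Delta, Matrix.diagonal_mul_diagonal, ← Matrix.diagonal_one]
    congr 1
    ext i
    rw [← zpow_add₀ hj, add_neg_cancel, zpow_zero]
  have h3 : slash weight γ MJ (z, u, v) τ =
      (VJ ((autFactor γ τ)⁻¹ • (z, v)) (moebius γ τ))⁻¹ * slash weight γ UJ (z, u) τ := by
    rw [slash, slash, ← mul_assoc]
    rfl
  have h4 : Delta weight γ τ * (VJ ((autFactor γ τ)⁻¹ • (z, v)) (moebius γ τ))⁻¹ =
      (slash weight γ UJ (z, v) τ)⁻¹ := by
    rw [slash, Matrix.mul_inv_rev, ← hΔ, VJ_eq_UJ]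
  rw [h3, ← mul_assoc, h4, h1, h2, Matrix.mul_inv_rev, mul_assoc,
    Matrix.nonsing_inv_mul_cancel_left _ _ hFd]
  rfl

end AppellLerch

end

/-! ### Assembly: fundamental matrices, monodromy and the modular cocycle -/

theorem theorem1p5 :
    -- `U` and `V` are fundamental matrices of solutions
    (∀ z u τ : ℂ, AppellLerch.Regular z u τ →
      (∀ j, AppellLerch.SolvesAt (AppellLerch.e τ) (AppellLerch.e z)
        (AppellLerch.solU (AppellLerch.e u) (AppellLerch.e τ) j)) ∧
      (∀ j, AppellLerch.SolvesAt (AppellLerch.e τ) (AppellLerch.e z)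
        (AppellLerch.solV (AppellLerch.e u) (AppellLerch.e τ) j)) ∧
      (AppellLerch.UJ (z, u) τ).det ≠ 0 ∧ (AppellLerch.VJ (z, u) τ).det ≠ 0) ∧
    -- (a) the monodromy
    (∀ z u v τ : ℂ, AppellLerch.Regular z u τ → AppellLerch.Regular z v τ →
      AppellLerch.M (AppellLerch.e z) (AppellLerch.e u) (AppellLerch.e v) (AppellLerch.e τ) =
        !![1, 0;
           AppellLerch.M21 (AppellLerch.e z) (AppellLerch.e u) (AppellLerch.e v)
             (AppellLerch.e τ), 1]) ∧
    -- (a) its modular transformation law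
    (∀ (γ : Matrix.SpecialLinearGroup (Fin 2) ℤ) (z u v τ : ℂ),
      AppellLerch.Regular z u τ → AppellLerch.Regular z v τ →
      AppellLerch.MJ (z, u, v) τ =
        AppellLerch.Delta AppellLerch.weight γ τ *
          AppellLerch.slash AppellLerch.weight γ AppellLerch.MJ (z, u, v) τ) ∧
    -- (b) the two cocycles are one and the same function of `(z, τ)`, which extends
    -- meromorphically to `ℂ × ℂ_γ` and is explicit for `γ = S`
    ∃ Ω : Matrix.SpecialLinearGroup (Fin 2) ℤ → ℂ × ℂ → Matrix (Fin 2) (Fin 2) ℂ,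
      (∀ (γ : Matrix.SpecialLinearGroup (Fin 2) ℤ) (z u τ : ℂ), AppellLerch.Regular z u τ →
        AppellLerch.cocycle AppellLerch.weight γ AppellLerch.UJ (z, u) τ = Ω γ (z, τ)) ∧
      (∀ (γ : Matrix.SpecialLinearGroup (Fin 2) ℤ) (z v τ : ℂ), AppellLerch.Regular z v τ →
        AppellLerch.cocycle AppellLerch.weight γ AppellLerch.VJ (z, v) τ = Ω γ (z, τ)) ∧
      (∀ (γ γ' : Matrix.SpecialLinearGroup (Fin 2) ℤ) (z τ : ℂ), 0 < τ.im →
        z ∉ AppellLerch.lattice τ →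
        Ω (γ * γ') (z, τ) =
          Ω γ ((AppellLerch.autFactor γ' τ)⁻¹ * z, AppellLerch.moebius γ' τ) * Ω γ' (z, τ)) ∧
      (∀ γ : Matrix.SpecialLinearGroup (Fin 2) ℤ, AppellLerch.IsModularOn γ (Ω γ)) ∧
      (∀ z τ : ℂ, 0 < τ.im → Ω ModularGroup.S (z, τ) = AppellLerch.omegaS z τ) := by
  classical
  choose F hF using AppellLerch.exists_isCocycleOn
  obtain ⟨FS, hFS, hFS'⟩ := AppellLerch.exists_isCocycleOn_omegaS
  -- At S the chosen extension is replaced by the explicit one.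
  set Ω : Matrix.SpecialLinearGroup (Fin 2) ℤ → ℂ × ℂ → Matrix (Fin 2) (Fin 2) ℂ :=
    fun γ => if γ = ModularGroup.S then FS else F γ with hΩ
  have hΩc : ∀ γ, AppellLerch.IsCocycleOn γ (AppellLerch.cutPlane γ) (Ω γ) := by
    intro γ
    by_cases h : γ = ModularGroup.S
    · subst h
      simpa [hΩ] using hFS
    · simpa [hΩ, h] using hF γ
  refine ⟨fun z u τ h => ⟨AppellLerch.solvesAt_solU h, AppellLerch.solvesAt_solU h,
    AppellLerch.det_UJ_ne_zero h, AppellLerch.det_UJ_ne_zero h⟩,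
    fun z u v τ => AppellLerch.M_eq, fun γ z u v τ => AppellLerch.MJ_eq_Delta_mul_slash γ,
    Ω, fun γ z u τ => (hΩc γ).cocycle_eq, fun γ z v τ => (hΩc γ).cocycle_eq, ?_,
    fun γ => (hΩc γ).isModularOn, fun z τ hτ => ?_⟩
  · intro γ γ' z τ hτ hz
    -- Both sides act in the same way on the invertible matrix U(z, u, τ), which can then be
    -- cancelled on the right.
    obtain ⟨u, hr⟩ := AppellLerch.exists_regular hτ hz
    have hU : IsUnit (AppellLerch.UJ (z, u) τ) :=
      (Matrix.isUnit_iff_isUnit_det _).2 (isUnit_iff_ne_zero.2 (AppellLerch.det_UJ_ne_zero hr))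
    apply hU.mul_left_injective
    change Ω (γ * γ') (z, τ) * AppellLerch.UJ (z, u) τ = _ * AppellLerch.UJ (z, u) τ
    rw [← (hΩc (γ * γ')).slash_eq z u τ hr, (hΩc γ).slash_mul_eq hr, (hΩc γ').slash_eq z u τ hr,
      mul_assoc]
    rfl
  · simpa [hΩ] using hFS' z τ hτ
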